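/- For a finite group $G$, let $\omega(G)$ denote the set of orders of elements of $G$. The prime graph $GK(G)$ is the graph whose vertices are the prime divisors of $|G|$, in which two vertices $p$ and $q$ are adjacent if and only if $p\neq q$ and $pq\in\omega(G)$. Let $t(G)$ denote the maximum number of pairwise nonadjacent vertices of $GK(G)$. Let $L$ be a finite group with $t(L)\geqslant 4$. If $G$ is a finite group with $\omega(G)=\omega(L\times L)$, then $G$ is nonsolvable. -/

import Mathlib

/-- The spectrum `ω(G)` of a group `G`: the set of orders of its elements
(used only for finite groups). -/
def groupSpectrum (G : Type*) [Group G] : Set ℕ :=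
  Set.range (fun g : G => orderOf g)

/-- The prime graph `GK(G)` of a finite group `G`. Its vertices are the prime divisors
of the order of `G`; two vertices `p` and `q` are adjacent if and only if `p ≠ q`
and `p * q` is the order of an element of `G`. -/
def primeGraph (G : Type*) [Group G] : SimpleGraph (Nat.card G).primeFactors where
  Adj p q := p ≠ q ∧ (p : ℕ) * (q : ℕ) ∈ groupSpectrum G
  symm := ⟨fun p q h => ⟨h.1.symm, by rw [mul_comm]; exact h.2⟩⟩
  loopless := ⟨fun _ h => h.1 rfl⟩

/-- `t(G)`: the maximum number of pairwise nonadjacent vertices in the prime graph of `G`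
(the vertex set is finite, so the maximum is attained). -/
noncomputable def primeGraphIndepNum (G : Type*) [Group G] : ℕ :=
  (primeGraph G).indepNum

/-!
Let `p`, `q`, `r`, `s` be four pairwise nonadjacent primes of the prime graph of `L`. For any two of
them `L × L` has an element whose order is their product, but no element order is divisible by three
of them: two of the three would divide the order of the same component, and so be adjacent in the
prime graph of `L`. A solvable group `G` with the same element orders would inherit these two
properties, and they are contradictory (`not_isSolvable_of_groupSpectrum`).

Such a `G` has an elementary abelian subgroup of rank two for each of the four primes
(`exists_isRankTwo`): if there is none for `p`, then all subgroups of order `p` are conjugate, so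
the centralizer of one of them contains elements of the three other prime orders. No two elements of
distinct such orders commute in it, whereas a solvable group does not have three pairwise
nonadjacent primes (`false_of_noEdge`). Passing to a Hall subgroup, one may assume that `G` is a
`{p, q, r, s}`-group, so that no three commuting elements have distinct prime orders; this is
`NoCommutingTriple`.

The main tool is an elementary form of the theorem on Frobenius actions: let `K` and `P` be groups
of prime power orders, normalised by an element `d` of prime order, with `K` acting on `P` and the
three primes distinct. If `d` has no fixed points on `P` and the elements of `K` commuting with `d`
act trivially on `P`, then `K` acts trivially on `P` (`commute_of_fixedPointFree`). Combined with the
fact that a `q`-group acted on by an elementary abelian `r`-group of rank two is generated by the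
fixed points of the nontrivial elements of the latter (`IsRankTwo.le_of_fixed_le`), it shows that a
group of rank two for one prime rarely commutes with an element of another prime order
(`fixedPts_eq_bot_of_commute_rankTwo`, `not_commute_rankTwo`).

A solvable group has a nontrivial `O_p(G)` for some prime, say `p`, and its Fitting subgroup
contains its own centralizer (`mem_pcore_of_commute`).

* If the Fitting subgroup is `O_p(G)`, then a Hall `{q, r, s}`-subgroup `H` is faithful on `O_p(G)`.
  If the Fitting subgroup of `H` involves one prime only, the configuration reduces to a tower of
  four groups of coprime orders, each acting nontrivially on the next one (`false_of_tower`). If it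
  involves two primes, then it has rank two for both of them (`exists_rankTwo_le_pcore`), which is
  impossible. Three primes would yield a commuting triple.
* If the Fitting subgroup is `O_p(G) × O_q(G)`, a Hall `{r, s}`-subgroup `B` acts faithfully on this
  product. Then the groups of rank two for `s` centralise `O_r(B)` and those for `r` centralise
  `O_s(B)` (`IsFaithfulOnPair.commute_of_isPGroup`), which leads to a contradiction in `B`
  (`IsFaithfulOnPair.false`).
* Three primes dividing the order of the Fitting subgroup would yield a commuting triple.
-/

namespace FourPrimes

open Subgroup
open scoped commutatorElement

/-! ### Coprime action -/

section CoprimeAction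

variable {G : Type*} [Group G]

theorem conj_mem_of_mem_normalizer {P : Subgroup G} {g x : G}
    (hg : g ∈ normalizer (P : Set G)) (hx : x ∈ P) : g * x * g⁻¹ ∈ P :=
  (mem_normalizer_iff.1 hg x).1 hx

theorem mem_normalizer_of_conj_mem [Finite G] {P : Subgroup G} {g : G}
    (h : ∀ x ∈ P, g * x * g⁻¹ ∈ P) : g ∈ normalizer (P : Set G) :=
  mem_normalizer_fintype h

theorem mem_normalizer_commutator {P Q : Subgroup G} {g : G} (hP : g ∈ normalizer (P : Set G))
    (hQ : g ∈ normalizer (Q : Set G)) : g ∈ normalizer ((⁅P, Q⁆ : Subgroup G) : Set G) := by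
  rw [mem_normalizer_iff_map_conj_eq] at *
  rw [map_commutator, hP, hQ]

theorem centralizer_le_normalizer {P : Subgroup G} :
    centralizer (P : Set G) ≤ normalizer (P : Set G) := by
  intro g hg
  rw [mem_normalizer_iff]
  intro x
  rw [mem_centralizer_iff] at hg
  constructor
  · intro hx
    rwa [← hg x hx, mul_inv_cancel_right]
  · intro hx
    have := hg _ hx
    have h2 : x = g * x * g⁻¹ := by
      have h3 : g * x = g * (g * x * g⁻¹) := by rw [← this]; group
      exact mul_left_cancel h3
    rwa [h2]

theorem normalizer_le_normalizer_centralizer {P : Subgroup G} :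
    normalizer (P : Set G) ≤ normalizer (centralizer (P : Set G) : Set G) := by
  have key : ∀ g ∈ normalizer (P : Set G), ∀ x ∈ centralizer (P : Set G),
      g * x * g⁻¹ ∈ centralizer (P : Set G) := by
    intro g hg x hx
    rw [mem_centralizer_iff] at hx ⊢
    intro y hy
    have hy' : g⁻¹ * y * g ∈ P := by
      simpa using conj_mem_of_mem_normalizer (inv_mem hg) hy
    have := hx _ hy'
    calc y * (g * x * g⁻¹) = g * ((g⁻¹ * y * g) * x) * g⁻¹ := by group
      _ = g * (x * (g⁻¹ * y * g)) * g⁻¹ := by rw [this]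
      _ = g * x * g⁻¹ * y := by group
  intro g hg
  rw [mem_normalizer_iff]
  refine fun x => ⟨key g hg x, fun hx => ?_⟩
  have := key _ (inv_mem hg) _ hx
  simpa [mul_assoc] using this

theorem not_dvd_card_of_isPGroup [Finite G] {p q : ℕ} [hp : Fact p.Prime] [hq : Fact q.Prime]
    (h : p ≠ q) {Q : Subgroup G} (hQ : IsPGroup q Q) : ¬ p ∣ Nat.card Q := by
  obtain ⟨n, hn⟩ := IsPGroup.iff_card.1 hQ
  rw [hn]
  intro hd
  exact h ((Nat.prime_dvd_prime_iff_eq hp.out hq.out).1 (hp.out.dvd_of_dvd_pow hd))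

theorem isPGroup_zpowers_of_pow_pow_eq_one {s k : ℕ} {d : G} (hd : d ^ s ^ k = 1) :
    IsPGroup s (zpowers d) := by
  rintro ⟨x, n, rfl⟩
  refine ⟨k, Subtype.ext ?_⟩
  change (d ^ n) ^ s ^ k = 1
  rw [← zpow_natCast, ← zpow_mul, mul_comm, zpow_mul, zpow_natCast, hd, one_zpow]

theorem isPGroup_zpowers_of_pow_eq_one {s : ℕ} {d : G} (hd : d ^ s = 1) :
    IsPGroup s (zpowers d) :=
  isPGroup_zpowers_of_pow_pow_eq_one (k := 1) (by rwa [pow_one])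

/-- If an `r`-group `R` normalises a subgroup `N` of order prime to `r` and stabilises the coset
`x N`, then it fixes an element of this coset: `R` permutes the coset, whose size is prime
to `r`. -/
theorem exists_commute_mul [Finite G] {r : ℕ} [Fact r.Prime] {R N : Subgroup G} (hR : IsPGroup r R)
    (hN : ¬ r ∣ Nat.card N) (hRN : R ≤ normalizer (N : Set G)) {x : G}
    (hx : ∀ ρ ∈ R, x⁻¹ * (ρ * x * ρ⁻¹) ∈ N) : ∃ n ∈ N, ∀ ρ ∈ R, Commute ρ (x * n) := by
  let α := {y : G // x⁻¹ * y ∈ N}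
  let e : α ≃ N :=
    { toFun := fun y => ⟨x⁻¹ * y.1, y.2⟩
      invFun := fun n => ⟨x * n.1, by simp⟩
      left_inv := fun y => by simp
      right_inv := fun n => by simp }
  let _ : MulAction R α :=
    { smul := fun ρ y => ⟨ρ.1 * y.1 * ρ.1⁻¹, by
        have h1 := hx ρ.1 ρ.2
        have h2 := conj_mem_of_mem_normalizer (hRN ρ.2) y.2
        have h3 := mul_mem h1 h2
        convert h3 using 1
        group⟩
      one_smul := fun y => Subtype.ext (by change (1 : G) * y.1 * (1 : G)⁻¹ = y.1; simp)
      mul_smul := fun a b y => Subtype.ext (by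
        change (a.1 * b.1) * y.1 * (a.1 * b.1)⁻¹ = a.1 * (b.1 * y.1 * b.1⁻¹) * a.1⁻¹
        group) }
  have hα : ¬ r ∣ Nat.card α := by rwa [Nat.card_congr e]
  obtain ⟨y, hy⟩ := hR.nonempty_fixed_point_of_prime_not_dvd_card α hα
  refine ⟨x⁻¹ * y.1, y.2, fun ρ hρ => ?_⟩
  have h1 : ρ * y.1 * ρ⁻¹ = y.1 := congrArg Subtype.val (hy ⟨ρ, hρ⟩)
  rw [mul_inv_cancel_left]
  exact mul_inv_eq_iff_eq_mul.1 h1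

/-- The case of `exists_commute_mul` for a single element of prime order. -/
theorem exists_commute_mul_of_pow_eq_one [Finite G] {s : ℕ} [Fact s.Prime] {d : G} {N : Subgroup G}
    (hd : d ^ s = 1) (hN : ¬ s ∣ Nat.card N) (hdN : d ∈ normalizer (N : Set G)) {x : G}
    (hx : x⁻¹ * (d * x * d⁻¹) ∈ N) : ∃ n ∈ N, Commute d (x * n) := by
  have hle : zpowers d ≤ normalizer (N : Set G) := by rwa [zpowers_le]
  have hx' : ∀ ρ ∈ zpowers d, x⁻¹ * (ρ * x * ρ⁻¹) ∈ N := by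
    intro ρ hρ
    obtain ⟨n, rfl⟩ := (isOfFinOrder_of_finite d).mem_powers_iff_mem_zpowers.2 hρ
    induction n with
    | zero => simp
    | succ n ih =>
      have h1 := mul_mem hx (conj_mem_of_mem_normalizer hdN (ih ⟨n, by simp⟩))
      convert h1 using 1
      simp only [pow_succ']
      group
  obtain ⟨n, hn, h⟩ :=
    exists_commute_mul (isPGroup_zpowers_of_pow_eq_one hd) hN hle hx'
  exact ⟨n, hn, h d (mem_zpowers d)⟩

/-- An `r`-group acting trivially on a normal subgroup `N` of order prime to `r` and on the cosets
of `N` acts trivially. -/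
theorem commute_of_commutator_mem [Finite G] {r : ℕ} [Fact r.Prime] {R N : Subgroup G}
    (hR : IsPGroup r R) (hN : ¬ r ∣ Nat.card N) (hRN : ∀ ρ ∈ R, ∀ n ∈ N, Commute ρ n) {x : G}
    (hx : ∀ ρ ∈ R, x⁻¹ * (ρ * x * ρ⁻¹) ∈ N) : ∀ ρ ∈ R, Commute ρ x := by
  have hle : R ≤ normalizer (N : Set G) := fun ρ hρ =>
    centralizer_le_normalizer (mem_centralizer_iff.2 fun n hn => (hRN ρ hρ n hn).symm.eq)
  obtain ⟨n, hn, h⟩ := exists_commute_mul hR hN hle hx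
  intro ρ hρ
  have := (h ρ hρ).mul_right (hRN ρ hρ n hn).inv_right
  rwa [mul_inv_cancel_right] at this

/-- The norm argument on a commutative group `A`: if `d` has prime order, normalises `K`,
and fixes no nontrivial element of `K` or of `A`, then `K` acts trivially. -/
theorem eq_bot_of_fixedPointFree {A : Type*} [Group A] [Finite A] (hA : ∀ a b : A, a * b = b * a)
    {K : Subgroup (MulAut A)} {d : MulAut A} {s : ℕ} (hs : s.Prime) (hds : d ^ s = 1)
    (hdK : ∀ k ∈ K, d * k * d⁻¹ ∈ K) (hfK : ∀ k ∈ K, Commute d k → k = 1)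
    (hfA : ∀ a, d a = a → a = 1) (hcop : (Nat.card K).Coprime (Nat.card A)) : K = ⊥ := by
  let _ : CommGroup A := { (inferInstance : Group A) with mul_comm := hA }
  have : Finite (MulAut A) := Finite.of_injective (fun f : MulAut A => (f : A → A))
    DFunLike.coe_injective
  let _ : Fintype K := Fintype.ofFinite K
  have hdKi : ∀ i : ℕ, ∀ k ∈ K, d ^ i * k * (d ^ i)⁻¹ ∈ K := by
    intro i
    induction i with
    | zero => simp
    | succ i ih =>
      intro k hk
      convert hdK _ (ih k hk) using 1
      simp only [pow_succ']
      group
  -- the norm of every element over `⟨d⟩` is trivial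
  have hnorm : ∀ v : A, ∏ i ∈ Finset.range s, (d ^ i) v = 1 := by
    intro v
    apply hfA
    rw [map_prod]
    have h1 : ∀ i : ℕ, d ((d ^ i) v) = (d ^ (i + 1)) v := fun i => by
      rw [pow_succ']; rfl
    simp only [h1]
    have h2 := Finset.prod_range_succ (fun i => (d ^ i) v) s
    have h3 := Finset.prod_range_succ' (fun i => (d ^ i) v) s
    rw [h3] at h2
    simp only [hds, pow_zero] at h2
    exact mul_right_cancel h2
  rw [eq_bot_iff]
  intro k₀ hk₀
  rw [mem_bot]
  ext w
  have hmulapp : ∀ (a b : MulAut A) (x : A), (a * b) x = a (b x) := fun _ _ _ => rfl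
  have htot : ∏ k : K, ∏ i ∈ Finset.range s, ((k : MulAut A) * d ^ i * (k : MulAut A)⁻¹) w = 1 := by
    refine Finset.prod_eq_one fun k _ => ?_
    have := congrArg (k : MulAut A) (hnorm ((k : MulAut A)⁻¹ w))
    rw [map_prod, map_one] at this
    simpa only [hmulapp] using this
  rw [Finset.prod_comm] at htot
  obtain ⟨m, rfl⟩ : ∃ m, s = m + 1 := ⟨s - 1, (Nat.sub_add_cancel hs.one_le).symm⟩
  rw [Finset.prod_range_succ'] at htot
  have h0 : ∏ k : K, ((k : MulAut A) * d ^ 0 * (k : MulAut A)⁻¹) w = w ^ Nat.card K := by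
    simp [Nat.card_eq_fintype_card]
  rw [h0] at htot
  -- conjugation turns the remaining factors into norms over `K`
  have hi : ∀ i ∈ Finset.range m, ∏ k : K, ((k : MulAut A) * d ^ (i + 1) * (k : MulAut A)⁻¹) w =
      ∏ k : K, (k : MulAut A) ((d ^ (i + 1)) w) := by
    intro i hi
    have hcop' : (i + 1).Coprime (orderOf d) := by
      refine Nat.Coprime.coprime_dvd_right (orderOf_dvd_of_pow_eq_one hds) ?_
      exact (Nat.coprime_of_lt_prime (by simp) (by simpa using hi) hs).symm
    obtain ⟨j, hj⟩ := exists_pow_eq_self_of_coprime hcop'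
    let φ : K → K := fun k => ⟨k * d ^ (i + 1) * (k : MulAut A)⁻¹ * (d ^ (i + 1))⁻¹, by
      have := mul_mem k.2 (hdKi (i + 1) _ (inv_mem k.2))
      convert this using 1
      group⟩
    have hφ : Function.Injective φ := by
      intro k l hkl
      have h1 : (k : MulAut A) * d ^ (i + 1) * (k : MulAut A)⁻¹ =
          (l : MulAut A) * d ^ (i + 1) * (l : MulAut A)⁻¹ :=
        mul_right_cancel (congrArg Subtype.val hkl)
      have h2 : Commute (d ^ (i + 1)) ((l : MulAut A)⁻¹ * k) := by
        change _ * _ = _ * _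
        calc d ^ (i + 1) * ((l : MulAut A)⁻¹ * k)
            = (l : MulAut A)⁻¹ * ((l : MulAut A) * d ^ (i + 1) * (l : MulAut A)⁻¹) * k := by group
          _ = (l : MulAut A)⁻¹ * ((k : MulAut A) * d ^ (i + 1) * (k : MulAut A)⁻¹) * k := by
            rw [h1]
          _ = (l : MulAut A)⁻¹ * k * d ^ (i + 1) := by group
      have h3 : Commute d ((l : MulAut A)⁻¹ * k) := by
        have := h2.pow_left j
        rwa [hj] at this
      have h4 := hfK _ (mul_mem (inv_mem l.2) k.2) h3
      exact Subtype.ext (inv_mul_eq_one.1 h4).symm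
    have hφb : Function.Bijective φ := Finite.injective_iff_bijective.1 hφ
    rw [← hφb.prod_comp (fun k : K => (k : MulAut A) ((d ^ (i + 1)) w))]
    refine Finset.prod_congr rfl fun k _ => ?_
    rw [← hmulapp]
    congr 1
    simp [φ]
  rw [Finset.prod_congr rfl hi] at htot
  have hinv : k₀ (w ^ Nat.card K) = w ^ Nat.card K := by
    have h5 : w ^ Nat.card K =
        (∏ i ∈ Finset.range m, ∏ k : K, (k : MulAut A) ((d ^ (i + 1)) w))⁻¹ :=
      eq_inv_of_mul_eq_one_right htot
    rw [h5, map_inv, map_prod]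
    congr 1
    refine Finset.prod_congr rfl fun i _ => ?_
    rw [map_prod]
    refine Fintype.prod_equiv (Equiv.mulLeft (⟨k₀, hk₀⟩ : K)) _ _ fun k => ?_
    rfl
  have h6 : (k₀ w * w⁻¹) ^ Nat.card K = 1 := by
    rw [mul_pow, inv_pow, ← map_pow, hinv, mul_inv_cancel]
  have h7 : orderOf (k₀ w * w⁻¹) = 1 := by
    refine Nat.eq_one_of_dvd_coprimes hcop (orderOf_dvd_of_pow_eq_one h6) (orderOf_dvd_natCard _)
  exact mul_inv_eq_one.1 (orderOf_eq_one_iff.1 h7)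

theorem coprime_card_section {u q : ℕ} [hu : Fact u.Prime] [hq : Fact q.Prime]
    (h : u ≠ q) {A B : Type*} [Group A] [Group B] [Finite A] [Finite B] (hA : IsPGroup u A)
    (hB : IsPGroup q B) : (Nat.card A).Coprime (Nat.card B) := by
  obtain ⟨n, hn⟩ := IsPGroup.iff_card.1 hA
  obtain ⟨m, hm⟩ := IsPGroup.iff_card.1 hB
  rw [hn, hm]
  exact Nat.Coprime.pow _ _ ((Nat.coprime_primes hu.out hq.out).2 h)

/-- The action by conjugation on the section `P / N` of the elements normalising `P` and `N`. -/
noncomputable def sectionHom (P N : Subgroup G) [(N.subgroupOf P).Normal] :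
    (normalizer (P : Set G) ⊓ normalizer (N : Set G) : Subgroup G) →*
      MulAut (P ⧸ N.subgroupOf P) where
  toFun t := QuotientGroup.congr _ _ (normalizerMonoidHom P ⟨t, t.2.1⟩) (by
    ext x
    constructor
    · rintro ⟨y, hy, rfl⟩
      exact conj_mem_of_mem_normalizer t.2.2 hy
    · intro hx
      have h1 : (t : G)⁻¹ * x * (t : G) ∈ P := by
        simpa using conj_mem_of_mem_normalizer (inv_mem t.2.1) x.2
      have h2 : (t : G)⁻¹ * x * (t : G) ∈ N := by
        simpa using conj_mem_of_mem_normalizer (inv_mem t.2.2) hx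
      refine ⟨⟨_, h1⟩, h2, Subtype.ext ?_⟩
      change (t : G) * ((t : G)⁻¹ * x * (t : G)) * (t : G)⁻¹ = x
      group)
  map_one' := by
    ext x
    induction x using QuotientGroup.induction_on with
    | H x =>
      refine congrArg (QuotientGroup.mk' _) (Subtype.ext ?_)
      change (1 : G) * x * (1 : G)⁻¹ = x
      simp
  map_mul' a b := by
    ext x
    induction x using QuotientGroup.induction_on with
    | H x =>
      refine congrArg (QuotientGroup.mk' _) (Subtype.ext ?_)
      change ((a : G) * b) * x * ((a : G) * b)⁻¹ = a * (b * x * (b : G)⁻¹) * (a : G)⁻¹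
      group

theorem sectionHom_mk {P N : Subgroup G} [(N.subgroupOf P).Normal]
    (t : (normalizer (P : Set G) ⊓ normalizer (N : Set G) : Subgroup G)) (x : P) :
    sectionHom P N t (x : P ⧸ N.subgroupOf P) =
      ((⟨t * x * (t : G)⁻¹, conj_mem_of_mem_normalizer t.2.1 x.2⟩ : P) : P ⧸ N.subgroupOf P) :=
  rfl

theorem sectionHom_mk_eq_iff {P N : Subgroup G} [(N.subgroupOf P).Normal]
    (t : (normalizer (P : Set G) ⊓ normalizer (N : Set G) : Subgroup G)) (x : P) :
    sectionHom P N t (x : P ⧸ N.subgroupOf P) = x ↔ ⁅(t : G), (x : G)⁆ ∈ N := by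
  rw [sectionHom_mk, QuotientGroup.eq_iff_div_mem, div_eq_mul_inv, mem_subgroupOf]
  rfl

theorem normal_subgroupOf_of_commutator_le {P N : Subgroup G} (hPN : ⁅P, P⁆ ≤ N) :
    (N.subgroupOf P).Normal := by
  refine ⟨fun n hn g => ?_⟩
  have h1 : ⁅(g : G), (n : G)⁆ ∈ N := hPN (commutator_mem_commutator g.2 n.2)
  have h2 := mul_mem h1 (mem_subgroupOf.1 hn)
  rw [mem_subgroupOf]
  convert h2 using 1
  simp [commutatorElement_def]

theorem section_mul_comm {P N : Subgroup G} [(N.subgroupOf P).Normal] (hPN : ⁅P, P⁆ ≤ N)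
    (a b : P ⧸ N.subgroupOf P) : a * b = b * a := by
  induction a using QuotientGroup.induction_on with
  | H a =>
    induction b using QuotientGroup.induction_on with
    | H b =>
      rw [← QuotientGroup.mk_mul, ← QuotientGroup.mk_mul, QuotientGroup.eq_iff_div_mem,
        mem_subgroupOf]
      have h1 : ⁅(a : G), (b : G)⁆ ∈ N := hPN (commutator_mem_commutator a.2 b.2)
      convert h1 using 1
      simp [commutatorElement_def, div_eq_mul_inv, mul_assoc]

/-- Let `d` have prime order and normalise the `u`-group `K`, let both act on an abelian section
`P / N` which is a `q`-group. If `d` fixes no nontrivial element of `P / N` and the elements of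
`K` commuting with `d` act trivially on `P / N`, then `K` acts trivially on `P / N`. -/
theorem commutator_mem_of_fixedPointFree [Finite G] {u s q : ℕ} [Fact u.Prime] [hs : Fact s.Prime]
    [Fact q.Prime] (hus : u ≠ s) (huq : u ≠ q) {K P N : Subgroup G} {d : G} (hK : IsPGroup u K)
    (hd : d ^ s = 1) (hP : IsPGroup q P) (hPN : ⁅P, P⁆ ≤ N)
    (hdK : d ∈ normalizer (K : Set G)) (hdP : d ∈ normalizer (P : Set G))
    (hdN : d ∈ normalizer (N : Set G)) (hKP : K ≤ normalizer (P : Set G))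
    (hKN : K ≤ normalizer (N : Set G)) (h1 : ∀ k ∈ K, Commute k d → ∀ x ∈ P, ⁅k, x⁆ ∈ N)
    (h2 : ∀ x ∈ P, ⁅d, x⁆ ∈ N → x ∈ N) : ∀ k ∈ K, ∀ x ∈ P, ⁅k, x⁆ ∈ N := by
  have := normal_subgroupOf_of_commutator_le hPN
  set T : Subgroup G := normalizer (P : Set G) ⊓ normalizer (N : Set G) with hT
  have hKT : K ≤ T := le_inf hKP hKN
  let d' : T := ⟨d, hdP, hdN⟩
  let K' : Subgroup T := K.subgroupOf T
  let φ := sectionHom P N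
  have hφ1 : ∀ k : T, φ k = 1 ↔ ∀ x ∈ P, ⁅(k : G), x⁆ ∈ N := by
    intro k
    constructor
    · intro h x hx
      rw [← sectionHom_mk_eq_iff k ⟨x, hx⟩]
      change φ k _ = _
      rw [h]; rfl
    · intro h
      ext x
      induction x using QuotientGroup.induction_on with
      | H x => exact (sectionHom_mk_eq_iff k x).2 (h x x.2)
  have hbot : K'.map φ = ⊥ := by
    refine eq_bot_of_fixedPointFree (d := φ d') (section_mul_comm hPN) hs.out ?_ ?_ ?_ ?_ ?_
    · rw [← map_pow]
      have : d' ^ s = 1 := Subtype.ext hd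
      rw [this, map_one]
    · rintro _ ⟨k, hk, rfl⟩
      have h3 : d' * k * d'⁻¹ ∈ K' :=
        mem_subgroupOf.2 (conj_mem_of_mem_normalizer hdK (mem_subgroupOf.1 hk))
      exact ⟨d' * k * d'⁻¹, h3, by simp [φ]⟩
    · rintro _ ⟨k, hk, rfl⟩ hc
      -- an element of `K` whose image commutes with `d` can be moved within its coset
      let K₀ : Subgroup G := φ.ker.map T.subtype ⊓ K
      have hK₀T : ∀ {y : T}, φ y = 1 → (y : G) ∈ K → (y : G) ∈ K₀ := fun {y} hy hyK =>
        ⟨⟨y, hy, rfl⟩, hyK⟩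
      have hdK₀ : d ∈ normalizer (K₀ : Set G) := by
        refine mem_normalizer_of_conj_mem ?_
        rintro _ ⟨⟨y, hy, rfl⟩, hyK⟩
        refine hK₀T (y := d' * y * d'⁻¹) ?_ (conj_mem_of_mem_normalizer hdK hyK)
        rw [map_mul, map_mul, MonoidHom.mem_ker.1 hy]
        simp
      have hcard : ¬ s ∣ Nat.card K₀ :=
        not_dvd_card_of_isPGroup hus.symm (hK.to_le inf_le_right)
      have hcos : (k : G)⁻¹ * (d * k * d⁻¹) ∈ K₀ := by
        refine hK₀T (y := k⁻¹ * (d' * k * d'⁻¹)) ?_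
          (mul_mem (inv_mem hk) (conj_mem_of_mem_normalizer hdK hk))
        simp only [map_mul, map_inv]
        rw [hc.eq]
        simp
      obtain ⟨n, hn, hcomm⟩ := exists_commute_mul_of_pow_eq_one hd hcard hdK₀ hcos
      obtain ⟨⟨n', hn', rfl⟩, hnK⟩ := hn
      have h3 : φ (k * n') = 1 := by
        rw [hφ1]
        exact h1 _ (mul_mem hk hnK) hcomm.symm
      rwa [map_mul, MonoidHom.mem_ker.1 hn', mul_one] at h3
    · intro a ha
      induction a using QuotientGroup.induction_on with
      | H a =>
        have := h2 a a.2 ((sectionHom_mk_eq_iff d' a).1 ha)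
        exact (QuotientGroup.eq_one_iff a).2 (mem_subgroupOf.2 this)
    · refine coprime_card_section huq ?_ (hP.to_quotient _)
      have hK' : IsPGroup u K' := hK.comap_subtype
      exact hK'.map φ
  intro k hk
  rw [← hφ1 ⟨k, hKT hk⟩]
  have h3 : φ ⟨k, hKT hk⟩ ∈ K'.map φ := ⟨⟨k, hKT hk⟩, hk, rfl⟩
  rwa [hbot, mem_bot] at h3

theorem commutator_lt_of_isPGroup [Finite G] {q : ℕ} [Fact q.Prime] {P : Subgroup G}
    (hP : IsPGroup q P) (h : P ≠ ⊥) : ⁅P, P⁆ < P := by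
  have : Nontrivial P := (nontrivial_iff_ne_bot P).2 h
  have : Group.IsNilpotent P := hP.isNilpotent
  have h1 := Group.IsSolvable.commutator_lt_top_of_nontrivial P
  refine lt_of_le_of_ne (commutator_le_self P) fun h2 => h1.ne ?_
  rw [← map_subtype_commutator] at h2
  refine map_injective P.subtype_injective ?_
  rw [h2, ← MonoidHom.range_eq_map, range_subtype]

theorem le_normalizer_self_commutator {P : Subgroup G} :
    P ≤ normalizer ((⁅P, P⁆ : Subgroup G) : Set G) :=
  fun _ hg => mem_normalizer_commutator (le_normalizer hg) (le_normalizer hg)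

/-- Let `d` have prime order and normalise the `u`-group `K`, let both act on the `q`-group `P`.
If `d` fixes no nontrivial element of `P` and the elements of `K` commuting with `d` act trivially
on `P`, then `K` acts trivially on `P`. For `C_K(d) = 1` this is the familiar statement that in a
Frobenius group acting coprimely, with the kernel acting nontrivially, the complement has nontrivial
fixed points. -/
theorem commute_of_fixedPointFree [Finite G] {u s q : ℕ} [Fact u.Prime] [hs : Fact s.Prime]
    [Fact q.Prime] (hus : u ≠ s) (huq : u ≠ q) (hsq : s ≠ q) {K : Subgroup G} {d : G}
    (hK : IsPGroup u K) (hd : d ^ s = 1) (hdK : d ∈ normalizer (K : Set G)) {P : Subgroup G}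
    (hP : IsPGroup q P) (hdP : d ∈ normalizer (P : Set G)) (hKP : K ≤ normalizer (P : Set G))
    (h1 : ∀ k ∈ K, Commute k d → ∀ x ∈ P, Commute k x)
    (h2 : ∀ x ∈ P, Commute d x → x = 1) : ∀ k ∈ K, ∀ x ∈ P, Commute k x := by
  induction hn : Nat.card P using Nat.strong_induction_on generalizing P with
  | _ n ih =>
  by_cases hbot : P = ⊥
  · subst hbot
    intro k _ x hx
    rw [mem_bot.1 hx]
    exact Commute.one_right k
  have hlt := commutator_lt_of_isPGroup hP hbot
  have hle : ⁅P, P⁆ ≤ P := hlt.le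
  have hdP' := mem_normalizer_commutator hdP hdP
  have hKP' : K ≤ normalizer ((⁅P, P⁆ : Subgroup G) : Set G) := fun k hk =>
    mem_normalizer_commutator (hKP hk) (hKP hk)
  have hcard : Nat.card (⁅P, P⁆ : Subgroup G) < n := by
    rw [← hn]
    exact Set.ncard_lt_ncard hlt
  have hind := ih _ hcard (hP.to_le hle) hdP' hKP' (fun k hk hc x hx => h1 k hk hc x (hle hx))
    (fun x hx => h2 x (hle hx)) rfl
  have htop : ∀ k ∈ K, ∀ x ∈ P, ⁅k, x⁆ ∈ ⁅P, P⁆ := by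
    refine commutator_mem_of_fixedPointFree hus huq hK hd hP le_rfl hdK hdP hdP' hKP hKP' ?_ ?_
    · intro k hk hc x hx
      rw [(h1 k hk hc x hx).commutator_eq]
      exact one_mem _
    · intro x hx hdx
      have h3 : x⁻¹ * (d * x * d⁻¹) ∈ ⁅P, P⁆ := by
        have := conj_mem_of_mem_normalizer (le_normalizer_self_commutator (inv_mem hx)) hdx
        convert this using 1
        rw [commutatorElement_def]; group
      obtain ⟨y, hy, hc⟩ := exists_commute_mul_of_pow_eq_one hd
        (not_dvd_card_of_isPGroup hsq (hP.to_le hle)) hdP' h3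
      have := h2 _ (mul_mem hx (hle hy)) hc
      rw [eq_inv_of_mul_eq_one_left this]
      exact inv_mem hy
  intro k hk x hx
  refine commute_of_commutator_mem hK (not_dvd_card_of_isPGroup huq (hP.to_le hle)) hind ?_ k hk
  intro ρ hρ
  have := conj_mem_of_mem_normalizer (le_normalizer_self_commutator (inv_mem hx)) (htop ρ hρ x hx)
  convert this using 1
  rw [commutatorElement_def]; group

theorem eq_one_of_pow_eq_one_of_mem {u s : ℕ} [hu : Fact u.Prime] [hs : Fact s.Prime] (h : u ≠ s)
    {K : Subgroup G} (hK : IsPGroup u K) {y : G} (hy : y ∈ K) (hys : y ^ s = 1) : y = 1 := by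
  obtain ⟨n, hn⟩ := hK ⟨y, hy⟩
  have hn' : y ^ u ^ n = 1 := congrArg Subtype.val hn
  have h1 : (u ^ n).Coprime s := Nat.Coprime.pow_left _ ((Nat.coprime_primes hu.out hs.out).2 h)
  exact orderOf_eq_one_iff.1 (Nat.eq_one_of_dvd_coprimes h1 (orderOf_dvd_of_pow_eq_one hn')
    (orderOf_dvd_of_pow_eq_one hys))

/-- The subgroup `[K, f]` of an abelian group `K` on which `f` acts with order prime to `|K|`:
`f` fixes none of its nontrivial elements. -/
theorem exists_commutator_subgroup [Finite G] {u s : ℕ} [Fact u.Prime] [Fact s.Prime] (hus : u ≠ s)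
    {K : Subgroup G} {f : G} (hK : IsPGroup u K) (hab : ∀ a ∈ K, ∀ b ∈ K, Commute a b)
    (hf : f ^ s = 1) (hfK : f ∈ normalizer (K : Set G)) :
    ∃ K' ≤ K, f ∈ normalizer (K' : Set G) ∧ (∀ k ∈ K', Commute k f → k = 1) ∧
      ∀ k ∈ K, ⁅k, f⁆ ∈ K' := by
  have hmem : ∀ k ∈ K, ⁅k, f⁆ ∈ K := fun k hk => by
    have := mul_mem hk (conj_mem_of_mem_normalizer hfK (inv_mem hk))
    rwa [commutatorElement_def, mul_assoc, mul_assoc, ← mul_assoc f]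
  let K' : Subgroup G :=
    { carrier := {y | ∃ k ∈ K, ⁅k, f⁆ = y}
      one_mem' := ⟨1, one_mem _, commutatorElement_one_left f⟩
      mul_mem' := by
        rintro _ _ ⟨k, hk, rfl⟩ ⟨l, hl, rfl⟩
        refine ⟨l * k, mul_mem hl hk, ?_⟩
        have h1 := hab l hl _ (hmem k hk)
        calc ⁅l * k, f⁆ = l * ⁅k, f⁆ * l⁻¹ * ⁅l, f⁆ := by simp only [commutatorElement_def]; group
          _ = ⁅k, f⁆ * ⁅l, f⁆ := by rw [h1.eq]; group
      inv_mem' := by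
        rintro _ ⟨k, hk, rfl⟩
        refine ⟨k⁻¹, inv_mem hk, ?_⟩
        have h1 := (hab k hk _ (inv_mem (hmem k hk)))
        calc ⁅k⁻¹, f⁆ = k⁻¹ * (⁅k, f⁆⁻¹ * k) := by simp only [commutatorElement_def]; group
          _ = ⁅k, f⁆⁻¹ := by rw [← h1.eq]; group }
  refine ⟨K', ?_, mem_normalizer_of_conj_mem ?_, ?_, fun k hk => ⟨k, hk, rfl⟩⟩
  · rintro _ ⟨k, hk, rfl⟩
    exact hmem k hk
  · rintro _ ⟨k, hk, rfl⟩
    refine ⟨f * k * f⁻¹, conj_mem_of_mem_normalizer hfK hk, ?_⟩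
    simp only [commutatorElement_def]; group
  · rintro _ ⟨k, hk, rfl⟩ hc
    have h1 : (⁅k, f⁆ * f) ^ s = 1 := by
      have : ⁅k, f⁆ * f = k * f * k⁻¹ := by rw [commutatorElement_def]; group
      rw [this, conj_pow, hf]; group
    rw [hc.mul_pow, hf, mul_one] at h1
    exact eq_one_of_pow_eq_one_of_mem hus hK (hmem k hk) h1

end CoprimeAction

/-! ### Elementary abelian subgroups of rank two -/

section RankTwo

/-- `E` is an elementary abelian `r`-group of rank two. -/
structure IsRankTwo {G : Type*} [Group G] (r : ℕ) (E : Subgroup G) : Prop where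
  card_eq : Nat.card E = r ^ 2
  pow_eq_one : ∀ x ∈ E, x ^ r = 1
  commute : ∀ x ∈ E, ∀ y ∈ E, Commute x y

/-- In a commutative group acted on by commuting `a` and `b` of prime order `r`, the `r`-th power
of any element is a product of elements fixed by `b` or by some `a * b ^ j`: multiply the norms
over these `r + 1` cyclic groups, and compare with the norm over the group they generate. -/
theorem pow_mem_of_fixed_mem {A : Type*} [Group A] (hA : ∀ a b : A, a * b = b * a) {r : ℕ}
    (hr : r.Prime) {a b : MulAut A} (ha : a ^ r = 1) (hb : b ^ r = 1) (hab : Commute a b)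
    (J : Subgroup A) (hJb : ∀ w, b w = w → w ∈ J) (hJ : ∀ j : ℕ, ∀ w, (a * b ^ j) w = w → w ∈ J)
    (w : A) : w ^ r ∈ J := by
  let _ : CommGroup A := { (inferInstance : Group A) with mul_comm := hA }
  have hmulapp : ∀ (a b : MulAut A) (x : A), (a * b) x = a (b x) := fun _ _ _ => rfl
  have hnorm : ∀ (c : MulAut A) (_ : c ^ r = 1) (v : A),
      c (∏ i ∈ Finset.range r, (c ^ i) v) = ∏ i ∈ Finset.range r, (c ^ i) v := by
    intro c hc v
    rw [map_prod]
    have h1 : ∀ i : ℕ, c ((c ^ i) v) = (c ^ (i + 1)) v := fun i => by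
      rw [pow_succ']; rfl
    simp only [h1]
    have h2 := Finset.prod_range_succ (fun i => (c ^ i) v) r
    have h3 := Finset.prod_range_succ' (fun i => (c ^ i) v) r
    rw [h3] at h2
    simp only [hc, pow_zero] at h2
    exact mul_right_cancel h2
  have hX : ∏ j ∈ Finset.range r, ∏ i ∈ Finset.range r, ((a * b ^ j) ^ i) w ∈ J := by
    refine prod_mem fun j _ => hJ j _ (hnorm _ ?_ _)
    rw [(hab.pow_right j).mul_pow, ha, ← pow_mul, mul_comm, pow_mul, hb, one_pow, one_mul]
  have hY : ∀ v : A, ∏ j ∈ Finset.range r, (b ^ j) v ∈ J := fun v => hJb _ (hnorm b hb v)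
  rw [Finset.prod_comm] at hX
  obtain ⟨m, rfl⟩ : ∃ m, r = m + 1 := ⟨r - 1, (Nat.sub_add_cancel hr.one_le).symm⟩
  rw [Finset.prod_range_succ'] at hX
  have h0 : ∏ j ∈ Finset.range (m + 1), ((a * b ^ j) ^ 0) w = w ^ (m + 1) := by simp
  have hi : ∏ i ∈ Finset.range m, ∏ j ∈ Finset.range (m + 1), ((a * b ^ j) ^ (i + 1)) w =
      ∏ i ∈ Finset.range m, ∏ j ∈ Finset.range (m + 1), (b ^ j) ((a ^ (i + 1)) w) := by
    refine Finset.prod_congr rfl fun i hi => ?_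
    have hi' : i + 1 < m + 1 := by simpa using hi
    have hcop : (m + 1).Coprime (i + 1) := Nat.coprime_of_lt_prime (by simp) hi' hr
    have hinj : Set.InjOn (fun j => (i + 1) * j % (m + 1)) (Finset.range (m + 1)) := by
      intro x hx y hy hxy
      have h1 : (i + 1) * x ≡ (i + 1) * y [MOD m + 1] := hxy
      have h2 := Nat.ModEq.cancel_left_of_coprime hcop h1
      exact Nat.ModEq.eq_of_lt_of_lt h2 (by simpa using hx) (by simpa using hy)
    have hmaps : Set.MapsTo (fun j => (i + 1) * j % (m + 1)) (Finset.range (m + 1))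
        (Finset.range (m + 1)) := by
      intro x _
      simpa using Nat.mod_lt _ (Nat.succ_pos m)
    refine Finset.prod_nbij (fun j => (i + 1) * j % (m + 1)) hmaps hinj
      (Finset.surjOn_of_injOn_of_card_le _ hmaps hinj le_rfl) fun j _ => ?_
    rw [← hmulapp, (hab.pow_right j).mul_pow, ← pow_mul, mul_comm j,
      pow_eq_pow_mod ((i + 1) * j) hb]
    exact congrFun (congrArg DFunLike.coe (hab.pow_pow _ _).eq) w
  rw [h0, hi] at hX
  have := Subgroup.prod_mem J (t := Finset.range m) fun i _ => hY ((a ^ (i + 1)) w)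
  exact (mul_mem_cancel_left this).1 hX

variable {G : Type*} [Group G]

theorem IsRankTwo.isPGroup {r : ℕ} {E : Subgroup G} (hE : IsRankTwo r E) : IsPGroup r E :=
  fun x => ⟨1, Subtype.ext (by simpa using hE.pow_eq_one x x.2)⟩

theorem IsRankTwo.exists_not_mem_zpowers {r : ℕ} [hr : Fact r.Prime] {E : Subgroup G}
    (hE : IsRankTwo r E) {b : G} (hb : b ∈ E) : ∃ a ∈ E, a ∉ zpowers b := by
  by_contra! h
  have h1 : E = zpowers b := le_antisymm h (by rwa [zpowers_le])
  have h2 := hE.card_eq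
  rw [h1, Nat.card_zpowers] at h2
  have h3 := Nat.le_of_dvd hr.out.pos (orderOf_dvd_of_pow_eq_one (hE.pow_eq_one b hb))
  have := hr.out.one_lt
  nlinarith

theorem IsRankTwo.exists_ne_one {r : ℕ} [hr : Fact r.Prime] {E : Subgroup G}
    (hE : IsRankTwo r E) : ∃ b ∈ E, b ≠ 1 := by
  obtain ⟨b, hb, h⟩ := hE.exists_not_mem_zpowers (one_mem E)
  exact ⟨b, hb, fun h1 => h (by rw [h1]; exact one_mem _)⟩

theorem mem_zpowers_of_mem_of_prime {r : ℕ} [hr : Fact r.Prime] {a x : G} (ha : a ^ r = 1)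
    (hx : x ∈ zpowers a) (hx1 : x ≠ 1) : a ∈ zpowers x := by
  have ha1 : a ≠ 1 := by rintro rfl; simp at hx; exact hx1 hx
  have hoa : orderOf a = r := orderOf_eq_prime ha ha1
  have hfin : IsOfFinOrder a := isOfFinOrder_iff_pow_eq_one.2 ⟨r, hr.out.pos, ha⟩
  obtain ⟨n, rfl⟩ := hfin.mem_powers_iff_mem_zpowers.2 hx
  have hcop : n.Coprime (orderOf a) := by
    rw [hoa]
    refine Nat.Coprime.symm ((Nat.coprime_or_dvd_of_prime hr.out n).resolve_right ?_)
    rintro ⟨m, rfl⟩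
    exact hx1 (by simp [pow_mul, ha])
  obtain ⟨m, hm⟩ := exists_pow_eq_self_of_coprime hcop
  exact ⟨m, by simpa using hm⟩

theorem exists_zpow_mul_zpow_of_mem_sup {a b x : G} (hab : Commute a b)
    (hx : x ∈ zpowers a ⊔ zpowers b) : ∃ i j : ℤ, x = a ^ i * b ^ j := by
  let f : zpowers a × zpowers b →* G :=
    MonoidHom.noncommCoprod (zpowers a).subtype (zpowers b).subtype (by
      rintro ⟨_, i, rfl⟩ ⟨_, j, rfl⟩
      exact hab.zpow_zpow i j)
  have hrange : f.range = zpowers a ⊔ zpowers b :=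
    (MonoidHom.noncommCoprod_range _ _ _).trans (by rw [range_subtype, range_subtype])
  rw [← hrange] at hx
  obtain ⟨⟨⟨_, i, rfl⟩, ⟨_, j, rfl⟩⟩, rfl⟩ := hx
  exact ⟨i, j, rfl⟩

theorem isRankTwo_sup {r : ℕ} [hr : Fact r.Prime] {a b : G} (ha : a ^ r = 1) (hb : b ^ r = 1)
    (hab : Commute a b) (hb1 : b ≠ 1) (hnot : a ∉ zpowers b) :
    IsRankTwo r (zpowers a ⊔ zpowers b) := by
  have ha1 : a ≠ 1 := fun h => hnot (by rw [h]; exact one_mem _)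
  have hcz : ∀ x ∈ zpowers a, ∀ y ∈ zpowers b, Commute x y := by
    rintro _ ⟨i, rfl⟩ _ ⟨j, rfl⟩
    exact hab.zpow_zpow i j
  let f : zpowers a × zpowers b →* G :=
    MonoidHom.noncommCoprod (zpowers a).subtype (zpowers b).subtype
      fun x y => hcz x x.2 y y.2
  have hrange : f.range = zpowers a ⊔ zpowers b :=
    (MonoidHom.noncommCoprod_range _ _ _).trans (by rw [range_subtype, range_subtype])
  have hmem : ∀ x ∈ zpowers a ⊔ zpowers b, ∃ i j : ℤ, x = a ^ i * b ^ j := fun x hx =>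
    exists_zpow_mul_zpow_of_mem_sup hab hx
  refine ⟨?_, ?_, ?_⟩
  · have hinj : Function.Injective f := by
      rw [injective_iff_map_eq_one]
      rintro ⟨x, y⟩ hxy
      have h1 : (x : G) * y = 1 := hxy
      have h2 : (x : G) = 1 := by
        by_contra hx1
        have h3 : (x : G) ∈ zpowers b := by
          rw [eq_inv_of_mul_eq_one_left h1]
          exact inv_mem y.2
        have h4 := mem_zpowers_of_mem_of_prime ha x.2 hx1
        exact hnot ((zpowers_le.2 h3) h4)
      rw [h2, one_mul] at h1
      exact Prod.ext (Subtype.ext h2) (Subtype.ext h1)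
    rw [← hrange, ← Nat.card_congr (MonoidHom.ofInjective hinj).toEquiv, Nat.card_prod,
      Nat.card_zpowers, Nat.card_zpowers, orderOf_eq_prime ha ha1, orderOf_eq_prime hb hb1, sq]
  · intro x hx
    obtain ⟨i, j, rfl⟩ := hmem x hx
    rw [(hab.zpow_zpow i j).mul_pow, ← zpow_natCast, ← zpow_natCast, ← zpow_mul, ← zpow_mul,
      mul_comm i, mul_comm j, zpow_mul, zpow_mul, zpow_natCast, zpow_natCast, ha, hb]
    simp
  · intro x hx y hy
    obtain ⟨i, j, rfl⟩ := hmem x hx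
    obtain ⟨k, l, rfl⟩ := hmem y hy
    exact (((Commute.refl a).zpow_zpow i k).mul_right (hab.zpow_zpow i l)).mul_left
      ((hab.symm.zpow_zpow j k).mul_right ((Commute.refl b).zpow_zpow j l))

theorem IsRankTwo.le_of_mem [Finite G] {r : ℕ} [hr : Fact r.Prime] {E S : Subgroup G}
    (hE : IsRankTwo r E) {b a : G} (hb : b ∈ E) (ha : a ∈ E) (hb1 : b ≠ 1) (hab : a ∉ zpowers b)
    (hbS : b ∈ S) (haS : a ∈ S) : E ≤ S := by
  have h1 := isRankTwo_sup (hE.pow_eq_one a ha) (hE.pow_eq_one b hb) (hE.commute a ha b hb) hb1 hab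
  have h2 : zpowers a ⊔ zpowers b ≤ E := sup_le (by rwa [zpowers_le]) (by rwa [zpowers_le])
  have h3 : zpowers a ⊔ zpowers b = E :=
    Subgroup.eq_of_le_of_card_ge h2 (by rw [h1.card_eq, hE.card_eq])
  rw [← h3]
  exact sup_le (by rwa [zpowers_le]) (by rwa [zpowers_le])

/-- A group of order prime to `r` acted on by an elementary abelian `r`-group `E` of rank two is
generated by the fixed points of the nontrivial elements of `E`. -/
theorem IsRankTwo.le_of_fixed_le [Finite G] {r q : ℕ} [hr : Fact r.Prime] [hq : Fact q.Prime]
    (hrq : r ≠ q) {E P : Subgroup G} (hE : IsRankTwo r E) (hP : IsPGroup q P)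
    (hEP : E ≤ normalizer (P : Set G)) {J : Subgroup G}
    (hJ : ∀ e ∈ E, e ≠ 1 → ∀ x ∈ P, Commute e x → x ∈ J) : P ≤ J := by
  induction hn : Nat.card P using Nat.strong_induction_on generalizing P with
  | _ n ih =>
  by_cases hbot : P = ⊥
  · rw [hbot]; exact bot_le
  have hlt := commutator_lt_of_isPGroup hP hbot
  have hle : ⁅P, P⁆ ≤ P := hlt.le
  have hEP' : E ≤ normalizer ((⁅P, P⁆ : Subgroup G) : Set G) := fun k hk =>
    mem_normalizer_commutator (hEP hk) (hEP hk)
  have hcard : Nat.card (⁅P, P⁆ : Subgroup G) < n := by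
    rw [← hn]
    exact Set.ncard_lt_ncard hlt
  have hind : ⁅P, P⁆ ≤ J := ih _ hcard (hP.to_le hle) hEP'
    (fun e he he1 x hx => hJ e he he1 x (hle hx)) rfl
  have := normal_subgroupOf_of_commutator_le (le_refl ⁅P, P⁆)
  obtain ⟨b, hb, hb1⟩ := hE.exists_ne_one
  obtain ⟨a, ha, hab⟩ := hE.exists_not_mem_zpowers hb
  let φ := sectionHom P ⁅P, P⁆
  let ι : E → (normalizer (P : Set G) ⊓ normalizer ((⁅P, P⁆ : Subgroup G) : Set G) : Subgroup G) :=
    fun e => ⟨e, hEP e.2, hEP' e.2⟩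
  let A := P ⧸ (⁅P, P⁆ : Subgroup G).subgroupOf P
  let J' : Subgroup A := (J.subgroupOf P).map (QuotientGroup.mk' _)
  -- fixed points of nontrivial elements of `E` on the abelianization come from fixed points on `P`
  have hfix : ∀ e : E, (e : G) ≠ 1 → ∀ w : A, φ (ι e) w = w → w ∈ J' := by
    intro e he w hw
    induction w using QuotientGroup.induction_on with
    | H w =>
      have h1 : ⁅(e : G), (w : G)⁆ ∈ ⁅P, P⁆ := (sectionHom_mk_eq_iff (ι e) w).1 hw
      have h3 : (w : G)⁻¹ * (e * w * (e : G)⁻¹) ∈ ⁅P, P⁆ := by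
        have := conj_mem_of_mem_normalizer (le_normalizer_self_commutator (inv_mem w.2)) h1
        convert this using 1
        rw [commutatorElement_def]; group
      obtain ⟨y, hy, hc⟩ := exists_commute_mul_of_pow_eq_one (hE.pow_eq_one e e.2)
        (not_dvd_card_of_isPGroup hrq (hP.to_le hle)) (hEP' e.2) h3
      have h4 := hJ e e.2 he _ (mul_mem w.2 (hle hy)) hc
      have h5 : (w : G) ∈ J := (mul_mem_cancel_right (hind hy)).1 h4
      exact ⟨w, h5, rfl⟩
  intro x hx
  have hpow : ((⟨x, hx⟩ : P) : A) ^ r ∈ J' := by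
    refine pow_mem_of_fixed_mem (section_mul_comm le_rfl) hr.out
      (a := φ (ι ⟨a, ha⟩)) (b := φ (ι ⟨b, hb⟩)) ?_ ?_ ?_ J' (hfix ⟨b, hb⟩ hb1) ?_ _
    · rw [← map_pow]
      convert map_one φ using 2
      exact Subtype.ext (hE.pow_eq_one a ha)
    · rw [← map_pow]
      convert map_one φ using 2
      exact Subtype.ext (hE.pow_eq_one b hb)
    · refine Commute.map ?_ φ
      exact Subtype.ext (hE.commute a ha b hb).eq
    · intro j w hw
      refine hfix ⟨a * b ^ j, mul_mem ha (pow_mem hb j)⟩ ?_ w ?_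
      · intro h
        apply hab
        rw [eq_inv_of_mul_eq_one_left h]
        exact inv_mem (pow_mem (mem_zpowers b) j)
      · convert hw using 2
        rw [← map_pow, ← map_mul]
        rfl
  rw [← QuotientGroup.mk_pow] at hpow
  obtain ⟨y, hy, hyx⟩ := hpow
  have h6 : (y : G)⁻¹ * x ^ r ∈ ⁅P, P⁆ := by
    have := QuotientGroup.eq.1 hyx
    exact this
  have h7 : x ^ r ∈ J := (mul_mem_cancel_left (inv_mem (mem_subgroupOf.1 hy))).1 (hind h6)
  obtain ⟨k, hk⟩ := hP ⟨x, hx⟩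
  have hk' : x ^ q ^ k = 1 := congrArg Subtype.val hk
  have hcop : r.Coprime (orderOf x) := by
    refine Nat.Coprime.coprime_dvd_right (orderOf_dvd_of_pow_eq_one hk') ?_
    exact Nat.Coprime.pow_right _ ((Nat.coprime_primes hr.out hq.out).2 hrq)
  obtain ⟨m, hm⟩ := exists_pow_eq_self_of_coprime hcop
  rw [← hm]
  exact pow_mem h7 m

theorem IsRankTwo.exists_commute [Finite G] {r q : ℕ} [hr : Fact r.Prime] [hq : Fact q.Prime]
    (hrq : r ≠ q) {E P : Subgroup G} (hE : IsRankTwo r E) (hP : IsPGroup q P)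
    (hEP : E ≤ normalizer (P : Set G)) (hne : P ≠ ⊥) :
    ∃ e ∈ E, e ≠ 1 ∧ ∃ x ∈ P, x ≠ 1 ∧ Commute e x := by
  by_contra! h
  refine hne (eq_bot_iff.2 (hE.le_of_fixed_le hrq hP hEP fun e he he1 x hx hc => ?_))
  by_contra hx1
  exact h e he he1 x hx hx1 hc

theorem exists_pow_prime_order [Finite G] {r : ℕ} [hr : Fact r.Prime] {R : Subgroup G}
    (hR : IsPGroup r R) (hne : R ≠ ⊥) : ∃ c ∈ R, c ≠ 1 ∧ c ^ r = 1 := by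
  have : Nontrivial R := (nontrivial_iff_ne_bot R).2 hne
  have hdvd : r ∣ Nat.card R := hR.card_eq_or_dvd.resolve_left
    (fun h => (Finite.one_lt_card (α := R)).ne' h)
  obtain ⟨c, hc⟩ := exists_prime_orderOf_dvd_card' r hdvd
  have hc' : orderOf (c : G) = r := by rw [Subgroup.orderOf_coe, hc]
  refine ⟨c, c.2, fun h => ?_, by rw [← hc', pow_orderOf_eq_one]⟩
  rw [h, orderOf_one] at hc'
  exact hr.out.one_lt.ne hc'

/-- A nontrivial `r`-group without elementary abelian subgroups of rank two has a central element
`c` of order `r`, and every element of order `r` is a power of `c`. -/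
theorem exists_unique_order [Finite G] {r : ℕ} [hr : Fact r.Prime] {R : Subgroup G}
    (hR : IsPGroup r R) (hne : R ≠ ⊥) (hrank : ∀ E ≤ R, ¬ IsRankTwo r E) :
    ∃ c ∈ R, c ≠ 1 ∧ c ^ r = 1 ∧ (∀ y ∈ R, Commute c y) ∧ ∀ y ∈ R, y ^ r = 1 → y ∈ zpowers c := by
  have : Nontrivial R := (nontrivial_iff_ne_bot R).2 hne
  have hZ := hR.bot_lt_center
  let Z : Subgroup G := (center R).map R.subtype
  have hZR : Z ≤ R := map_subtype_le _
  have hZne : Z ≠ ⊥ := by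
    intro h
    rw [map_eq_bot_iff_of_injective _ R.subtype_injective] at h
    exact hZ.ne' h
  obtain ⟨c, hc, hc1, hcr⟩ := exists_pow_prime_order (hR.to_le hZR) hZne
  have hcomm : ∀ y ∈ R, Commute c y := by
    obtain ⟨c', hc', rfl⟩ := hc
    intro y hy
    exact (congrArg Subtype.val (mem_center_iff.1 hc' ⟨y, hy⟩)).symm
  refine ⟨c, hZR hc, hc1, hcr, hcomm, fun y hy hyr => ?_⟩
  by_contra hnot
  exact hrank _ (sup_le (by rwa [zpowers_le]) (by rw [zpowers_le]; exact hZR hc))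
    (isRankTwo_sup hyr hcr (hcomm y hy).symm hc1 hnot)

end RankTwo

/-! ### Minimal subgroups with nontrivial coprime action -/

section Minimal

variable {G : Type*} [Group G]

/-- The power formula `(u v)ⁿ = uⁿ vⁿ [v⁻¹, u⁻¹] ^ (n choose 2)` when the commutator is central. -/
theorem mul_pow_of_commute_commutator {u v : G} (hu : Commute ⁅v⁻¹, u⁻¹⁆ u)
    (hv : Commute ⁅v⁻¹, u⁻¹⁆ v) (n : ℕ) :
    v ^ n * u = u * v ^ n * ⁅v⁻¹, u⁻¹⁆ ^ n ∧
      (u * v) ^ n = u ^ n * v ^ n * ⁅v⁻¹, u⁻¹⁆ ^ n.choose 2 := by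
  have hvu : v * u = u * v * ⁅v⁻¹, u⁻¹⁆ := by rw [commutatorElement_def]; group
  generalize ⁅v⁻¹, u⁻¹⁆ = c at *
  have h1 : ∀ n : ℕ, v ^ n * u = u * v ^ n * c ^ n := by
    intro n
    induction n with
    | zero => simp
    | succ n ih =>
      calc v ^ (n + 1) * u = v * (v ^ n * u) := by rw [pow_succ']; group
        _ = (v * u) * v ^ n * c ^ n := by rw [ih]; group
        _ = u * v * (c * v ^ n) * c ^ n := by rw [hvu]; group
        _ = u * v * (v ^ n * c) * c ^ n := by rw [(hv.pow_right n).eq]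
        _ = u * v ^ (n + 1) * c ^ (n + 1) := by rw [pow_succ' v, pow_succ' c]; group
  refine ⟨h1 n, ?_⟩
  induction n with
  | zero => simp
  | succ n ih =>
    have hcc : Commute (c ^ n.choose 2) (u * v) := (hu.mul_right hv).pow_left _
    calc (u * v) ^ (n + 1) = u ^ n * v ^ n * (c ^ n.choose 2 * (u * v)) := by
          rw [pow_succ, ih]; group
      _ = u ^ n * (v ^ n * u) * v * c ^ n.choose 2 := by rw [hcc.eq]; group
      _ = u ^ n * u * v ^ n * (c ^ n * v) * c ^ n.choose 2 := by rw [h1 n]; group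
      _ = u ^ n * u * v ^ n * (v * c ^ n) * c ^ n.choose 2 := by rw [(hv.pow_left n).eq]
      _ = u ^ (n + 1) * v ^ (n + 1) * (c ^ n * c ^ n.choose 2) := by
          rw [pow_succ, pow_succ]; group
      _ = u ^ (n + 1) * v ^ (n + 1) * c ^ (n + 1).choose 2 := by
          rw [← pow_add, Nat.choose_succ_succ n 1, Nat.choose_one_right]

theorem mem_normalizer_closure [Finite G] {S : Set G} {g : G} (h : ∀ x ∈ S, g * x * g⁻¹ ∈ S) :
    g ∈ normalizer (closure S : Set G) := by
  refine mem_normalizer_of_conj_mem fun x hx => ?_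
  induction hx using closure_induction with
  | mem x hx => exact subset_closure (h x hx)
  | one => simp
  | mul x y _ _ hx hy =>
    have := mul_mem hx hy
    convert this using 1
    group
  | inv x _ hx =>
    have := inv_mem hx
    convert this using 1
    group

/-- The `q`-th powers and commutators of a nontrivial `q`-group generate a proper subgroup. -/
theorem closure_pow_ne [Finite G] {q : ℕ} [hq : Fact q.Prime] {M : Subgroup G}
    (hM : IsPGroup q M) (hne : M ≠ ⊥) :
    closure ({y | ∃ m ∈ M, m ^ q = y} ∪ ((⁅M, M⁆ : Subgroup G) : Set G)) ≠ M := by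
  intro heq
  have hnorm := normal_subgroupOf_of_commutator_le (le_refl ⁅M, M⁆)
  let A := M ⧸ (⁅M, M⁆ : Subgroup G).subgroupOf M
  let _ : CommGroup A :=
    { (inferInstance : Group A) with mul_comm := section_mul_comm le_rfl }
  let f : A →* A := powMonoidHom q
  have hsurj : Function.Surjective f := by
    have h1 : ∀ x ∈ closure ({y | ∃ m ∈ M, m ^ q = y} ∪ ((⁅M, M⁆ : Subgroup G) : Set G)),
        ∃ h : x ∈ M, ((⟨x, h⟩ : M) : A) ∈ f.range := by
      intro x hx
      induction hx using closure_induction with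
      | mem x hx =>
        rcases hx with ⟨m, hm, rfl⟩ | hx
        · exact ⟨pow_mem hm q, ((⟨m, hm⟩ : M) : A), rfl⟩
        · refine ⟨commutator_le_self M hx, ?_⟩
          have h2 : ((⟨x, commutator_le_self M hx⟩ : M) : A) = 1 :=
            (QuotientGroup.eq_one_iff _).2 hx
          rw [h2]; exact one_mem _
      | one => exact ⟨one_mem _, one_mem f.range⟩
      | mul x y _ _ hx hy =>
        obtain ⟨hx, hx'⟩ := hx
        obtain ⟨hy, hy'⟩ := hy
        exact ⟨mul_mem hx hy, mul_mem hx' hy'⟩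
      | inv x _ hx =>
        obtain ⟨hx, hx'⟩ := hx
        exact ⟨inv_mem hx, inv_mem hx'⟩
    intro a
    induction a using QuotientGroup.induction_on with
    | H a =>
      obtain ⟨_, h⟩ := h1 a (by rw [heq]; exact a.2)
      exact h
  have hinj : Function.Injective f := Finite.injective_iff_surjective.2 hsurj
  have hA : IsPGroup q A := hM.to_quotient _
  have hnt : Nontrivial A := by
    by_contra h
    rw [not_nontrivial_iff_subsingleton] at h
    refine (commutator_lt_of_isPGroup hM hne).not_ge fun x hx => ?_
    have : ((⟨x, hx⟩ : M) : A) = 1 := Subsingleton.elim _ _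
    exact mem_subgroupOf.1 ((QuotientGroup.eq_one_iff (⟨x, hx⟩ : M)).1 this)
  have hdvd : q ∣ Nat.card A := hA.card_eq_or_dvd.resolve_left
    (fun h => (Finite.one_lt_card (α := A)).ne' h)
  obtain ⟨c, hc⟩ := exists_prime_orderOf_dvd_card' q hdvd
  have h3 : f c = f 1 := by
    change c ^ q = 1 ^ q
    rw [← hc, pow_orderOf_eq_one, one_pow]
  rw [hinj h3, orderOf_one] at hc
  exact hq.out.one_lt.ne hc

/-- Let the `r`-group `X` act nontrivially on the `q`-group `Q`, and let `Y` normalise both. A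
minimal `Y`-invariant subgroup `M` of `Q` on which `X` acts nontrivially is of class at most two,
`X` centralises its commutator subgroup, and `M` has exponent `q` when `q` is odd. -/
theorem exists_special_subgroup [Finite G] {r q : ℕ} [hr : Fact r.Prime] [hq : Fact q.Prime]
    (hrq : r ≠ q) {X Y Q : Subgroup G} (hX : IsPGroup r X) (hQ : IsPGroup q Q)
    (hYX : Y ≤ normalizer (X : Set G)) (hYQ : Y ≤ normalizer (Q : Set G)) (hXY : X ≤ Y)
    (hne : ¬ ∀ x ∈ X, ∀ y ∈ Q, Commute x y) :
    ∃ M ≤ Q, Y ≤ normalizer (M : Set G) ∧ (¬ ∀ x ∈ X, ∀ y ∈ M, Commute x y) ∧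
      (∀ x ∈ X, ∀ c ∈ ⁅M, M⁆, Commute x c) ∧ (∀ c ∈ ⁅M, M⁆, ∀ m ∈ M, Commute c m) ∧
      (q ≠ 2 → ∀ m ∈ M, m ^ q = 1) := by
  let F : Set (Subgroup G) := {M | M ≤ Q ∧ Y ≤ normalizer (M : Set G) ∧
    ¬ ∀ x ∈ X, ∀ y ∈ M, Commute x y}
  obtain ⟨M, ⟨hMQ, hYM, hXM⟩, hmin'⟩ := (Set.toFinite F).exists_minimal ⟨Q, le_rfl, hYQ, hne⟩
  have hmin : ∀ N ≤ M, Y ≤ normalizer (N : Set G) → N ≠ M → ∀ x ∈ X, ∀ y ∈ N, Commute x y := by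
    intro N hN hYN hNM
    by_contra h
    exact hNM (le_antisymm hN (hmin' ⟨hN.trans hMQ, hYN, h⟩ hN))
  have hM : IsPGroup q M := hQ.to_le hMQ
  have hMne : M ≠ ⊥ := by
    rintro rfl
    refine hXM fun x _ y hy => ?_
    rw [mem_bot.1 hy]
    exact Commute.one_right x
  set Φ := closure ({y | ∃ m ∈ M, m ^ q = y} ∪ ((⁅M, M⁆ : Subgroup G) : Set G)) with hΦ
  have hcΦ : ⁅M, M⁆ ≤ Φ := fun x hx => subset_closure (Or.inr hx)
  have hpΦ : ∀ m ∈ M, m ^ q ∈ Φ := fun m hm => subset_closure (Or.inl ⟨m, hm, rfl⟩)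
  have hΦM : Φ ≤ M := by
    rw [hΦ, closure_le]
    rintro x (⟨m, hm, rfl⟩ | hx)
    · exact pow_mem hm q
    · exact commutator_le_self M hx
  have hYΦ : Y ≤ normalizer (Φ : Set G) := by
    intro g hg
    refine mem_normalizer_closure ?_
    rintro x (⟨m, hm, rfl⟩ | hx)
    · exact Or.inl ⟨g * m * g⁻¹, conj_mem_of_mem_normalizer (hYM hg) hm, conj_pow⟩
    · exact Or.inr
        (conj_mem_of_mem_normalizer (mem_normalizer_commutator (hYM hg) (hYM hg)) hx)
  have hXΦ := hmin Φ hΦM hYΦ (closure_pow_ne hM hMne)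
  -- minimality forces `[X, M] = M`
  have hXMle : ⁅X, M⁆ ≤ M := le_normalizer_iff_commutator_le_right.1 (hXY.trans hYM)
  have hXMeq : ⁅X, M⁆ = M := by
    by_contra hcon
    have h1 := hmin ⁅X, M⁆ hXMle
      (fun g hg => mem_normalizer_commutator (hYX hg) (hYM hg)) hcon
    refine hXM fun x hx y hy => ?_
    refine commute_of_commutator_mem hX (not_dvd_card_of_isPGroup hrq (hM.to_le hXMle)) h1 ?_ x hx
    intro ρ hρ
    rw [commutator_comm]
    have := commutator_mem_commutator (inv_mem hy) hρ
    convert this using 1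
    rw [commutatorElement_def]; group
  -- the three subgroups lemma
  have hMΦ : ⁅M, Φ⁆ = ⊥ := by
    have h1 : ⁅⁅M, Φ⁆, X⁆ = ⊥ := by
      rw [commutator_eq_bot_iff_le_centralizer]
      intro c hc
      rw [mem_centralizer_iff]
      intro x hx
      exact (hXΦ x hx c (hcΦ (commutator_mono le_rfl hΦM hc))).eq
    have h2 : ⁅⁅Φ, X⁆, M⁆ = ⊥ := by
      have : ⁅Φ, X⁆ = ⊥ := by
        rw [commutator_eq_bot_iff_le_centralizer]
        intro c hc
        rw [mem_centralizer_iff]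
        intro x hx
        exact (hXΦ x hx c hc).eq
      rw [this, commutator_bot_left]
    have h3 := commutator_commutator_eq_bot_of_rotate h1 h2
    rwa [hXMeq] at h3
  have hcent : ∀ c ∈ Φ, ∀ m ∈ M, Commute c m := by
    intro c hc m hm
    exact (mem_centralizer_iff.1 ((commutator_eq_bot_iff_le_centralizer.1 hMΦ) hm) c hc)
  refine ⟨M, hMQ, hYM, hXM, fun x hx c hc => hXΦ x hx c (hcΦ hc),
    fun c hc m hm => hcent c (hcΦ hc) m hm, fun hq2 => ?_⟩
  -- for odd `q` the `q`-th power map is multiplicative on `M`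
  have hmul : ∀ u ∈ M, ∀ v ∈ M, (u * v) ^ q = u ^ q * v ^ q := by
    intro u hu v hv
    have hc : ⁅v⁻¹, u⁻¹⁆ ∈ Φ := hcΦ (commutator_mem_commutator (inv_mem hv) (inv_mem hu))
    obtain ⟨h1, h2⟩ := mul_pow_of_commute_commutator (hcent _ hc u hu) (hcent _ hc v hv) q
    rw [(hcent _ (hpΦ v hv) u hu).eq] at h1
    have h3 : ⁅v⁻¹, u⁻¹⁆ ^ q = 1 := (mul_eq_left.1 h1.symm)
    obtain ⟨j, hj⟩ := hq.out.dvd_choose_self two_ne_zero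
      (lt_of_le_of_ne hq.out.two_le (Ne.symm hq2))
    rw [h2, hj, pow_mul, h3, one_pow, mul_one]
  let T : Subgroup G :=
    { carrier := {m | m ∈ M ∧ m ^ q = 1}
      one_mem' := ⟨one_mem _, one_pow q⟩
      mul_mem' := fun {a b} ha hb =>
        ⟨mul_mem ha.1 hb.1, by rw [hmul a ha.1 b hb.1, ha.2, hb.2, one_mul]⟩
      inv_mem' := fun {a} ha => ⟨inv_mem ha.1, by rw [inv_pow, ha.2, inv_one]⟩ }
  have hT : ⁅X, M⁆ ≤ T := by
    rw [commutator_le]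
    intro x hx m hm
    have hxm := conj_mem_of_mem_normalizer (hYM (hXY hx)) hm
    refine ⟨mul_mem hxm (inv_mem hm), ?_⟩
    rw [commutatorElement_def, hmul _ hxm _ (inv_mem hm), conj_pow,
      (hXΦ x hx _ (hpΦ m hm)).eq, inv_pow]
    group
  rw [hXMeq] at hT
  exact fun m hm => (hT hm).2

/-- If all elements of order `q`, `q` odd, of a `q`-group lie in one cyclic group `⟨c⟩`, then a
group of order prime to `q` which centralises `c` centralises the whole `q`-group. -/
theorem commute_of_unique_order [Finite G] {r q : ℕ} [hr : Fact r.Prime] [hq : Fact q.Prime]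
    (hrq : r ≠ q) (hq2 : q ≠ 2) {X Q : Subgroup G} (hX : IsPGroup r X) (hQ : IsPGroup q Q)
    (hXQ : X ≤ normalizer (Q : Set G)) {c : G} (hc : ∀ y ∈ Q, y ^ q = 1 → y ∈ zpowers c)
    (hXc : ∀ x ∈ X, Commute x c) : ∀ x ∈ X, ∀ y ∈ Q, Commute x y := by
  by_contra h
  obtain ⟨M, hMQ, -, hXM, -, -, hexp⟩ :=
    exists_special_subgroup hrq hX hQ le_normalizer hXQ le_rfl h
  refine hXM fun x hx y hy => ?_
  obtain ⟨i, rfl⟩ := hc y (hMQ hy) (hexp hq2 y hy)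
  exact (hXc x hx).zpow_right i

/-- An element of prime order `s` normalising but not centralising a group of prime order `r`
forces `s ∣ r - 1`. -/
theorem dvd_sub_one_of_not_commute [Finite G] {r s : ℕ} [hr : Fact r.Prime] [hs : Fact s.Prime]
    {x c : G} (hx : x ^ s = 1) (hc : c ^ r = 1) (hxc : x * c * x⁻¹ ∈ zpowers c)
    (hne : ¬ Commute x c) : s ∣ r - 1 := by
  by_contra hdvd
  have hc1 : c ≠ 1 := by rintro rfl; exact hne (Commute.one_right x)
  have hoc : orderOf c = r := orderOf_eq_prime hc hc1
  obtain ⟨k, hk⟩ := (isOfFinOrder_of_finite c).mem_powers_iff_mem_zpowers.2 hxc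
  have hk : c ^ k = x * c * x⁻¹ := hk
  have hpow : ∀ n : ℕ, x ^ n * c * (x ^ n)⁻¹ = c ^ k ^ n := by
    intro n
    induction n with
    | zero => simp
    | succ n ih =>
      calc x ^ (n + 1) * c * (x ^ (n + 1))⁻¹ = x * (x ^ n * c * (x ^ n)⁻¹) * x⁻¹ := by
            rw [pow_succ']; group
        _ = (x * c * x⁻¹) ^ k ^ n := by rw [ih, conj_pow]
        _ = c ^ k ^ (n + 1) := by rw [← hk, ← pow_mul, pow_succ']
  have h1 := hpow s
  rw [hx] at h1
  have h2 : ((k : ZMod r)) ^ s = 1 := by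
    have h3 : c ^ 1 = c ^ k ^ s := by rw [← h1]; group
    rw [pow_inj_mod, hoc] at h3
    have := (ZMod.natCast_eq_natCast_iff' _ _ r).2 h3
    push_cast at this
    exact this.symm
  have hk0 : (k : ZMod r) ≠ 0 := by
    intro h0
    rw [h0, zero_pow hs.out.ne_zero] at h2
    exact zero_ne_one h2
  have h4 := ZMod.pow_card_sub_one_eq_one hk0
  have hcop : s.Coprime (r - 1) := (Nat.coprime_or_dvd_of_prime hs.out _).resolve_right hdvd
  have h5 : (k : ZMod r) = 1 := orderOf_eq_one_iff.1 (Nat.eq_one_of_dvd_coprimes hcop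
    (orderOf_dvd_of_pow_eq_one h2) (orderOf_dvd_of_pow_eq_one h4))
  have h6 : c ^ k = c ^ 1 := by
    rw [pow_inj_mod, hoc]
    refine (ZMod.natCast_eq_natCast_iff' _ _ r).1 ?_
    rw [h5, Nat.cast_one]
  rw [pow_one] at h6
  rw [h6] at hk
  exact hne (eq_mul_inv_iff_mul_eq.1 hk).symm

end Minimal

/-! ### The largest normal `t`-subgroup and the Fitting subgroup of a solvable group -/

section Core

variable {G : Type*} [Group G]

/-- `O_t(H)`, the largest normal `t`-subgroup of `H`, as a subgroup of the ambient group. -/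
def pcore (t : ℕ) (H : Subgroup G) : Subgroup G :=
  (sSup {N : Subgroup H | N.Normal ∧ IsPGroup t N}).map H.subtype

theorem pcore_le {t : ℕ} {H : Subgroup G} : pcore t H ≤ H :=
  map_subtype_le _

theorem le_pcore {t : ℕ} {H N : Subgroup G} (hN : N ≤ H) (hHN : H ≤ normalizer (N : Set G))
    (hNt : IsPGroup t N) : N ≤ pcore t H := by
  have h1 : (N.subgroupOf H).Normal := by
    refine ⟨fun n hn g => ?_⟩
    exact mem_subgroupOf.2 (conj_mem_of_mem_normalizer (hHN g.2) (mem_subgroupOf.1 hn))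
  have h2 : N.subgroupOf H ≤ sSup {N : Subgroup H | N.Normal ∧ IsPGroup t N} :=
    le_sSup ⟨h1, hNt.comap_subtype⟩
  intro x hx
  exact ⟨⟨x, hN hx⟩, h2 (mem_subgroupOf.2 hx), rfl⟩

theorem isPGroup_pcore {t : ℕ} [Fact t.Prime] {H : Subgroup G} : IsPGroup t (pcore t H) := by
  refine IsPGroup.map ?_ _
  exact Sylow.sSup_of_normal _ (fun N hN => hN.2) (fun N hN => hN.1)

theorem normal_sSup_of_normal {S : Set (Subgroup G)} (hS : ∀ N ∈ S, N.Normal) :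
    (sSup S).Normal := by
  rw [sSup_eq_iSup']
  have : ∀ N : S, (N : Subgroup G).Normal := fun N => hS N N.2
  infer_instance

theorem le_normalizer_map_subtype {H : Subgroup G} {N : Subgroup H} (hN : N.Normal) :
    H ≤ normalizer (N.map H.subtype : Set G) := by
  intro g hg
  rw [mem_normalizer_iff]
  have key : ∀ g ∈ H, ∀ x ∈ N.map H.subtype, g * x * g⁻¹ ∈ N.map H.subtype := by
    rintro g hg _ ⟨x, hx, rfl⟩
    exact ⟨⟨g, hg⟩ * x * ⟨g, hg⟩⁻¹, hN.conj_mem x hx _, rfl⟩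
  refine fun x => ⟨key g hg x, fun hx => ?_⟩
  have := key _ (inv_mem hg) _ hx
  simpa [mul_assoc] using this

theorem le_normalizer_pcore {t : ℕ} {H : Subgroup G} : H ≤ normalizer (pcore t H : Set G) :=
  le_normalizer_map_subtype (normal_sSup_of_normal fun _ hN => hN.1)

theorem normalizer_le_normalizer_map_of_characteristic {N : Subgroup G} {S : Subgroup N}
    (hS : S.Characteristic) :
    normalizer (N : Set G) ≤ normalizer (S.map N.subtype : Set G) := by
  have key : ∀ g ∈ normalizer (N : Set G), ∀ x ∈ S.map N.subtype,
      g * x * g⁻¹ ∈ S.map N.subtype := by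
    rintro g hg _ ⟨x, hx, rfl⟩
    have h1 := characteristic_iff_map_eq.1 hS (normalizerMonoidHom N ⟨g, hg⟩)
    have h2 : normalizerMonoidHom N ⟨g, hg⟩ x ∈ S := by
      rw [← h1]
      exact mem_map_of_mem _ hx
    exact ⟨_, h2, rfl⟩
  intro g hg
  rw [mem_normalizer_iff]
  refine fun x => ⟨key g hg x, fun hx => ?_⟩
  have := key _ (inv_mem hg) _ hx
  simpa [mul_assoc] using this

/-- The elements of `t`-power order of a normal nilpotent subgroup of `H` lie in `O_t(H)`. -/
theorem mem_pcore_of_isNilpotent [Finite G] {t : ℕ} [ht : Fact t.Prime] {H N : Subgroup G}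
    (hNH : N ≤ H) (hHN : H ≤ normalizer (N : Set G)) (hN : Group.IsNilpotent N) {x : G}
    (hx : x ∈ N) {k : ℕ} (hxt : x ^ t ^ k = 1) : x ∈ pcore t H := by
  have hz : IsPGroup t (zpowers (⟨x, hx⟩ : N)) := by
    rintro ⟨y, n, rfl⟩
    refine ⟨k, Subtype.ext (Subtype.ext ?_)⟩
    change (x ^ n) ^ t ^ k = 1
    rw [← zpow_natCast, ← zpow_mul, mul_comm, zpow_mul, zpow_natCast, hxt, one_zpow]
  obtain ⟨S, hS⟩ := hz.exists_le_sylow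
  have htfae : Group.IsNilpotent N ↔
      ∀ (p : ℕ) (_ : Fact p.Prime) (P : Sylow p N), (P : Subgroup N).Normal :=
    Group.isNilpotent_of_finite_tfae.out 0 3
  have hSn : (S : Subgroup N).Normal := htfae.1 hN t ht S
  have hchar := S.characteristic_of_normal hSn
  have h1 : (S : Subgroup N).map N.subtype ≤ pcore t H :=
    le_pcore ((map_subtype_le _).trans hNH)
      (hHN.trans (normalizer_le_normalizer_map_of_characteristic hchar)) (S.2.map _)
  exact h1 ⟨⟨x, hx⟩, hS (mem_zpowers _), rfl⟩

/-- A subgroup containing all powers of `x` of prime power order contains `x`. -/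
theorem mem_of_prime_pow_mem [Finite G] {S : Subgroup G} {x : G}
    (h : ∀ t : ℕ, t.Prime → ∀ y ∈ zpowers x, ∀ k : ℕ, y ^ t ^ k = 1 → y ∈ S) : x ∈ S := by
  induction hn : orderOf x using Nat.strong_induction_on generalizing x with
  | _ n ih =>
  by_cases hn1 : n = 1
  · rw [orderOf_eq_one_iff.1 (hn.trans hn1)]; exact one_mem S
  have hpos : 0 < n := hn ▸ orderOf_pos x
  have hp := Nat.minFac_prime hn1
  obtain ⟨a, m, hm, hnm⟩ := Nat.exists_eq_pow_mul_and_not_dvd hpos.ne' n.minFac hp.ne_one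
  have ha : a ≠ 0 := by
    rintro rfl
    rw [pow_zero, one_mul] at hnm
    exact hm (hnm ▸ n.minFac_dvd)
  generalize n.minFac = p at *
  have hm0 : m ≠ 0 := by rintro rfl; simp at hm
  have h1 : x ^ m ∈ S := by
    refine h p hp _ (pow_mem (mem_zpowers x) m) a ?_
    rw [← pow_mul, mul_comm, ← hnm, ← hn, pow_orderOf_eq_one]
  have h2 : x ^ p ^ a ∈ S := by
    have hord : orderOf (x ^ p ^ a) = m := by
      rw [orderOf_pow, hn, hnm, Nat.gcd_eq_right (Dvd.intro _ rfl),
        Nat.mul_div_cancel_left _ (pow_pos hp.pos a)]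
    refine ih m ?_ (fun t ht y hy => h t ht y ?_) hord
    · rw [hnm]
      exact lt_mul_of_one_lt_left (Nat.pos_of_ne_zero hm0) (Nat.one_lt_pow ha hp.one_lt)
    · exact (zpowers_le.2 (pow_mem (mem_zpowers x) _)) hy
  have hcop : (p ^ a).Coprime m := Nat.Coprime.pow_left _ ((Nat.Prime.coprime_iff_not_dvd hp).2 hm)
  have hb := Nat.gcd_eq_gcd_ab (p ^ a) m
  rw [hcop] at hb
  have : x = (x ^ p ^ a) ^ ((p ^ a).gcdA m) * (x ^ m) ^ ((p ^ a).gcdB m) := by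
    rw [← zpow_natCast, ← zpow_natCast, ← zpow_mul, ← zpow_mul, ← zpow_add, ← hb]
    simp
  rw [this]
  exact mul_mem (zpow_mem h2 _) (zpow_mem h1 _)

/-- The Fitting subgroup of a solvable group contains its centralizer: an element of `t`-power
order centralising every `O_u(H)` lies in `O_t(H)`. All terms of the derived series of the
centralizer `C` of the Fitting subgroup are central in `C`: if the next term is central, then the
given one is nilpotent, hence lies in the Fitting subgroup. -/
theorem mem_pcore_of_commute [Finite G] {t : ℕ} [ht : Fact t.Prime] {H : Subgroup G}
    (hH : Group.IsSolvable H) {x : G} (hxH : x ∈ H) {k : ℕ} (hxt : x ^ t ^ k = 1)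
    (hx : ∀ u : ℕ, u.Prime → ∀ y ∈ pcore u H, Commute x y) : x ∈ pcore t H := by
  let C : Subgroup G := H ⊓ ⨅ u : {u : ℕ // u.Prime}, centralizer (pcore (u : ℕ) H : Set G)
  have hmemC : ∀ y, y ∈ C ↔ y ∈ H ∧ ∀ u : ℕ, u.Prime → ∀ z ∈ pcore u H, Commute z y := by
    intro y
    simp only [C, mem_inf, mem_iInf, mem_centralizer_iff, Subtype.forall]
    rfl
  have hCH : C ≤ H := inf_le_left
  have hHC : H ≤ normalizer (C : Set G) := by
    intro g hg
    refine mem_normalizer_of_conj_mem fun y hy => ?_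
    rw [hmemC] at hy ⊢
    refine ⟨mul_mem (mul_mem hg hy.1) (inv_mem hg), fun u hu z hz => ?_⟩
    have h1 : g⁻¹ * z * g ∈ pcore u H := by
      simpa using conj_mem_of_mem_normalizer (le_normalizer_pcore (inv_mem hg)) hz
    have h2 := (hy.2 u hu _ h1)
    change z * (g * y * g⁻¹) = g * y * g⁻¹ * z
    calc z * (g * y * g⁻¹) = g * ((g⁻¹ * z * g) * y) * g⁻¹ := by group
      _ = g * (y * (g⁻¹ * z * g)) * g⁻¹ := by rw [h2.eq]
      _ = g * y * g⁻¹ * z := by group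
  have hsol : Group.IsSolvable C :=
    Group.isSolvable_of_isSolvable_injective (f := inclusion hCH) (inclusion_injective hCH)
  have hstep : ∀ i, (derivedSeries C (i + 1) ≤ center C) → derivedSeries C i ≤ center C := by
    intro i hi
    let D : Subgroup G := (derivedSeries C i).map C.subtype
    have hchar : (derivedSeries C i).Characteristic := derivedSeries_characteristic C i
    have hHD : H ≤ normalizer (D : Set G) :=
      hHC.trans (normalizer_le_normalizer_map_of_characteristic hchar)
    have hDC : D ≤ C := map_subtype_le _
    have hcomm : ∀ c ∈ ⁅D, D⁆, ∀ y ∈ C, Commute c y := by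
      intro c hc y hy
      rw [← map_commutator] at hc
      obtain ⟨c', hc', rfl⟩ := hc
      exact (congrArg Subtype.val (mem_center_iff.1 (hi hc') ⟨y, hy⟩)).symm
    have hnil : Group.IsNilpotent D := by
      refine Subgroup.isNilpotent_of_ker_le_center (Abelianization.of : D →* _) ?_
      rw [Abelianization.ker_of]
      intro c hc
      rw [mem_center_iff]
      intro y
      refine Subtype.ext ?_
      have hc' : (c : G) ∈ ⁅D, D⁆ := by
        rw [← map_subtype_commutator]
        exact ⟨c, hc, rfl⟩
      exact (hcomm c hc' y (hDC y.2)).symm.eq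
    intro d hd
    rw [mem_center_iff]
    intro y
    refine Subtype.ext ?_
    have hd' : (d : G) ∈ D := ⟨d, hd, rfl⟩
    have h1 : (d : G) ∈ centralizer {(y : G)} := by
      refine mem_of_prime_pow_mem fun u hu z hz k hzk => ?_
      have : Fact u.Prime := ⟨hu⟩
      have hzD : z ∈ D := (zpowers_le.2 hd') hz
      have hzu : z ∈ pcore u H := mem_pcore_of_isNilpotent (hDC.trans hCH) hHD hnil hzD hzk
      rw [mem_centralizer_singleton_iff]
      exact (((hmemC y).1 y.2).2 u hu z hzu).eq
    exact (mem_centralizer_singleton_iff.1 h1).symm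
  obtain ⟨n, hn⟩ := hsol.solvable
  have h0 : ∀ j, j ≤ n → derivedSeries C (n - j) ≤ center C := by
    intro j
    induction j with
    | zero => intro _; rw [Nat.sub_zero, hn]; exact bot_le
    | succ j ih =>
      intro hj
      refine hstep _ ?_
      rw [show n - (j + 1) + 1 = n - j by omega]
      exact ih (by omega)
  have htop : ∀ a : C, a ∈ center C := fun a => by
    have := h0 n le_rfl
    rw [Nat.sub_self, derivedSeries_zero] at this
    exact this (mem_top a)
  have hCnil : Group.IsNilpotent C := by
    refine Subgroup.isNilpotent_of_ker_le_center (Abelianization.of : C →* _) fun a _ => htop a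
  refine mem_pcore_of_isNilpotent hCH hHC hCnil ?_ hxt
  exact (hmemC x).2 ⟨hxH, fun u hu z hz => (hx u hu z hz).symm⟩

/-- A nontrivial solvable group has a nontrivial normal `t`-subgroup for some prime `t`. -/
theorem exists_pcore_ne_bot [Finite G] {H : Subgroup G} (hH : Group.IsSolvable H) (hne : H ≠ ⊥) :
    ∃ t : ℕ, t.Prime ∧ pcore t H ≠ ⊥ := by
  by_contra! h
  refine hne (eq_bot_iff.2 fun x hx => mem_of_prime_pow_mem fun t ht y hy k hyk => ?_)
  have : Fact t.Prime := ⟨ht⟩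
  rw [← h t ht]
  refine mem_pcore_of_commute hH ((zpowers_le.2 hx) hy) hyk fun u hu z hz => ?_
  rw [h u hu, mem_bot] at hz
  rw [hz]
  exact Commute.one_right y

/-- If in a normal subgroup `C` of `H` all elements whose order is a power of a prime other than
`t` are central in `C`, then `C` is nilpotent, so its elements of `t`-power order lie
in `O_t(H)`. -/
theorem mem_pcore_of_central [Finite G] {t : ℕ} [ht : Fact t.Prime] {H C : Subgroup G}
    (hCH : C ≤ H) (hHC : H ≤ normalizer (C : Set G))
    (hC : ∀ u : ℕ, u.Prime → u ≠ t → ∀ y ∈ C, ∀ k : ℕ, y ^ u ^ k = 1 → ∀ c ∈ C, Commute y c)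
    {x : G} (hx : x ∈ C) {k : ℕ} (hxt : x ^ t ^ k = 1) : x ∈ pcore t H := by
  refine mem_pcore_of_isNilpotent hCH hHC ?_ hx hxt
  have hq : IsPGroup t (C ⧸ center C) := by
    intro a
    induction a using QuotientGroup.induction_on with
    | H a =>
      obtain ⟨n, m, hm, hnm⟩ :=
        Nat.exists_eq_pow_mul_and_not_dvd (orderOf_pos a).ne' t ht.out.ne_one
      refine ⟨n, (QuotientGroup.eq_one_iff (a ^ t ^ n)).2 ?_⟩
      refine mem_of_prime_pow_mem fun u hu y hy j hyj => ?_
      have hord : orderOf (a ^ t ^ n) = m := by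
        rw [orderOf_pow, hnm, Nat.gcd_eq_right (Dvd.intro _ rfl),
          Nat.mul_div_cancel_left _ (pow_pos ht.out.pos n)]
      rw [mem_center_iff]
      intro c
      by_cases hut : u = t
      · subst hut
        have h1 : orderOf y ∣ m := by
          rw [← hord]
          exact orderOf_dvd_of_mem_zpowers hy
        have h2 := orderOf_dvd_of_pow_eq_one hyj
        have h3 : orderOf y = 1 := Nat.eq_one_of_dvd_coprimes
          (Nat.Coprime.pow_left j ((Nat.Prime.coprime_iff_not_dvd hu).2 hm)) h2 h1
        rw [orderOf_eq_one_iff.1 h3]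
        simp
      · exact Subtype.ext (hC u hu hut y y.2 j (congrArg Subtype.val hyj) c c.2).symm.eq
  exact Group.of_quotient_center_nilpotent hq.isNilpotent

end Core

/-! ### Hall subgroups of solvable groups -/

section Hall

/-- `K` is a Hall `π`-subgroup of `H`. -/
structure IsHall {G : Type*} [Group G] (π : Set ℕ) (K H : Subgroup G) : Prop where
  le : K ≤ H
  mem_of_dvd_card : ∀ p : ℕ, p.Prime → p ∣ Nat.card K → p ∈ π
  not_dvd_relIndex : ∀ p : ℕ, p.Prime → p ∈ π → ¬ p ∣ K.relIndex H

/-- Hall's existence theorem for the whole group, by induction on its order: take a normal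
`t`-subgroup `N ≠ 1` and the preimage `K` of a Hall subgroup of `G ⧸ N`; if `t ∉ π`, replace `K` by
a complement of `N` in it, given by the Schur–Zassenhaus theorem. -/
theorem exists_isHall_top {G : Type*} [Group G] [Finite G] (hG : Group.IsSolvable G) (π : Set ℕ) :
    ∃ K : Subgroup G, (∀ p : ℕ, p.Prime → p ∣ Nat.card K → p ∈ π) ∧
      ∀ p : ℕ, p.Prime → p ∈ π → ¬ p ∣ K.index := by
  induction hn : Nat.card G using Nat.strong_induction_on generalizing G with
  | _ n ih =>
  rcases subsingleton_or_nontrivial G with hs | hnt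
  · refine ⟨⊤, fun p hp hd => ?_, fun p hp _ hd => ?_⟩
    · rw [Nat.card_of_subsingleton (1 : (⊤ : Subgroup G))] at hd
      exact absurd (Nat.dvd_one.1 hd) hp.ne_one
    · rw [index_top] at hd
      exact hp.ne_one (Nat.dvd_one.1 hd)
  have hsol : Group.IsSolvable (⊤ : Subgroup G) :=
    Group.isSolvable_of_isSolvable_injective (f := (⊤ : Subgroup G).subtype) (subtype_injective _)
  obtain ⟨t, ht, hN⟩ := exists_pcore_ne_bot hsol top_ne_bot
  have : Fact t.Prime := ⟨ht⟩
  set N := pcore t (⊤ : Subgroup G) with hNdef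
  have hNn : N.Normal := normalizer_eq_top_iff.1 (eq_top_iff.2 le_normalizer_pcore)
  have hNt : IsPGroup t N := isPGroup_pcore
  have hcard : Nat.card (G ⧸ N) < n := by
    have h1 := card_eq_card_quotient_mul_card_subgroup N
    have : Nontrivial N := (nontrivial_iff_ne_bot N).2 hN
    have h2 := Finite.one_lt_card (α := N)
    have h3 : 0 < Nat.card (G ⧸ N) := Nat.card_pos
    rw [← hn, h1]
    exact lt_mul_of_one_lt_right h3 h2
  have hsolQ : Group.IsSolvable (G ⧸ N) :=
    Group.isSolvable_of_surjective (QuotientGroup.mk'_surjective N)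
  obtain ⟨L, hL1, hL2⟩ := ih _ hcard hsolQ rfl
  set K := L.comap (QuotientGroup.mk' N) with hK
  have hNK : N ≤ K := fun x hx => by
    change (x : G ⧸ N) ∈ L
    rw [(QuotientGroup.eq_one_iff x).2 hx]
    exact one_mem L
  have hKindex : K.index = L.index := index_comap_of_surjective _ (QuotientGroup.mk'_surjective N)
  have hrel : (N.subgroupOf K).index = Nat.card L := by
    have h1 : Nat.card K * K.index = Nat.card G := K.card_mul_index
    have h2 : Nat.card L * L.index = Nat.card (G ⧸ N) := L.card_mul_index
    have h3 := card_eq_card_quotient_mul_card_subgroup N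
    have h4 : Nat.card (N.subgroupOf K) * (N.subgroupOf K).index = Nat.card K :=
      (N.subgroupOf K).card_mul_index
    have h5 : Nat.card (N.subgroupOf K) = Nat.card N := Nat.card_congr (subgroupOfEquivOfLe hNK)
    have h6 : 0 < Nat.card N := Nat.card_pos
    have h7 : 0 < L.index := Nat.pos_of_ne_zero index_ne_zero_of_finite
    rw [h5] at h4
    rw [← h4, hKindex, h3, ← h2] at h1
    have h8 : Nat.card N * L.index * (N.subgroupOf K).index =
        Nat.card N * L.index * Nat.card L := by
      linarith
    exact Nat.eq_of_mul_eq_mul_left (Nat.mul_pos h6 h7) h8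
  have hKcard : Nat.card K = Nat.card N * Nat.card L := by
    have h4 : Nat.card (N.subgroupOf K) * (N.subgroupOf K).index = Nat.card K :=
      (N.subgroupOf K).card_mul_index
    rw [← h4, hrel, Nat.card_congr (subgroupOfEquivOfLe hNK).toEquiv]
  obtain ⟨a, ha⟩ := IsPGroup.iff_card.1 hNt
  by_cases htπ : t ∈ π
  · refine ⟨K, fun p hp hd => ?_, fun p hp hpπ => by rw [hKindex]; exact hL2 p hp hpπ⟩
    rw [hKcard] at hd
    rcases hp.dvd_mul.1 hd with h | h
    · rw [ha] at h
      rw [(Nat.prime_dvd_prime_iff_eq hp ht).1 (hp.dvd_of_dvd_pow h)]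
      exact htπ
    · exact hL1 p hp h
  · -- here `N` has order prime to its index in `K`, and a complement is a Hall subgroup
    have hcop : (Nat.card (N.subgroupOf K)).Coprime (N.subgroupOf K).index := by
      rw [hrel, Nat.card_congr (subgroupOfEquivOfLe hNK).toEquiv, ha]
      exact Nat.Coprime.pow_left _ ((Nat.Prime.coprime_iff_not_dvd ht).2
        fun h => htπ (hL1 t ht h))
    have hn' : (N.subgroupOf K).Normal := inferInstance
    obtain ⟨M, hM⟩ := exists_right_complement'_of_coprime hcop
    have hMcard : Nat.card M = Nat.card L := by
      rw [← hrel, hM.symm.index_eq_card]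
    have hMc : Nat.card (M.map K.subtype) = Nat.card L := by
      rw [← hMcard]
      exact (Nat.card_congr (M.equivMapOfInjective _ K.subtype_injective).toEquiv).symm
    have hidx : (M.map K.subtype).index = Nat.card N * L.index := by
      have h1 : Nat.card (M.map K.subtype) * (M.map K.subtype).index = Nat.card G :=
        (M.map K.subtype).card_mul_index
      have h2 : Nat.card K * K.index = Nat.card G := K.card_mul_index
      rw [← h2, hMc, hKcard, hKindex] at h1
      have h3 : 0 < Nat.card L := Nat.card_pos
      have h4 : Nat.card L * (M.map K.subtype).index = Nat.card L * (Nat.card N * L.index) := by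
        rw [h1]; ring
      exact Nat.eq_of_mul_eq_mul_left h3 h4
    refine ⟨M.map K.subtype, fun p hp hd => hL1 p hp (hMc ▸ hd), fun p hp hpπ hd => ?_⟩
    rw [hidx] at hd
    rcases hp.dvd_mul.1 hd with h | h
    · rw [ha] at h
      rw [(Nat.prime_dvd_prime_iff_eq hp ht).1 (hp.dvd_of_dvd_pow h)] at hpπ
      exact htπ hpπ
    · exact hL2 p hp hpπ h

variable {G : Type*} [Group G]

/-- **Hall's theorem**: a finite solvable group has a Hall `π`-subgroup for every set `π`
of primes. -/
theorem exists_isHall [Finite G] {H : Subgroup G} (hH : Group.IsSolvable H) (π : Set ℕ) :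
    ∃ K : Subgroup G, IsHall π K H := by
  obtain ⟨K, hK1, hK2⟩ := exists_isHall_top hH π
  refine ⟨K.map H.subtype, map_subtype_le _, fun p hp hd => hK1 p hp ?_, fun p hp hpπ => ?_⟩
  · rwa [← Nat.card_congr (K.equivMapOfInjective _ H.subtype_injective).toEquiv] at hd
  · have : (K.map H.subtype).relIndex H = K.index := by
      rw [relIndex, subgroupOf, comap_map_eq_self_of_injective H.subtype_injective]
    rw [this]
    exact hK2 p hp hpπ

/-- An `r`-subgroup is conjugate into any subgroup of index prime to `r`: it fixes a coset. -/
theorem exists_conj_mem {r : ℕ} [Fact r.Prime] {E K H : Subgroup G} (hE : IsPGroup r E)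
    (hEH : E ≤ H) (h : ¬ r ∣ K.relIndex H) :
    ∃ g ∈ H, ∀ e ∈ E, g⁻¹ * e * g ∈ K := by
  have hE' : IsPGroup r (E.subgroupOf H) := hE.comap_subtype
  obtain ⟨x, hx⟩ :=
    hE'.nonempty_fixed_point_of_prime_not_dvd_card (H ⧸ K.subgroupOf H) h
  induction x using QuotientGroup.induction_on with
  | H g =>
    refine ⟨g, g.2, fun e he => ?_⟩
    have h1 := hx ⟨⟨e, hEH he⟩, mem_subgroupOf.2 he⟩
    have h2 : ((⟨e, hEH he⟩ * g : H) : H ⧸ K.subgroupOf H) = (g : H ⧸ K.subgroupOf H) := h1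
    have h3 := mem_subgroupOf.1 (QuotientGroup.eq.1 h2.symm)
    simpa [mul_assoc] using h3

/-- Rank at least two for `r` passes to subgroups of index prime to `r`. -/
theorem IsRankTwo.exists_conj {r : ℕ} [Fact r.Prime] {E K H : Subgroup G} (hE : IsRankTwo r E)
    (hEH : E ≤ H) (h : ¬ r ∣ K.relIndex H) : ∃ E' ≤ K, IsRankTwo r E' := by
  obtain ⟨g, -, hg⟩ := exists_conj_mem hE.isPGroup hEH h
  refine ⟨E.map (MulAut.conj g⁻¹).toMonoidHom, ?_, ?_, ?_, ?_⟩
  · rintro _ ⟨e, he, rfl⟩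
    simpa using hg e he
  · rw [← hE.card_eq]
    exact (Nat.card_congr
      (E.equivMapOfInjective _ (MulAut.conj g⁻¹).injective).toEquiv).symm
  · rintro _ ⟨e, he, rfl⟩
    rw [← map_pow, hE.pow_eq_one e he, map_one]
  · rintro _ ⟨e, he, rfl⟩ _ ⟨f, hf, rfl⟩
    exact (hE.commute e he f hf).map _

/-- A Hall subgroup contains elements of every prime order in `π` dividing the group order. -/
theorem IsHall.exists_mem_of_mem {π : Set ℕ} {K H : Subgroup G} (h : IsHall π K H) {p : ℕ}
    [hp : Fact p.Prime] (hpπ : p ∈ π) {x : G} (hx : x ∈ H) (hx1 : x ≠ 1) (hxp : x ^ p = 1) :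
    ∃ y ∈ K, y ≠ 1 ∧ y ^ p = 1 := by
  obtain ⟨g, -, hg⟩ := exists_conj_mem (isPGroup_zpowers_of_pow_eq_one hxp) (zpowers_le.2 hx)
    (h.not_dvd_relIndex p hp.out hpπ)
  refine ⟨g⁻¹ * x * g, hg x (mem_zpowers x), fun h1 => hx1 ?_, ?_⟩
  · calc x = g * (g⁻¹ * x * g) * g⁻¹ := by group
      _ = 1 := by rw [h1]; group
  · have := conj_pow (i := p) (a := g⁻¹) (b := x)
    rw [inv_inv] at this
    rw [this, hxp]; group

theorem isSolvable_of_le {K H : Subgroup G} (hKH : K ≤ H) (hH : Group.IsSolvable H) :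
    Group.IsSolvable K :=
  Group.isSolvable_of_isSolvable_injective (f := inclusion hKH) (inclusion_injective hKH)

/-- Every prime with a nontrivial `O_t(K)` divides the order of `K`. -/
theorem dvd_card_of_pcore_ne_bot [Finite G] {t : ℕ} [ht : Fact t.Prime] {K : Subgroup G}
    (h : pcore t K ≠ ⊥) : t ∣ Nat.card K := by
  have : Nontrivial (pcore t K) := (nontrivial_iff_ne_bot _).2 h
  exact ((isPGroup_pcore.card_eq_or_dvd (p := t) (G := pcore t K)).resolve_left
    (Finite.one_lt_card (α := pcore t K)).ne').trans (card_dvd_of_le pcore_le)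

end Hall

/-! ### Groups without commuting elements of three distinct prime orders -/

section NoTriple

variable {G : Type*} [Group G]

/-- No three pairwise commuting elements of `G` have distinct prime orders. For finite `G` this
says that no element order is divisible by three distinct primes. -/
def NoCommutingTriple (G : Type*) [Group G] : Prop :=
  ∀ p q r : ℕ, p.Prime → q.Prime → r.Prime → p ≠ q → p ≠ r → q ≠ r → ∀ x y z : G,
    x ^ p = 1 → y ^ q = 1 → z ^ r = 1 → Commute x y → Commute x z → Commute y z →
      x = 1 ∨ y = 1 ∨ z = 1

theorem exists_zpow_of_isPGroup [Finite G] {p : ℕ} [Fact p.Prime] {P : Subgroup G}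
    (hP : IsPGroup p P) {x : G} (hx : x ∈ P) (hx1 : x ≠ 1) :
    ∃ i : ℤ, (x ^ i) ≠ 1 ∧ (x ^ i) ^ p = 1 := by
  obtain ⟨c, ⟨i, rfl⟩, hc1, hcp⟩ := exists_pow_prime_order (R := zpowers x)
    (hP.to_le (zpowers_le.2 hx)) (by rwa [Ne, zpowers_eq_bot])
  exact ⟨i, hc1, hcp⟩

/-- The form of `NoCommutingTriple` for elements of prime power order: pass to suitable powers. -/
theorem NoCommutingTriple.false [Finite G] (h : NoCommutingTriple G) {p q r : ℕ} [hp : Fact p.Prime]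
    [hq : Fact q.Prime] [hr : Fact r.Prime] (hpq : p ≠ q) (hpr : p ≠ r) (hqr : q ≠ r)
    {P Q R : Subgroup G} (hP : IsPGroup p P) (hQ : IsPGroup q Q) (hR : IsPGroup r R) {x y z : G}
    (hx : x ∈ P) (hy : y ∈ Q) (hz : z ∈ R) (hx1 : x ≠ 1) (hy1 : y ≠ 1) (hz1 : z ≠ 1)
    (hxy : Commute x y) (hxz : Commute x z) (hyz : Commute y z) : False := by
  obtain ⟨i, hi, hi'⟩ := exists_zpow_of_isPGroup hP hx hx1
  obtain ⟨j, hj, hj'⟩ := exists_zpow_of_isPGroup hQ hy hy1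
  obtain ⟨k, hk, hk'⟩ := exists_zpow_of_isPGroup hR hz hz1
  rcases h p q r hp.out hq.out hr.out hpq hpr hqr _ _ _ hi' hj' hk' (hxy.zpow_zpow i j)
    (hxz.zpow_zpow i k) (hyz.zpow_zpow j k) with h | h | h
  · exact hi h
  · exact hj h
  · exact hk h

/-- `C_P(d)`, the subgroup of elements of `P` commuting with `d`. -/
def fixedPts (P : Subgroup G) (d : G) : Subgroup G :=
  P ⊓ centralizer {d}

theorem mem_fixedPts {P : Subgroup G} {d x : G} : x ∈ fixedPts P d ↔ x ∈ P ∧ Commute d x := by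
  rw [fixedPts, mem_inf, mem_centralizer_singleton_iff]
  exact and_congr_right fun _ => ⟨fun h => h.symm, fun h => h.symm.eq⟩

theorem fixedPts_le {P : Subgroup G} {d : G} : fixedPts P d ≤ P :=
  inf_le_left

theorem fixedPts_eq_bot_iff {P : Subgroup G} {d : G} :
    fixedPts P d = ⊥ ↔ ∀ x ∈ P, Commute d x → x = 1 := by
  rw [eq_bot_iff]
  exact ⟨fun h x hx hc => mem_bot.1 (h (mem_fixedPts.2 ⟨hx, hc⟩)),
    fun h x hx => mem_bot.2 (h x (mem_fixedPts.1 hx).1 (mem_fixedPts.1 hx).2)⟩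

theorem exists_ne_one_of_ne_bot {P : Subgroup G} (h : P ≠ ⊥) : ∃ x ∈ P, x ≠ 1 := by
  by_contra! h1
  exact h (eq_bot_iff.2 fun x hx => mem_bot.2 (h1 x hx))

theorem ne_bot_of_mem {P : Subgroup G} {x : G} (hx : x ∈ P) (hx1 : x ≠ 1) : P ≠ ⊥ := by
  rintro rfl
  exact hx1 (mem_bot.1 hx)

theorem mem_normalizer_fixedPts [Finite G] {P : Subgroup G} {d g : G}
    (hg : g ∈ normalizer (P : Set G)) (hgd : Commute g d) :
    g ∈ normalizer (fixedPts P d : Set G) := by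
  refine mem_normalizer_of_conj_mem fun x hx => ?_
  rw [mem_fixedPts] at hx ⊢
  exact ⟨conj_mem_of_mem_normalizer hg hx.1,
    (hgd.symm.mul_right hx.2).mul_right hgd.symm.inv_right⟩

variable [Finite G] (hNT : NoCommutingTriple G)

include hNT

/-- An element `d` of order `s` commuting with an elementary abelian `r`-group of rank two acts
without fixed points on groups of order prime to `r` and `s`. -/
theorem fixedPts_eq_bot_of_commute_rankTwo {p r s : ℕ} [Fact p.Prime] [Fact r.Prime] [Fact s.Prime]
    (hpr : p ≠ r) (hps : p ≠ s) (hrs : r ≠ s) {P E : Subgroup G} (hP : IsPGroup p P)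
    (hE : IsRankTwo r E) (hEP : E ≤ normalizer (P : Set G)) {d : G} (hd : d ^ s = 1) (hd1 : d ≠ 1)
    (hdE : ∀ e ∈ E, Commute d e) : fixedPts P d = ⊥ := by
  by_contra hne
  obtain ⟨e, he, he1, x, hx, hx1, hex⟩ := hE.exists_commute hpr.symm (hP.to_le fixedPts_le)
    (fun e he => mem_normalizer_fixedPts (hEP he) (hdE e he).symm) hne
  obtain ⟨hxP, hdx⟩ := mem_fixedPts.1 hx
  exact hNT.false hpr hps hrs hP hE.isPGroup (isPGroup_zpowers_of_pow_eq_one hd) hxP he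
    (mem_zpowers d) hx1 he1 hd1 hex.symm hdx.symm (hdE e he).symm

/-- If a nontrivial `q`-group `Q` acts faithfully on a `p`-group `P`, and `d` of order `s` and an
elementary abelian `r`-group of rank two normalise both, then they do not commute. -/
theorem not_commute_rankTwo {p q r s : ℕ} [Fact p.Prime] [Fact q.Prime] [Fact r.Prime]
    [Fact s.Prime] (hpq : p ≠ q) (hpr : p ≠ r) (hps : p ≠ s) (hqr : q ≠ r) (hqs : q ≠ s)
    (hrs : r ≠ s) {P Q E : Subgroup G} (hP : IsPGroup p P) (hQ : IsPGroup q Q)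
    (hQP : Q ≤ normalizer (P : Set G)) (hfaith : ∀ y ∈ Q, (∀ x ∈ P, Commute y x) → y = 1)
    (hQne : Q ≠ ⊥) (hE : IsRankTwo r E) (hEP : E ≤ normalizer (P : Set G))
    (hEQ : E ≤ normalizer (Q : Set G)) {d : G} (hd : d ^ s = 1) (hd1 : d ≠ 1)
    (hdP : d ∈ normalizer (P : Set G)) (hdQ : d ∈ normalizer (Q : Set G))
    (hdE : ∀ e ∈ E, Commute d e) : False := by
  have h1 := fixedPts_eq_bot_iff.1
    (fixedPts_eq_bot_of_commute_rankTwo hNT hpr hps hrs hP hE hEP hd hd1 hdE)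
  have h2 := fixedPts_eq_bot_iff.1
    (fixedPts_eq_bot_of_commute_rankTwo hNT hqr hqs hrs hQ hE hEQ hd hd1 hdE)
  obtain ⟨y, hy, hy1⟩ := exists_ne_one_of_ne_bot hQne
  refine hy1 (hfaith y hy ?_)
  refine commute_of_fixedPointFree hqs hpq.symm hps.symm hQ hd hdQ hP hdP hQP ?_ h1 y hy
  intro k hk hc x _
  rw [h2 k hk hc.symm]
  exact Commute.one_left x

end NoTriple

/-! ### Towers of faithful actions -/

section Tower

variable {G : Type*} [Group G] [Finite G]

/-- There is no tower `D`, `R`, `Q`, `P` of groups of orders divisible by distinct primes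
`s`, `r`, `q`, `p`, with `D` elementary abelian of rank two, in which `Q` acts faithfully on `P`
and `[R, δ]` acts nontrivially on `Q` for every `δ ≠ 1` in `D`. The proof distinguishes whether
all `[R, δ]` still act nontrivially on the centre of `Q`. -/
theorem false_of_tower (hNT : NoCommutingTriple G) {p q r s : ℕ} [Fact p.Prime] [hq : Fact q.Prime]
    [Fact r.Prime] [Fact s.Prime] (hpq : p ≠ q) (hpr : p ≠ r) (hps : p ≠ s) (hqr : q ≠ r)
    (hqs : q ≠ s) (hrs : r ≠ s) {P Q R D : Subgroup G} (hP : IsPGroup p P) (hQ : IsPGroup q Q)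
    (hR : IsPGroup r R) (hD : IsRankTwo s D) (hQP : Q ≤ normalizer (P : Set G))
    (hRP : R ≤ normalizer (P : Set G)) (hRQ : R ≤ normalizer (Q : Set G))
    (hDP : D ≤ normalizer (P : Set G)) (hDQ : D ≤ normalizer (Q : Set G))
    (hDR : D ≤ normalizer (R : Set G)) (hfaith : ∀ y ∈ Q, (∀ x ∈ P, Commute y x) → y = 1)
    (hfaithR : ∀ δ ∈ D, δ ≠ 1 → ∃ x ∈ R, ∃ y ∈ Q, ¬ Commute ⁅x, δ⁆ y) : False := by
  have hDs : IsPGroup s D := hD.isPGroup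
  let A : Subgroup G := (center Q).map Q.subtype
  have hAQ : A ≤ Q := map_subtype_le _
  have hAq : IsPGroup q A := hQ.to_le hAQ
  have hAcomm : ∀ a ∈ A, ∀ y ∈ Q, Commute a y := by
    rintro _ ⟨a, ha, rfl⟩ y hy
    exact (congrArg Subtype.val (mem_center_iff.1 ha ⟨y, hy⟩)).symm
  have hNA : normalizer (Q : Set G) ≤ normalizer (A : Set G) :=
    normalizer_le_normalizer_map_of_characteristic inferInstance
  have hDA := hDQ.trans hNA
  have hRA := hRQ.trans hNA
  have hAne : A ≠ ⊥ := by
    obtain ⟨δ, hδ, hδ1⟩ := hD.exists_ne_one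
    obtain ⟨x, -, y, hy, hxy⟩ := hfaithR δ hδ hδ1
    have hQne : Q ≠ ⊥ := ne_bot_of_mem hy (by rintro rfl; exact hxy (Commute.one_right _))
    have : Nontrivial Q := (nontrivial_iff_ne_bot Q).2 hQne
    intro h
    rw [map_eq_bot_iff_of_injective _ Q.subtype_injective] at h
    exact hQ.bot_lt_center.ne' h
  have hcommR : ∀ x ∈ R, ∀ δ ∈ D, ⁅x, δ⁆ ∈ R := fun x hx δ hδ => by
    have := mul_mem hx (conj_mem_of_mem_normalizer (hDR hδ) (inv_mem hx))
    rwa [commutatorElement_def, mul_assoc, mul_assoc, ← mul_assoc δ]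
  obtain ⟨δ₁, hδ₁, hδ₁1, a₁, ha₁, ha₁1, hδa₁⟩ := hD.exists_commute hqs.symm hAq hDA hAne
  have hfixA₁ : fixedPts A δ₁ ≠ ⊥ := ne_bot_of_mem (mem_fixedPts.2 ⟨ha₁, hδa₁⟩) ha₁1
  have hδ₁s := hD.pow_eq_one δ₁ hδ₁
  by_cases hα : ∀ δ ∈ D, δ ≠ 1 → ∃ x ∈ R, ∃ a ∈ A, ¬ Commute ⁅x, δ⁆ a
  · -- no element of `D` has fixed points both on `A` and on `R`
    have hdich : ∀ δ ∈ D, δ ≠ 1 → fixedPts A δ ≠ ⊥ → fixedPts R δ = ⊥ := by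
      intro δ hδ hδ1 hA1
      by_contra hR1
      have hδs := hD.pow_eq_one δ hδ
      obtain ⟨c, hc, hc1, hcr⟩ := exists_pow_prime_order (hR.to_le fixedPts_le) hR1
      obtain ⟨hcR, hδc⟩ := mem_fixedPts.1 hc
      obtain ⟨a, ha, ha1⟩ := exists_ne_one_of_ne_bot hA1
      obtain ⟨haA, hδa⟩ := mem_fixedPts.1 ha
      have hV : fixedPts P δ = ⊥ := by
        by_contra hV
        obtain ⟨v, hv, hv1⟩ := exists_ne_one_of_ne_bot hV
        obtain ⟨hvP, hδv⟩ := mem_fixedPts.1 hv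
        have := commute_of_fixedPointFree (K := fixedPts A δ) (P := fixedPts P δ) hqr hpq.symm
          hpr.symm (hAq.to_le fixedPts_le) hcr (mem_normalizer_fixedPts (hRA hcR) hδc.symm)
          (hP.to_le fixedPts_le) (mem_normalizer_fixedPts (hRP hcR) hδc.symm)
          (fun k hk => mem_normalizer_fixedPts (hQP (hAQ (mem_fixedPts.1 hk).1))
            (mem_fixedPts.1 hk).2.symm) ?_ ?_ a ha v hv
        · exact hNT.false hpq hps hqs hP hAq hDs hvP haA hδ hv1 ha1 hδ1 this.symm hδv.symm
            hδa.symm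
        · intro k hk hkc x _
          obtain ⟨hkA, hδk⟩ := mem_fixedPts.1 hk
          by_cases hk1 : k = 1
          · rw [hk1]; exact Commute.one_left x
          · exact (hNT.false hqr hqs hrs hAq hR hDs hkA hcR hδ hk1 hc1 hδ1 hkc hδk.symm
              hδc.symm).elim
        · intro x hx hcx
          obtain ⟨hxP, hδx⟩ := mem_fixedPts.1 hx
          by_contra hx1
          exact hNT.false hpr hps hrs hP hR hDs hxP hcR hδ hx1 hc1 hδ1 hcx.symm hδx.symm hδc.symm
      obtain ⟨K', hK'A, hδK', hK'1, hK'c⟩ := exists_commutator_subgroup hqs hAq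
        (fun a ha b hb => hAcomm a ha b (hAQ hb)) hδs (hDA hδ)
      have hK'triv : ∀ k ∈ K', k = 1 := by
        intro k hk
        refine hfaith k (hAQ (hK'A hk)) ?_
        refine commute_of_fixedPointFree hqs hpq.symm hps.symm (hAq.to_le hK'A) hδs hδK' hP
          (hDP hδ) ((hK'A.trans hAQ).trans hQP) ?_ (fixedPts_eq_bot_iff.1 hV) k hk
        intro k hk hkc x _
        rw [hK'1 k hk hkc]
        exact Commute.one_left x
      have hδA : ∀ a ∈ A, Commute δ a := fun a ha =>
        (commutatorElement_eq_one_iff_commute.1 (hK'triv _ (hK'c a ha))).symm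
      obtain ⟨x, hx, a, ha, hxa⟩ := hα δ hδ hδ1
      refine hxa ?_
      have h1 : x⁻¹ * a * x ∈ A := by
        simpa using conj_mem_of_mem_normalizer (inv_mem (hRA hx)) ha
      have h2 : Commute (x * δ * x⁻¹) a := by
        change x * δ * x⁻¹ * a = a * (x * δ * x⁻¹)
        calc x * δ * x⁻¹ * a = x * (δ * (x⁻¹ * a * x)) * x⁻¹ := by group
          _ = x * ((x⁻¹ * a * x) * δ) * x⁻¹ := by rw [(hδA _ h1).eq]
          _ = a * (x * δ * x⁻¹) := by group
      rw [commutatorElement_def]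
      exact h2.mul_left (hδA a ha).inv_left
    have hR₁ := fixedPts_eq_bot_iff.1 (hdich δ₁ hδ₁ hδ₁1 hfixA₁)
    obtain ⟨d, hd, hd1, k, hk, a, ha, hka⟩ : ∃ d ∈ D, d ≠ 1 ∧ ∃ k ∈ fixedPts R d, ∃ a ∈ A,
        ¬ Commute k a := by
      by_contra! hcon
      have hRA' : R ≤ centralizer (A : Set G) := by
        refine hD.le_of_fixed_le hrs.symm hR hDR fun e he he1 x hx hex => ?_
        rw [mem_centralizer_iff]
        exact fun a ha => (hcon e he he1 x (mem_fixedPts.2 ⟨hx, hex⟩) a ha).symm.eq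
      obtain ⟨x, hx, a, ha, hxa⟩ := hα δ₁ hδ₁ hδ₁1
      exact hxa (mem_centralizer_iff.1 (hRA' (hcommR x hx δ₁ hδ₁)) a ha).symm
    have hds := hD.pow_eq_one d hd
    obtain ⟨d', hd', hd'd, hRd'⟩ : ∃ d' ∈ D, d' ∉ zpowers d ∧ fixedPts R d' ≠ ⊥ := by
      by_contra! hcon
      have hRd : R ≤ centralizer {d} := by
        refine hD.le_of_fixed_le hrs.symm hR hDR fun e he he1 x hx hex => ?_
        rw [mem_centralizer_singleton_iff]
        by_cases hed : e ∈ zpowers d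
        · obtain ⟨i, hi⟩ := mem_zpowers_of_mem_of_prime hds hed he1
          rw [← hi]
          exact (hex.zpow_left i).symm.eq
        · rw [fixedPts_eq_bot_iff.1 (hcon e he hed) x hx hex, one_mul, mul_one]
      obtain ⟨x, hx, a, ha, hxa⟩ := hα d hd hd1
      refine hxa ?_
      have h1 : Commute x d := mem_centralizer_singleton_iff.1 (hRd hx)
      rw [h1.commutator_eq]
      exact Commute.one_left a
    have hd'1 : d' ≠ 1 := by rintro rfl; exact hd'd (one_mem _)
    have hAd' : fixedPts A d' = ⊥ := by
      by_contra h
      exact hRd' (hdich d' hd' hd'1 h)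
    refine hka (commute_of_fixedPointFree (K := fixedPts R d) hrs hqr.symm hqs.symm
      (hR.to_le fixedPts_le) (hD.pow_eq_one d' hd')
      (mem_normalizer_fixedPts (hDR hd') (hD.commute d' hd' d hd)) hAq (hDA hd')
      (fixedPts_le.trans hRA) ?_ (fixedPts_eq_bot_iff.1 hAd') k hk a ha)
    intro k hk hkd' x _
    obtain ⟨hkR, hdk⟩ := mem_fixedPts.1 hk
    have h1 : D ≤ centralizer {k} := hD.le_of_mem hd hd' hd1 hd'd
      (mem_centralizer_singleton_iff.2 hdk.eq) (mem_centralizer_singleton_iff.2 hkd'.symm.eq)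
    rw [hR₁ k hkR (mem_centralizer_singleton_iff.1 (h1 hδ₁))]
    exact Commute.one_left x
  · push Not at hα
    obtain ⟨δ₀, hδ₀, hδ₀1, hδ₀A⟩ := hα
    let R' : Subgroup G := closure {y | ∃ x ∈ R, ⁅x, δ₀⁆ = y}
    have hR'R : R' ≤ R := by
      rw [closure_le]
      rintro _ ⟨x, hx, rfl⟩
      exact hcommR x hx δ₀ hδ₀
    have hR'r : IsPGroup r R' := hR.to_le hR'R
    have hDR' : D ≤ normalizer (R' : Set G) := by
      intro g hg
      refine mem_normalizer_closure ?_
      rintro _ ⟨x, hx, rfl⟩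
      refine ⟨g * x * g⁻¹, conj_mem_of_mem_normalizer (hDR hg) hx, ?_⟩
      rw [conjugate_commutatorElement, (hD.commute g hg δ₀ hδ₀).eq, mul_inv_cancel_right]
    have hR'A : ∀ x ∈ R', ∀ a ∈ A, Commute x a := by
      have h1 : R' ≤ centralizer (A : Set G) := by
        rw [closure_le]
        rintro _ ⟨x, hx, rfl⟩
        exact mem_centralizer_iff.2 fun a ha => (hδ₀A x hx a ha).symm.eq
      exact fun x hx a ha => (mem_centralizer_iff.1 (h1 hx) a ha).symm
    have hR'Q : ¬ ∀ x ∈ R', ∀ y ∈ Q, Commute x y := by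
      intro h
      obtain ⟨x, hx, y, hy, hxy⟩ := hfaithR δ₀ hδ₀ hδ₀1
      exact hxy (h _ (subset_closure ⟨x, hx, rfl⟩) y hy)
    obtain ⟨M, hMQ, hYM, hR'M, hMc, -, hMexp⟩ := exists_special_subgroup (Y := R' ⊔ D) hqr.symm
      hR'r hQ (sup_le le_normalizer hDR') (sup_le (hR'R.trans hRQ) hDQ) le_sup_left hR'Q
    have hR'nM : R' ≤ normalizer (M : Set G) := le_sup_left.trans hYM
    have hDM : D ≤ normalizer (M : Set G) := le_sup_right.trans hYM
    have hMq : IsPGroup q M := hQ.to_le hMQ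
    have hdich : ∀ δ ∈ D, δ ≠ 1 → fixedPts A δ ≠ ⊥ → fixedPts R' δ = ⊥ := by
      intro δ hδ hδ1 hA1
      by_contra hR1
      obtain ⟨c, hc, hc1⟩ := exists_ne_one_of_ne_bot hR1
      obtain ⟨hcR, hδc⟩ := mem_fixedPts.1 hc
      obtain ⟨a, ha, ha1⟩ := exists_ne_one_of_ne_bot hA1
      obtain ⟨haA, hδa⟩ := mem_fixedPts.1 ha
      exact hNT.false hqr hqs hrs hAq hR'r hDs haA hcR hδ ha1 hc1 hδ1 (hR'A c hcR a haA).symm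
        hδa.symm hδc.symm
    have hR₁ := fixedPts_eq_bot_iff.1 (hdich δ₁ hδ₁ hδ₁1 hfixA₁)
    obtain ⟨d, hd, hd1, k, hk, y, hy, hky⟩ : ∃ d ∈ D, d ≠ 1 ∧ ∃ k ∈ fixedPts R' d, ∃ y ∈ M,
        ¬ Commute k y := by
      by_contra! hcon
      have hRM : R' ≤ centralizer (M : Set G) := by
        refine hD.le_of_fixed_le hrs.symm hR'r hDR' fun e he he1 x hx hex => ?_
        rw [mem_centralizer_iff]
        exact fun a ha => (hcon e he he1 x (mem_fixedPts.2 ⟨hx, hex⟩) a ha).symm.eq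
      exact hR'M fun x hx m hm => (mem_centralizer_iff.1 (hRM hx) m hm).symm
    have hds := hD.pow_eq_one d hd
    have hk1 : k ≠ 1 := by rintro rfl; exact hky (Commute.one_left y)
    have hAd : fixedPts A d = ⊥ := by
      by_contra h
      exact ne_bot_of_mem hk hk1 (hdich d hd hd1 h)
    have hAd' := fixedPts_eq_bot_iff.1 hAd
    have hV : fixedPts P d ≠ ⊥ := by
      intro hV
      refine ha₁1 (hfaith a₁ (hAQ ha₁) ?_)
      refine commute_of_fixedPointFree hqs hpq.symm hps.symm hAq hds (hDA hd) hP (hDP hd)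
        (hAQ.trans hQP) ?_ (fixedPts_eq_bot_iff.1 hV) a₁ ha₁
      intro k hk hc x _
      rw [hAd' k hk hc.symm]
      exact Commute.one_left x
    have hKδ₁ : δ₁ ∈ normalizer (fixedPts R' d : Set G) :=
      mem_normalizer_fixedPts (hDR' hδ₁) (hD.commute δ₁ hδ₁ d hd)
    -- `D` has a common fixed point on `P`
    obtain ⟨v, hv, hv1⟩ : ∃ v ∈ fixedPts (fixedPts P d) δ₁, v ≠ 1 := by
      refine exists_ne_one_of_ne_bot fun hVδ => ?_
      obtain ⟨v, hv, hv1⟩ := exists_ne_one_of_ne_bot hV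
      have := commute_of_fixedPointFree (K := fixedPts R' d) (P := fixedPts P d) hrs hpr.symm
        hps.symm (hR'r.to_le fixedPts_le) hδ₁s hKδ₁ (hP.to_le fixedPts_le)
        (mem_normalizer_fixedPts (hDP hδ₁) (hD.commute δ₁ hδ₁ d hd))
        (fun k hk => mem_normalizer_fixedPts (hRP (hR'R (mem_fixedPts.1 hk).1))
          (mem_fixedPts.1 hk).2.symm) ?_ (fixedPts_eq_bot_iff.1 hVδ) k hk v hv
      · exact hNT.false hpr hps hrs hP hR'r hDs (mem_fixedPts.1 hv).1 (mem_fixedPts.1 hk).1 hd hv1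
          hk1 hd1 this.symm (mem_fixedPts.1 hv).2.symm (mem_fixedPts.1 hk).2.symm
      · intro k hk hc x _
        rw [hR₁ k (mem_fixedPts.1 hk).1 hc.symm]
        exact Commute.one_left x
    obtain ⟨hv, hδ₁v⟩ := mem_fixedPts.1 hv
    have hvP := (mem_fixedPts.1 hv).1
    obtain ⟨z, hz, hz1, hzq⟩ := exists_pow_prime_order (hAq.to_le fixedPts_le) hfixA₁
    obtain ⟨hzA, hδ₁z⟩ := mem_fixedPts.1 hz
    -- hence `C_Q(δ₁)` has a single subgroup of order `q`, and this one lies in `A`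
    have huniq : ∀ y ∈ Q, y ^ q = 1 → Commute δ₁ y → y ∈ zpowers z := by
      intro y hy hyq hδy
      by_contra hnot
      have hE := isRankTwo_sup hyq hzq (hAcomm z hzA y hy).symm hz1 hnot
      have hEQ : zpowers y ⊔ zpowers z ≤ fixedPts Q δ₁ :=
        sup_le (zpowers_le.2 (mem_fixedPts.2 ⟨hy, hδy⟩))
          (zpowers_le.2 (mem_fixedPts.2 ⟨hAQ hzA, hδ₁z⟩))
      obtain ⟨e, he, he1, x, hx, hx1, hex⟩ := hE.exists_commute hpq.symm
        (hP.to_le (fixedPts_le (d := δ₁)))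
        (fun e he => mem_normalizer_fixedPts (hQP (mem_fixedPts.1 (hEQ he)).1)
          (mem_fixedPts.1 (hEQ he)).2.symm)
        (ne_bot_of_mem (mem_fixedPts.2 ⟨hvP, hδ₁v⟩) hv1)
      obtain ⟨hxP, hδx⟩ := mem_fixedPts.1 hx
      obtain ⟨heQ, hδe⟩ := mem_fixedPts.1 (hEQ he)
      exact hNT.false hpq hps hqs hP hQ hDs hxP heQ hδ₁ hx1 he1 hδ₁1 hex.symm hδx.symm hδe.symm
    by_cases hq2 : q = 2
    · -- a unique involution is fixed by `d`
      have h1 : d * z * d⁻¹ ∈ A := conj_mem_of_mem_normalizer (hDA hd) hzA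
      have h2 : (d * z * d⁻¹) ^ q = 1 := by rw [conj_pow, hzq]; group
      have hdδ := hD.commute δ₁ hδ₁ d hd
      have h3 : d * z * d⁻¹ ∈ zpowers z :=
        huniq _ (hAQ h1) h2 ((hdδ.mul_right hδ₁z).mul_right hdδ.inv_right)
      have h4 : d * z * d⁻¹ ≠ 1 := by
        intro h
        apply hz1
        calc z = d⁻¹ * (d * z * d⁻¹) * d := by group
          _ = 1 := by rw [h]; group
      have h5 : d * z * d⁻¹ = z := by
        subst hq2
        obtain ⟨i, hi⟩ := h3
        have hi : z ^ i = d * z * d⁻¹ := hi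
        have hz2 : z ^ (2 : ℤ) = 1 := by exact_mod_cast hzq
        rcases Int.even_or_odd' i with ⟨j, rfl | rfl⟩
        · rw [zpow_mul, hz2, one_zpow] at hi
          exact absurd hi.symm h4
        · rw [zpow_add, zpow_mul, hz2, one_zpow, one_mul, zpow_one] at hi
          exact hi.symm
      exact hz1 (hAd' z hzA (mul_inv_eq_iff_eq_mul.1 h5))
    · set N := M ⊓ centralizer (R' : Set G) with hN
      have hNM : N ≤ M := inf_le_left
      have hR'N : ∀ x ∈ R', ∀ n ∈ N, Commute x n := fun x hx n hn =>
        mem_centralizer_iff.1 (mem_inf.1 hn).2 x hx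
      have hnorm : ∀ g, g ∈ normalizer (M : Set G) → g ∈ normalizer (R' : Set G) →
          g ∈ normalizer (N : Set G) := by
        intro g h1 h2
        refine mem_normalizer_of_conj_mem fun x hx => ⟨conj_mem_of_mem_normalizer h1 hx.1, ?_⟩
        exact conj_mem_of_mem_normalizer (normalizer_le_normalizer_centralizer h2) hx.2
      have hMN : ⁅M, M⁆ ≤ N := fun c hc =>
        ⟨commutator_le_self M hc, mem_centralizer_iff.2 fun x hx => (hMc x hx c hc).eq⟩
      have hKR' : fixedPts R' d ≤ R' := fixedPts_le
      have hδN := hnorm δ₁ (hDM hδ₁) (hDR' hδ₁)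
      have hMnN : M ≤ normalizer (N : Set G) := by
        intro m hm
        refine mem_normalizer_of_conj_mem fun n hn => ?_
        have h1 : ⁅m, n⁆ ∈ N := hMN (commutator_mem_commutator hm (hNM hn))
        have := mul_mem h1 hn
        rwa [commutatorElement_def, inv_mul_cancel_right] at this
      have hcos : ∀ {g x : G}, x ∈ M → ⁅g, x⁆ ∈ N → x⁻¹ * (g * x * g⁻¹) ∈ N := by
        intro g x hx h
        have := conj_mem_of_mem_normalizer (hMnN (inv_mem hx)) h
        convert this using 1
        rw [commutatorElement_def]; group
      have hact := commutator_mem_of_fixedPointFree (K := fixedPts R' d) (P := M) (N := N) hrs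
        hqr.symm (hR'r.to_le fixedPts_le) hδ₁s hMq hMN hKδ₁ (hDM hδ₁) hδN
        (hKR'.trans hR'nM)
        (fun k hk => hnorm k (hR'nM (hKR' hk)) (le_normalizer (hKR' hk))) ?_ ?_
      · refine hky (commute_of_commutator_mem (R := fixedPts R' d) (N := N)
          (hR'r.to_le fixedPts_le) (not_dvd_card_of_isPGroup hqr.symm (hMq.to_le hNM))
          (fun ρ hρ n hn => hR'N ρ (hKR' hρ) n hn) ?_ k hk)
        exact fun ρ hρ => hcos hy (hact ρ hρ y hy)
      · intro k hk hc x _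
        rw [hR₁ k (hKR' hk) hc.symm, commutatorElement_one_left]
        exact one_mem N
      · intro x hx hδx
        obtain ⟨n, hn, hc⟩ := exists_commute_mul_of_pow_eq_one hδ₁s
          (not_dvd_card_of_isPGroup hqs.symm (hMq.to_le hNM)) hδN (hcos hx hδx)
        have hxn : x * n ∈ M := mul_mem hx (hNM hn)
        have h1 : x * n ∈ zpowers z := huniq _ (hMQ hxn) (hMexp hq2 _ hxn) hc
        have h2 : x * n ∈ N := by
          refine ⟨hxn, mem_centralizer_iff.2 fun ρ hρ => ?_⟩
          obtain ⟨i, hi⟩ := h1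
          rw [← hi]
          exact ((hR'A ρ hρ z hzA).zpow_right i).eq
        exact (mul_mem_cancel_right hn).1 h2

end Tower

/-! ### A group whose `O_p` is self-centralising -/

section Normal

variable {G : Type*} [Group G]

theorem commute_of_normalizing {r s : ℕ} [Fact r.Prime] [Fact s.Prime] (hrs : r ≠ s)
    {R S : Subgroup G} (hR : IsPGroup r R) (hS : IsPGroup s S) (hRS : R ≤ normalizer (S : Set G))
    (hSR : S ≤ normalizer (R : Set G)) : ∀ x ∈ R, ∀ y ∈ S, Commute x y := by
  intro x hx y hy
  have h1 : ⁅x, y⁆ ∈ S := by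
    rw [commutatorElement_def]
    exact mul_mem (conj_mem_of_mem_normalizer (hRS hx) hy) (inv_mem hy)
  have h2 : ⁅x, y⁆ ∈ R := by
    rw [commutatorElement_def, mul_assoc, mul_assoc, ← mul_assoc y]
    exact mul_mem hx (conj_mem_of_mem_normalizer (hSR hy) (inv_mem hx))
  have h3 := (IsPGroup.disjoint_of_ne r s hrs R S hR hS).le_bot ⟨h2, h1⟩
  exact commutatorElement_eq_one_iff_commute.1 (mem_bot.1 h3)

theorem mem_centralizer_zpowers_iff {c g : G} :
    g ∈ centralizer (zpowers c : Set G) ↔ Commute g c := by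
  rw [mem_centralizer_iff]
  constructor
  · exact fun h => (h c (mem_zpowers c)).symm
  · rintro h _ ⟨i, rfl⟩
    exact (h.zpow_right i).symm.eq

/-- A normal `r`-subgroup of `H` lies in every subgroup of `H` of index prime to `r`. -/
theorem le_of_not_dvd_relIndex {r : ℕ} [Fact r.Prime] {R K H : Subgroup G} (hR : IsPGroup r R)
    (hRH : R ≤ H) (hHR : H ≤ normalizer (R : Set G)) (h : ¬ r ∣ K.relIndex H) : R ≤ K := by
  obtain ⟨g, hg, hgK⟩ := exists_conj_mem hR hRH h
  intro x hx
  have := hgK _ (conj_mem_of_mem_normalizer (hHR hg) hx)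
  convert this using 1
  group

theorem commute_pcore {r s : ℕ} [Fact r.Prime] [Fact s.Prime] (hrs : r ≠ s) {H : Subgroup G} :
    ∀ x ∈ pcore r H, ∀ y ∈ pcore s H, Commute x y :=
  commute_of_normalizing hrs isPGroup_pcore isPGroup_pcore
    (pcore_le.trans le_normalizer_pcore) (pcore_le.trans le_normalizer_pcore)

variable [Finite G]

theorem normalizer_le_normalizer_pcore {t : ℕ} [Fact t.Prime] {N : Subgroup G} :
    normalizer (N : Set G) ≤ normalizer (pcore t N : Set G) := by
  intro g hg
  have h1 : (pcore t N).map (MulAut.conj g).toMonoidHom ≤ pcore t N := by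
    refine le_pcore ?_ ?_ (isPGroup_pcore.map _)
    · rintro _ ⟨x, hx, rfl⟩
      exact conj_mem_of_mem_normalizer hg (pcore_le hx)
    · intro n hn
      refine mem_normalizer_of_conj_mem ?_
      rintro _ ⟨x, hx, rfl⟩
      have h2 : g⁻¹ * n * g ∈ N := by
        simpa using conj_mem_of_mem_normalizer (inv_mem hg) hn
      refine ⟨_, conj_mem_of_mem_normalizer (le_normalizer_pcore h2) hx, ?_⟩
      simp only [MulEquiv.coe_toMonoidHom, MulAut.conj_apply]
      group
  exact mem_normalizer_of_conj_mem fun x hx => h1 ⟨x, hx, rfl⟩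

theorem pcore_eq_bot_of_not_dvd {t : ℕ} (ht : t.Prime) {K : Subgroup G}
    (h : ¬ t ∣ Nat.card K) : pcore t K = ⊥ := by
  have : Fact t.Prime := ⟨ht⟩
  by_contra hne
  exact h (dvd_card_of_pcore_ne_bot hne)

/-- If `⟨c⟩` contains all elements of order `r` of `R`, everything normalising `R` normalises it. -/
theorem mem_normalizer_zpowers {r : ℕ} {R : Subgroup G} {c g : G} (hc : c ∈ R) (hcr : c ^ r = 1)
    (huniq : ∀ y ∈ R, y ^ r = 1 → y ∈ zpowers c) (hg : g ∈ normalizer (R : Set G)) :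
    g ∈ normalizer (zpowers c : Set G) := by
  refine mem_normalizer_of_conj_mem ?_
  rintro _ ⟨i, rfl⟩
  have h1 : g * c * g⁻¹ ∈ zpowers c :=
    huniq _ (conj_mem_of_mem_normalizer hg hc) (by rw [conj_pow, hcr]; group)
  change g * c ^ i * g⁻¹ ∈ zpowers c
  rw [← conj_zpow]
  exact zpow_mem h1 i

/-- Let `R`, `S` be commuting groups of `r`- and `s`-power order. If subgroups of rank two
normalising both of them exist for both primes, but no such subgroup centralises an element of the
other prime order, then `R` or `S` is trivial: otherwise `R` and `S` have rank one, which yields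
both `s ∣ r - 1` and `r ∣ s - 1`. -/
theorem eq_bot_or_eq_bot_of_rankTwo {r s : ℕ} [hr : Fact r.Prime] [hs : Fact s.Prime]
    {B R S E D : Subgroup G}
    (hEr : ∀ E ≤ B, IsRankTwo r E → ∀ d ∈ B, d ^ s = 1 → d ≠ 1 → ¬ ∀ e ∈ E, Commute d e)
    (hDs : ∀ D ≤ B, IsRankTwo s D → ∀ e ∈ B, e ^ r = 1 → e ≠ 1 → ¬ ∀ d ∈ D, Commute e d)
    (hR : IsPGroup r R) (hS : IsPGroup s S) (hRB : R ≤ B) (hSB : S ≤ B)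
    (hRS : ∀ x ∈ R, ∀ y ∈ S, Commute x y) (hBR : B ≤ normalizer (R : Set G))
    (hBS : B ≤ normalizer (S : Set G)) (hE : IsRankTwo r E) (hEB : E ≤ B) (hD : IsRankTwo s D)
    (hDB : D ≤ B) : R = ⊥ ∨ S = ⊥ := by
  by_contra! hne
  obtain ⟨hRne, hSne⟩ := hne
  obtain ⟨x, hx, hx1, hxr⟩ := exists_pow_prime_order hR hRne
  obtain ⟨y, hy, hy1, hys⟩ := exists_pow_prime_order hS hSne
  obtain ⟨c, hc, hc1, hcr, -, hcu⟩ := exists_unique_order hR hRne fun E' hE'R hE' =>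
    hEr E' (hE'R.trans hRB) hE' y (hSB hy) hys hy1 fun e he => (hRS e (hE'R he) y hy).symm
  obtain ⟨b, hb, hb1, hbs, -, hbu⟩ := exists_unique_order hS hSne fun D' hD'S hD' =>
    hDs D' (hD'S.trans hSB) hD' x (hRB hx) hxr hx1 fun d hd => hRS x hx d (hD'S hd)
  have h1 : s ∣ r - 1 := by
    obtain ⟨d, hd, hdc⟩ := not_forall₂.1 (hDs D hDB hD c (hRB hc) hcr hc1)
    exact dvd_sub_one_of_not_commute (hD.pow_eq_one d hd) hcr (conj_mem_of_mem_normalizer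
      (mem_normalizer_zpowers hc hcr hcu (hBR (hDB hd))) (mem_zpowers c)) fun h => hdc h.symm
  have h2 : r ∣ s - 1 := by
    obtain ⟨e, he, heb⟩ := not_forall₂.1 (hEr E hEB hE b (hSB hb) hbs hb1)
    exact dvd_sub_one_of_not_commute (hE.pow_eq_one e he) hbs (conj_mem_of_mem_normalizer
      (mem_normalizer_zpowers hb hbs hbu (hBS (hEB he))) (mem_zpowers b)) fun h => heb h.symm
  have h3 := Nat.le_of_dvd (Nat.sub_pos_of_lt hr.out.one_lt) h1
  have h4 := Nat.le_of_dvd (Nat.sub_pos_of_lt hs.out.one_lt) h2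
  have := hr.out.one_lt
  omega

end Normal

section SelfCentralising

variable {G : Type*} [Group G] [Finite G] (hNT : NoCommutingTriple G)

include hNT

/-- The part of `false_of_faithful_pair` in which `O_s(B)` is trivial: then the elements of order
`s` act faithfully on `O_r(B)`, and a tower arises. -/
theorem false_of_pcore_eq_bot {p q r s : ℕ} [Fact p.Prime] [Fact q.Prime]
    [Fact r.Prime] [Fact s.Prime] (hpq : p ≠ q) (hpr : p ≠ r) (hps : p ≠ s) (hqr : q ≠ r)
    (hqs : q ≠ s) (hrs : r ≠ s) {P Q B D : Subgroup G} (hP : IsPGroup p P) (hQ : IsPGroup q Q)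
    (hQP : Q ≤ normalizer (P : Set G)) (hBP : B ≤ normalizer (P : Set G))
    (hBQ : B ≤ normalizer (Q : Set G)) (hfaith : ∀ y ∈ Q, (∀ x ∈ P, Commute y x) → y = 1)
    (hB : Group.IsSolvable B) (hBcard : ∀ u : ℕ, u.Prime → u ∣ Nat.card B → u = r ∨ u = s)
    (hfaithB : ∀ b ∈ B, (∀ y ∈ Q, Commute b y) → b = 1)
    (hD : IsRankTwo s D) (hDB : D ≤ B) (hS : pcore s B = ⊥) : False := by
  refine false_of_tower hNT hpq hpr hps hqr hqs hrs hP hQ (isPGroup_pcore (t := r) (H := B)) hD hQP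
    (pcore_le.trans hBP) (pcore_le.trans hBQ) (hDB.trans hBP) (hDB.trans hBQ)
    (hDB.trans le_normalizer_pcore) hfaith ?_
  intro δ hδ hδ1
  by_contra! hcon
  have h1 : ∀ x ∈ pcore r B, Commute δ x := by
    intro x hx
    have h2 : ⁅x, δ⁆ ∈ B := by
      rw [commutatorElement_def]
      exact mul_mem (mul_mem (mul_mem (pcore_le hx) (hDB hδ)) (inv_mem (pcore_le hx)))
        (inv_mem (hDB hδ))
    exact (commutatorElement_eq_one_iff_commute.1 (hfaithB _ h2 (hcon x hx))).symm
  refine hδ1 (mem_bot.1 (hS ▸ mem_pcore_of_commute (k := 1) hB (hDB hδ) ?_ ?_))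
  · rw [pow_one]; exact hD.pow_eq_one δ hδ
  · intro u hu y hy
    by_cases hur : u = r
    · exact h1 y (hur ▸ hy)
    · have h2 : pcore u B = ⊥ := by
        by_cases hus : u = s
        · rw [hus, hS]
        · exact pcore_eq_bot_of_not_dvd hu fun h => (hBcard u hu h).elim hur hus
      rw [h2, mem_bot] at hy
      rw [hy]
      exact Commute.one_right δ

/-- There is no configuration of a `p`-group `P`, a `q`-group `Q` faithful on `P`, and a solvable
`{r, s}`-group `B` of rank at least two for both primes that normalises `P` and `Q` and is faithful
on `Q`. -/
theorem false_of_faithful_pair {p q r s : ℕ} [Fact p.Prime] [Fact q.Prime]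
    [Fact r.Prime] [Fact s.Prime] (hpq : p ≠ q) (hpr : p ≠ r) (hps : p ≠ s) (hqr : q ≠ r)
    (hqs : q ≠ s) (hrs : r ≠ s) {P Q B E D : Subgroup G} (hP : IsPGroup p P) (hQ : IsPGroup q Q)
    (hQP : Q ≤ normalizer (P : Set G)) (hBP : B ≤ normalizer (P : Set G))
    (hBQ : B ≤ normalizer (Q : Set G)) (hfaith : ∀ y ∈ Q, (∀ x ∈ P, Commute y x) → y = 1)
    (hB : Group.IsSolvable B) (hBcard : ∀ u : ℕ, u.Prime → u ∣ Nat.card B → u = r ∨ u = s)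
    (hfaithB : ∀ b ∈ B, (∀ y ∈ Q, Commute b y) → b = 1)
    (hE : IsRankTwo r E) (hEB : E ≤ B) (hD : IsRankTwo s D) (hDB : D ≤ B) : False := by
  have hQne : Q ≠ ⊥ := by
    rintro rfl
    obtain ⟨e, he, he1⟩ := hE.exists_ne_one
    refine he1 (hfaithB e (hEB he) fun y hy => ?_)
    rw [mem_bot.1 hy]
    exact Commute.one_right e
  have hbot : pcore r B = ⊥ ∨ pcore s B = ⊥ := by
    refine eq_bot_or_eq_bot_of_rankTwo (B := B) ?_ ?_ isPGroup_pcore isPGroup_pcore pcore_le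
      pcore_le (commute_pcore hrs) le_normalizer_pcore le_normalizer_pcore hE hEB hD hDB
    · exact fun E hEB hE d hd hds hd1 => not_commute_rankTwo hNT hpq hpr hps hqr hqs hrs hP hQ hQP
        hfaith hQne hE (hEB.trans hBP) (hEB.trans hBQ) hds hd1 (hBP hd) (hBQ hd)
    · exact fun D hDB hD e he her he1 => not_commute_rankTwo hNT hpq hps hpr hqs hqr hrs.symm hP hQ
        hQP hfaith hQne hD (hDB.trans hBP) (hDB.trans hBQ) her he1 (hBP he) (hBQ he)
  rcases hbot with h | h
  · exact false_of_pcore_eq_bot hNT hpq hps hpr hqs hqr hrs.symm hP hQ hQP hBP hBQ hfaith hB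
      (fun u hu hd => (hBcard u hu hd).symm) hfaithB hE hEB h
  · exact false_of_pcore_eq_bot hNT hpq hpr hps hqr hqs hrs hP hQ hQP hBP hBQ hfaith hB hBcard
      hfaithB hD hDB h

/-- Let a solvable `{q, r, s}`-group `H` act faithfully on a `p`-group `P`, with `O_q(H)` and
`O_r(H)` nontrivial but `O_s(H)` trivial, and let `H` have rank at least two for `r` and `s`. Then
`O_r(H)` has a subgroup of rank two. Otherwise let `c₀` generate its subgroup of order `r`, and
let `X` be a Hall `{r, s}`-subgroup of `H`; some `d₀` of order `s` commutes with `c₀`, hence acts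
without fixed points on `O_q(H)`, and nontrivially on `O_r(C_X(c₀))`. A minimal subgroup `M` on
which it acts nontrivially must centralise `O_q(H)`, which forces `M` into `O_r(H)`. -/
theorem exists_rankTwo_le_pcore {p q r s : ℕ} [Fact p.Prime] [hq : Fact q.Prime]
    [hr : Fact r.Prime] [hs : Fact s.Prime] (hpq : p ≠ q) (hpr : p ≠ r) (hps : p ≠ s) (hqr : q ≠ r)
    (hqs : q ≠ s) (hrs : r ≠ s) {P H E D : Subgroup G} (hP : IsPGroup p P)
    (hHP : H ≤ normalizer (P : Set G)) (hfaith : ∀ y ∈ H, (∀ x ∈ P, Commute y x) → y = 1)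
    (hH : Group.IsSolvable H)
    (hHcard : ∀ u : ℕ, u.Prime → u ∣ Nat.card H → u = q ∨ u = r ∨ u = s)
    (hQ : pcore q H ≠ ⊥) (hR : pcore r H ≠ ⊥) (hS : pcore s H = ⊥)
    (hE : IsRankTwo r E) (hEH : E ≤ H) (hD : IsRankTwo s D) (hDH : D ≤ H) :
    ∃ E' ≤ pcore r H, IsRankTwo r E' := by
  by_contra! hrank
  obtain ⟨c₀, hc₀, hc₀1, hc₀r, -, hc₀u⟩ := exists_unique_order isPGroup_pcore hR hrank
  have hHc₀ : H ≤ normalizer (zpowers c₀ : Set G) := fun h hh =>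
    mem_normalizer_zpowers hc₀ hc₀r hc₀u (le_normalizer_pcore hh)
  have hHQ : H ≤ normalizer (pcore q H : Set G) := le_normalizer_pcore
  have hQP : pcore q H ≤ normalizer (P : Set G) := pcore_le.trans hHP
  have hfaithQ : ∀ y ∈ pcore q H, (∀ x ∈ P, Commute y x) → y = 1 := fun y hy =>
    hfaith y (pcore_le hy)
  have hEr : ∀ E ≤ H, IsRankTwo r E → ∀ d ∈ H, d ^ s = 1 → d ≠ 1 → ¬ ∀ e ∈ E, Commute d e :=
    fun E hEB hE d hd hds hd1 => not_commute_rankTwo hNT hpq hpr hps hqr hqs hrs hP isPGroup_pcore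
      hQP hfaithQ hQ hE (hEB.trans hHP) (hEB.trans hHQ) hds hd1 (hHP hd) (hHQ hd)
  have hDs : ∀ D ≤ H, IsRankTwo s D → ∀ e ∈ H, e ^ r = 1 → e ≠ 1 → ¬ ∀ d ∈ D, Commute e d :=
    fun D hDB hD e he her he1 => not_commute_rankTwo hNT hpq hps hpr hqs hqr hrs.symm hP
      isPGroup_pcore hQP hfaithQ hQ hD (hDB.trans hHP) (hDB.trans hHQ) her he1 (hHP he) (hHQ he)
  obtain ⟨X, hX⟩ := exists_isHall hH {r, s}
  have hrX := hX.not_dvd_relIndex r hr.out (by simp)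
  have hsX := hX.not_dvd_relIndex s hs.out (by simp)
  obtain ⟨E, hEX, hE⟩ := hE.exists_conj hEH hrX
  obtain ⟨D, hDX, hD⟩ := hD.exists_conj hDH hsX
  have hEH := hEX.trans hX.le
  have hDH := hDX.trans hX.le
  have hc₀H : c₀ ∈ H := pcore_le hc₀
  have hc₀X : c₀ ∈ X :=
    le_of_not_dvd_relIndex isPGroup_pcore pcore_le le_normalizer_pcore hrX hc₀
  have hr2 : r ≠ 2 := by
    obtain ⟨d, hd, hdc⟩ := not_forall₂.1 (hDs D hDH hD c₀ hc₀H hc₀r hc₀1)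
    have h1 := dvd_sub_one_of_not_commute (hD.pow_eq_one d hd) hc₀r
      (conj_mem_of_mem_normalizer (hHc₀ (hDH hd)) (mem_zpowers c₀)) fun h => hdc h.symm
    rintro rfl
    exact hs.out.one_lt.ne' (Nat.dvd_one.1 h1)
  have hEc₀ : ∀ e ∈ E, Commute e c₀ := by
    intro e he
    by_contra hne
    have h1 := dvd_sub_one_of_not_commute (hE.pow_eq_one e he) hc₀r
      (conj_mem_of_mem_normalizer (hHc₀ (hEH he)) (mem_zpowers c₀)) hne
    have h2 := Nat.le_of_dvd (Nat.sub_pos_of_lt hr.out.one_lt) h1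
    have := hr.out.one_lt
    omega
  -- a group of rank two cannot act faithfully on a group of prime order
  obtain ⟨d₀, hd₀, hd₀1, hd₀c⟩ : ∃ d ∈ D, d ≠ 1 ∧ Commute d c₀ := by
    obtain ⟨d, hd, hd1, x, hx, hx1, hdx⟩ := hD.exists_commute hrs.symm
      (isPGroup_zpowers_of_pow_eq_one hc₀r) (hDH.trans hHc₀) (by rwa [Ne, zpowers_eq_bot])
    obtain ⟨i, hi⟩ := mem_zpowers_of_mem_of_prime hc₀r hx hx1
    have hi : x ^ i = c₀ := hi
    exact ⟨d, hd, hd1, hi ▸ hdx.zpow_right i⟩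
  have hd₀s := hD.pow_eq_one d₀ hd₀
  have hQd₀ : ∀ x ∈ pcore q H, Commute d₀ x → x = 1 := by
    intro x hx hdx
    by_contra hx1
    exact hNT.false hqr hqs hrs isPGroup_pcore isPGroup_pcore hD.isPGroup hx hc₀ hd₀ hx1 hc₀1 hd₀1
      (commute_pcore hqr x hx c₀ hc₀) hdx.symm hd₀c.symm
  set N := X ⊓ centralizer (zpowers c₀ : Set G) with hN
  have hNH : N ≤ H := inf_le_left.trans hX.le
  have hXN : X ≤ normalizer (N : Set G) := by
    intro g hg
    refine mem_normalizer_of_conj_mem fun n hn => ⟨X.mul_mem (X.mul_mem hg hn.1) (X.inv_mem hg), ?_⟩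
    exact conj_mem_of_mem_normalizer (normalizer_le_normalizer_centralizer (hHc₀ (hX.le hg))) hn.2
  have hd₀N : d₀ ∈ N := ⟨hDX hd₀, mem_centralizer_zpowers_iff.2 hd₀c⟩
  have hNs : pcore s N = ⊥ := by
    have h1 : zpowers c₀ = ⊥ ∨ pcore s N = ⊥ := by
      refine eq_bot_or_eq_bot_of_rankTwo (B := X) (r := r) (s := s)
        (fun E h1 h2 d hd => hEr E (h1.trans hX.le) h2 d (hX.le hd))
        (fun E h1 h2 d hd => hDs E (h1.trans hX.le) h2 d (hX.le hd))
        (isPGroup_zpowers_of_pow_eq_one hc₀r) isPGroup_pcore (zpowers_le.2 hc₀X)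
        (pcore_le.trans inf_le_left) ?_ (hX.le.trans hHc₀)
        (hXN.trans normalizer_le_normalizer_pcore) hE hEX hD hDX
      exact fun x hx y hy => mem_centralizer_iff.1 (pcore_le hy).2 x hx
    exact h1.resolve_left (by rwa [zpowers_eq_bot])
  have hne : ¬ ∀ x ∈ zpowers d₀, ∀ y ∈ pcore r N, Commute x y := by
    intro h
    refine hd₀1 (mem_bot.1 (hNs ▸ mem_pcore_of_commute (k := 1) (isSolvable_of_le hNH hH) hd₀N
      (by rwa [pow_one]) ?_))
    intro u hu y hy
    by_cases hur : u = r
    · exact h d₀ (mem_zpowers d₀) y (hur ▸ hy)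
    · have h2 : pcore u N = ⊥ := by
        by_cases hus : u = s
        · rw [hus, hNs]
        · refine pcore_eq_bot_of_not_dvd hu fun h => ?_
          have := hX.mem_of_dvd_card u hu (h.trans (card_dvd_of_le inf_le_left))
          simp [hur, hus] at this
      rw [h2, mem_bot] at hy
      rw [hy]
      exact Commute.one_right d₀
  obtain ⟨M, hMR, hdM, hMne, -, -, hMexp⟩ := exists_special_subgroup (X := zpowers d₀) hrs.symm
    (isPGroup_zpowers_of_pow_eq_one hd₀s) (isPGroup_pcore (t := r) (H := N)) le_normalizer
    ((zpowers_le.2 hd₀N).trans le_normalizer_pcore) le_rfl hne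
  replace hMexp := hMexp hr2
  have hMN : M ≤ N := hMR.trans pcore_le
  have hMH := hMN.trans hNH
  have hdM : d₀ ∈ normalizer (M : Set G) := hdM (mem_zpowers d₀)
  have hMc : ∀ m ∈ M, Commute m c₀ := fun m hm => mem_centralizer_zpowers_iff.1 (hMN hm).2
  have hMd : ∀ m ∈ M, Commute d₀ m → m ∈ zpowers c₀ := by
    intro m hm hdm
    by_contra hnot
    refine hEr _ (sup_le (zpowers_le.2 (hMH hm)) (zpowers_le.2 hc₀H))
      (isRankTwo_sup (hMexp m hm) hc₀r (hMc m hm) hc₀1 hnot) d₀ (hNH hd₀N) hd₀s hd₀1 ?_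
    have h1 : zpowers m ⊔ zpowers c₀ ≤ centralizer {d₀} :=
      sup_le (zpowers_le.2 (mem_centralizer_singleton_iff.2 hdm.symm.eq))
        (zpowers_le.2 (mem_centralizer_singleton_iff.2 hd₀c.symm.eq))
    exact fun e he => (mem_centralizer_singleton_iff.1 (h1 he)).symm
  have hMQ : ∀ m ∈ M, ∀ y ∈ pcore q H, Commute m y := by
    refine commute_of_fixedPointFree hrs hqr.symm hqs.symm (isPGroup_pcore.to_le hMR) hd₀s hdM
      isPGroup_pcore (hHQ (hNH hd₀N)) (hMH.trans hHQ) ?_ hQd₀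
    intro m hm hmd y hy
    obtain ⟨i, hi⟩ := hMd m hm hmd.symm
    rw [← hi]
    exact (commute_pcore hqr y hy c₀ hc₀).symm.zpow_left i
  set C := H ⊓ centralizer (pcore q H : Set G) ⊓ centralizer (zpowers c₀ : Set G) with hC
  have hHC : H ≤ normalizer (C : Set G) := by
    intro g hg
    refine mem_normalizer_of_conj_mem fun n hn =>
      ⟨⟨H.mul_mem (H.mul_mem hg hn.1.1) (H.inv_mem hg), ?_⟩, ?_⟩
    · exact conj_mem_of_mem_normalizer (normalizer_le_normalizer_centralizer (hHQ hg)) hn.1.2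
    · exact conj_mem_of_mem_normalizer (normalizer_le_normalizer_centralizer (hHc₀ hg)) hn.2
  have hCcentral : ∀ u : ℕ, u.Prime → u ≠ r → ∀ y ∈ C, ∀ k : ℕ, y ^ u ^ k = 1 →
      ∀ c ∈ C, Commute y c := by
    intro u hu hur y hy k hyk c hc
    have : Fact u.Prime := ⟨hu⟩
    have hbot : ∀ v : ℕ, v.Prime → v ≠ q → v ≠ r → pcore v H = ⊥ := by
      intro v hv hvq hvr
      by_cases hvs : v = s
      · rw [hvs, hS]
      · refine pcore_eq_bot_of_not_dvd hv fun h => ?_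
        rcases hHcard v hv h with h | h | h
        exacts [hvq h, hvr h, hvs h]
    have hyQ : ∀ z ∈ pcore q H, Commute y z := fun z hz =>
      (mem_centralizer_iff.1 hy.1.2 z hz).symm
    have hyu : IsPGroup u (zpowers y) := isPGroup_zpowers_of_pow_pow_eq_one hyk
    have hy' : y ∈ pcore u H := by
      refine mem_pcore_of_commute hH hy.1.1 hyk fun v hv z hz => ?_
      by_cases hvq : v = q
      · exact hyQ z (hvq ▸ hz)
      · by_cases hvr : v = r
        · subst hvr
          refine commute_of_unique_order hur hr2 hyu isPGroup_pcore
            ((zpowers_le.2 hy.1.1).trans le_normalizer_pcore) hc₀u ?_ y (mem_zpowers y) z hz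
          rintro _ ⟨i, rfl⟩
          exact (mem_centralizer_zpowers_iff.1 hy.2).zpow_left i
        · rw [hbot v hv hvq hvr, mem_bot] at hz
          rw [hz]
          exact Commute.one_right y
    by_cases huq : u = q
    · subst huq
      exact mem_centralizer_iff.1 hc.1.2 y hy'
    · rw [hbot u hu huq hur, mem_bot] at hy'
      rw [hy']
      exact Commute.one_left c
  refine hMne ?_
  rintro _ ⟨i, rfl⟩ m hm
  have hmC : m ∈ C := ⟨⟨hMH hm, mem_centralizer_iff.2 fun y hy => (hMQ m hm y hy).symm.eq⟩,
    mem_centralizer_zpowers_iff.2 (hMc m hm)⟩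
  have hmR : m ∈ pcore r H := mem_pcore_of_central (k := 1) (inf_le_left.trans inf_le_left) hHC
    hCcentral hmC (by rw [pow_one]; exact hMexp m hm)
  obtain ⟨j, hj⟩ := hc₀u m hmR (hMexp m hm)
  rw [← hj]
  exact hd₀c.zpow_zpow i j

end SelfCentralising

section SelfCentralisingCore

variable {G : Type*} [Group G] [Finite G]

/-- An element of a subgroup `B` of the solvable group `H` that centralises the Fitting subgroup
of `H` is trivial if no prime dividing `|B|` divides the order of the Fitting subgroup. -/
theorem eq_one_of_commute_pcore {H B : Subgroup G} (hH : Group.IsSolvable H) (hBH : B ≤ H)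
    (hbot : ∀ u : ℕ, u.Prime → u ∣ Nat.card B → pcore u H = ⊥) {b : G} (hb : b ∈ B)
    (hcomm : ∀ u : ℕ, u.Prime → ∀ y ∈ pcore u H, Commute b y) : b = 1 := by
  refine mem_bot.1 (mem_of_prime_pow_mem fun t ht y hy k hyk => ?_)
  have : Fact t.Prime := ⟨ht⟩
  have hyB : y ∈ B := (zpowers_le.2 hb) hy
  by_cases htB : t ∣ Nat.card B
  · rw [← hbot t ht htB]
    refine mem_pcore_of_commute hH (hBH hyB) hyk fun u hu z hz => ?_
    obtain ⟨i, rfl⟩ := hy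
    exact (hcomm u hu z hz).zpow_left i
  · have h1 : orderOf y ∣ Nat.card B := orderOf_dvd_natCard B hyB
    have h2 := orderOf_dvd_of_pow_eq_one hyk
    have h3 : orderOf y = 1 := Nat.eq_one_of_dvd_coprimes
      (Nat.Coprime.pow_left k ((Nat.Prime.coprime_iff_not_dvd ht).2 htB)) h2 h1
    exact mem_bot.2 (orderOf_eq_one_iff.1 h3)

variable (hNT : NoCommutingTriple G)

include hNT

/-- The part of `false_of_faithful` in which `O_q(H)` is nontrivial and `O_s(H)` is trivial. -/
theorem false_of_faithful_of_pcore {p q r s : ℕ} [Fact p.Prime] [hq : Fact q.Prime]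
    [hr : Fact r.Prime] [hs : Fact s.Prime] (hpq : p ≠ q) (hpr : p ≠ r) (hps : p ≠ s) (hqr : q ≠ r)
    (hqs : q ≠ s) (hrs : r ≠ s) {P H F E D : Subgroup G} (hP : IsPGroup p P)
    (hHP : H ≤ normalizer (P : Set G)) (hfaith : ∀ y ∈ H, (∀ x ∈ P, Commute y x) → y = 1)
    (hH : Group.IsSolvable H)
    (hHcard : ∀ u : ℕ, u.Prime → u ∣ Nat.card H → u = q ∨ u = r ∨ u = s)
    (hF : IsRankTwo q F) (hFH : F ≤ H) (hE : IsRankTwo r E) (hEH : E ≤ H) (hD : IsRankTwo s D)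
    (hDH : D ≤ H) (hQ : pcore q H ≠ ⊥) (hS : pcore s H = ⊥) : False := by
  by_cases hR : pcore r H = ⊥
  · obtain ⟨B, hB⟩ := exists_isHall hH {r, s}
    obtain ⟨E, hEB, hE⟩ := hE.exists_conj hEH (hB.not_dvd_relIndex r hr.out (by simp))
    obtain ⟨D, hDB, hD⟩ := hD.exists_conj hDH (hB.not_dvd_relIndex s hs.out (by simp))
    have hBcard : ∀ u : ℕ, u.Prime → u ∣ Nat.card B → u = r ∨ u = s := fun u hu hd => by
      simpa using hB.mem_of_dvd_card u hu hd
    refine false_of_faithful_pair hNT hpq hpr hps hqr hqs hrs hP (isPGroup_pcore (t := q) (H := H))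
      (pcore_le.trans hHP) (hB.le.trans hHP) (hB.le.trans le_normalizer_pcore)
      (fun y hy => hfaith y (pcore_le hy)) (isSolvable_of_le hB.le hH) hBcard ?_ hE hEB hD hDB
    intro b hb hbQ
    refine eq_one_of_commute_pcore hH hB.le ?_ hb ?_
    · intro u hu hd
      rcases hBcard u hu hd with rfl | rfl
      exacts [hR, hS]
    · intro u hu y hy
      by_cases huH : u ∣ Nat.card H
      · rcases hHcard u hu huH with rfl | rfl | rfl
        · exact hbQ y hy
        · rw [hR, mem_bot] at hy; rw [hy]; exact Commute.one_right b
        · rw [hS, mem_bot] at hy; rw [hy]; exact Commute.one_right b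
      · rw [pcore_eq_bot_of_not_dvd hu huH, mem_bot] at hy
        rw [hy]; exact Commute.one_right b
  · obtain ⟨E', hE'R, hE'⟩ := exists_rankTwo_le_pcore hNT hpq hpr hps hqr hqs hrs hP hHP hfaith hH
      hHcard hQ hR hS hE hEH hD hDH
    obtain ⟨F', hF'Q, hF'⟩ := exists_rankTwo_le_pcore hNT hpr hpq hps hqr.symm hrs hqs hP hHP hfaith
      hH (fun u hu hd => by rcases hHcard u hu hd with h | h | h <;> simp [h]) hR hQ hS hF hFH hD
      hDH
    have hPne : P ≠ ⊥ := by
      rintro rfl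
      obtain ⟨e, he, he1⟩ := hE.exists_ne_one
      refine he1 (hfaith e (hEH he) fun y hy => ?_)
      rw [mem_bot.1 hy]; exact Commute.one_right e
    obtain ⟨f, hf, hf1, x, hx, hx1, hfx⟩ := hF'.exists_commute hpq.symm hP
      ((hF'Q.trans pcore_le).trans hHP) hPne
    have h1 := fixedPts_eq_bot_of_commute_rankTwo hNT hpr hpq hqr.symm hP hE'
      ((hE'R.trans pcore_le).trans hHP) (hF'.pow_eq_one f hf) hf1
      fun e he => commute_pcore hqr f (hF'Q hf) e (hE'R he)
    exact hx1 (fixedPts_eq_bot_iff.1 h1 x hx hfx)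

/-- A solvable `{q, r, s}`-group `H` of rank at least two for the three primes does not act
faithfully on a `p`-group. -/
theorem false_of_faithful {p q r s : ℕ} [Fact p.Prime] [Fact q.Prime]
    [Fact r.Prime] [Fact s.Prime] (hpq : p ≠ q) (hpr : p ≠ r) (hps : p ≠ s) (hqr : q ≠ r)
    (hqs : q ≠ s) (hrs : r ≠ s) {P H F E D : Subgroup G} (hP : IsPGroup p P)
    (hHP : H ≤ normalizer (P : Set G)) (hfaith : ∀ y ∈ H, (∀ x ∈ P, Commute y x) → y = 1)
    (hH : Group.IsSolvable H)
    (hHcard : ∀ u : ℕ, u.Prime → u ∣ Nat.card H → u = q ∨ u = r ∨ u = s)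
    (hF : IsRankTwo q F) (hFH : F ≤ H) (hE : IsRankTwo r E) (hEH : E ≤ H) (hD : IsRankTwo s D)
    (hDH : D ≤ H) : False := by
  have hex : pcore q H ≠ ⊥ ∨ pcore r H ≠ ⊥ ∨ pcore s H ≠ ⊥ := by
    have hHne : H ≠ ⊥ := by
      obtain ⟨e, he, he1⟩ := hE.exists_ne_one
      exact ne_bot_of_mem (hEH he) he1
    obtain ⟨t, ht, hne⟩ := exists_pcore_ne_bot hH hHne
    have : Fact t.Prime := ⟨ht⟩
    rcases hHcard t ht (dvd_card_of_pcore_ne_bot hne) with rfl | rfl | rfl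
    exacts [Or.inl hne, Or.inr (Or.inl hne), Or.inr (Or.inr hne)]
  have hbot : pcore q H = ⊥ ∨ pcore r H = ⊥ ∨ pcore s H = ⊥ := by
    by_contra! hne
    obtain ⟨x, hx, hx1⟩ := exists_ne_one_of_ne_bot hne.1
    obtain ⟨y, hy, hy1⟩ := exists_ne_one_of_ne_bot hne.2.1
    obtain ⟨z, hz, hz1⟩ := exists_ne_one_of_ne_bot hne.2.2
    exact hNT.false hqr hqs hrs isPGroup_pcore isPGroup_pcore isPGroup_pcore hx hy hz hx1 hy1 hz1
      (commute_pcore hqr x hx y hy) (commute_pcore hqs x hx z hz) (commute_pcore hrs y hy z hz)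
  have hqrs := false_of_faithful_of_pcore hNT hpq hpr hps hqr hqs hrs hP hHP hfaith hH hHcard
    hF hFH hE hEH hD hDH
  have hqsr := false_of_faithful_of_pcore hNT hpq hps hpr hqs hqr hrs.symm hP hHP hfaith hH
    (fun u hu hd => by rcases hHcard u hu hd with h | h | h <;> simp [h]) hF hFH hD hDH hE hEH
  have hrqs := false_of_faithful_of_pcore hNT hpr hpq hps hqr.symm hrs hqs hP hHP hfaith hH
    (fun u hu hd => by rcases hHcard u hu hd with h | h | h <;> simp [h]) hE hEH hF hFH hD hDH
  have hrsq := false_of_faithful_of_pcore hNT hpr hps hpq hrs hqr.symm hqs.symm hP hHP hfaith hH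
    (fun u hu hd => by rcases hHcard u hu hd with h | h | h <;> simp [h]) hE hEH hD hDH hF hFH
  have hsqr := false_of_faithful_of_pcore hNT hps hpq hpr hqs.symm hrs.symm hqr hP hHP hfaith hH
    (fun u hu hd => by rcases hHcard u hu hd with h | h | h <;> simp [h]) hD hDH hF hFH hE hEH
  have hsrq := false_of_faithful_of_pcore hNT hps hpr hpq hrs.symm hqs.symm hqr.symm hP hHP hfaith
    hH (fun u hu hd => by rcases hHcard u hu hd with h | h | h <;> simp [h]) hD hDH hE hEH hF hFH
  rcases hex with h | h | h <;> rcases hbot with h' | h' | h'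
  exacts [h h', hqsr h h', hqrs h h', hrsq h h', h h', hrqs h h', hsrq h h', hsqr h h', h h']

end SelfCentralisingCore

/-! ### A group acting faithfully on the product of a `p`-group and a `q`-group -/

section TwoModules

variable {G : Type*} [Group G]

/-- Commuting nontrivial subgroups `V` of `p`-power order and `W` of `q`-power order, normalised by
a subgroup `B` that is faithful on `V` and `W` together; two further primes `r` and `s` are those
that may divide the order of `B`. -/
structure IsFaithfulOnPair (p q r s : ℕ) (V W B : Subgroup G) : Prop where
  ne_pq : p ≠ q
  ne_pr : p ≠ r
  ne_ps : p ≠ s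
  ne_qr : q ≠ r
  ne_qs : q ≠ s
  ne_rs : r ≠ s
  isPGroup_left : IsPGroup p V
  isPGroup_right : IsPGroup q W
  left_ne_bot : V ≠ ⊥
  right_ne_bot : W ≠ ⊥
  commute : ∀ v ∈ V, ∀ w ∈ W, Commute v w
  le_normalizer_left : B ≤ normalizer (V : Set G)
  le_normalizer_right : B ≤ normalizer (W : Set G)
  eq_one : ∀ b ∈ B, (∀ v ∈ V, Commute b v) → (∀ w ∈ W, Commute b w) → b = 1

namespace IsFaithfulOnPair

variable {p q r s : ℕ} {V W B : Subgroup G}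

theorem swap (h : IsFaithfulOnPair p q r s V W B) : IsFaithfulOnPair q p r s W V B :=
  ⟨h.ne_pq.symm, h.ne_qr, h.ne_qs, h.ne_pr, h.ne_ps, h.ne_rs, h.isPGroup_right, h.isPGroup_left,
    h.right_ne_bot, h.left_ne_bot, fun v hv w hw => (h.commute w hw v hv).symm,
    h.le_normalizer_right, h.le_normalizer_left, fun b hb hw hv => h.eq_one b hb hv hw⟩

theorem swap_primes (h : IsFaithfulOnPair p q r s V W B) : IsFaithfulOnPair p q s r V W B :=
  ⟨h.ne_pq, h.ne_ps, h.ne_pr, h.ne_qs, h.ne_qr, h.ne_rs.symm, h.isPGroup_left, h.isPGroup_right,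
    h.left_ne_bot, h.right_ne_bot, h.commute, h.le_normalizer_left, h.le_normalizer_right, h.eq_one⟩

/-- `x` centralises or inverts `V`. -/
def ActsAsSign (V : Subgroup G) (x : G) : Prop :=
  (∀ v ∈ V, x * v * x⁻¹ = v) ∨ ∀ v ∈ V, x * v * x⁻¹ = v⁻¹

/-- Inversion and the identity commute with all automorphisms. -/
theorem ActsAsSign.commute_commutator {x b : G} (h : ActsAsSign V x)
    (hb : b ∈ normalizer (V : Set G)) : ∀ v ∈ V, Commute ⁅b, x⁆ v := by
  intro v hv
  have key : ∀ v ∈ V, b * x * v * (b * x)⁻¹ = x * b * v * (x * b)⁻¹ := by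
    intro v hv
    have h1 := conj_mem_of_mem_normalizer hb hv
    rcases h with h | h
    · calc b * x * v * (b * x)⁻¹ = b * (x * v * x⁻¹) * b⁻¹ := by group
        _ = b * v * b⁻¹ := by rw [h v hv]
        _ = x * (b * v * b⁻¹) * x⁻¹ := (h _ h1).symm
        _ = x * b * v * (x * b)⁻¹ := by group
    · calc b * x * v * (b * x)⁻¹ = b * (x * v * x⁻¹) * b⁻¹ := by group
        _ = (b * v * b⁻¹)⁻¹ := by rw [h v hv]; group
        _ = x * (b * v * b⁻¹) * x⁻¹ := (h _ h1).symm
        _ = x * b * v * (x * b)⁻¹ := by group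
  have hx : x ∈ normalizer (V : Set G) := by
    rw [mem_normalizer_iff]
    have hx' : ∀ v ∈ V, x⁻¹ * v * x ∈ V := by
      intro v hv
      rcases h with h | h
      · rw [← h v hv]; simpa [mul_assoc] using hv
      · have h2 := h v⁻¹ (inv_mem hv)
        rw [inv_inv] at h2
        rw [← h2]
        simpa [mul_assoc] using hv
    refine fun v => ⟨fun hv => ?_, fun hv => by simpa [mul_assoc] using hx' _ hv⟩
    rcases h with h | h
    · rwa [h v hv]
    · rw [h v hv]; exact inv_mem hv
  have h2 : (x * b)⁻¹ * v * (x * b) ∈ V := by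
    simpa using conj_mem_of_mem_normalizer (inv_mem (mul_mem hx hb)) hv
  have h3 := key _ h2
  have h4 : x * b * ((x * b)⁻¹ * v * (x * b)) * (x * b)⁻¹ = v := by group
  rw [h4] at h3
  change ⁅b, x⁆ * v = v * ⁅b, x⁆
  calc ⁅b, x⁆ * v = (b * x * ((x * b)⁻¹ * v * (x * b)) * (b * x)⁻¹) * ⁅b, x⁆ := by
        rw [commutatorElement_def]; group
    _ = v * ⁅b, x⁆ := by rw [h3]

/-- An involution acting without fixed points inverts. -/
theorem conj_eq_inv_of_fixedPts_eq_bot [Finite G] {x : G} (hx2 : x ^ 2 = 1)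
    (hx : x ∈ normalizer (V : Set G)) (h : fixedPts V x = ⊥) : ∀ v ∈ V, x * v * x⁻¹ = v⁻¹ := by
  have hxx : x * x = 1 := by rw [← sq, hx2]
  let φ : V →* V := (normalizerMonoidHom V ⟨x, hx⟩ : MulAut V).toMonoidHom
  have hφ : ∀ v : V, ((φ v : V) : G) = x * v * x⁻¹ := fun v => rfl
  have h1 : MonoidHom.FixedPointFree φ := by
    intro v hv
    have h2 : x * v * x⁻¹ = v := by rw [← hφ, hv]
    exact Subtype.ext (fixedPts_eq_bot_iff.1 h v v.2 (mul_inv_eq_iff_eq_mul.1 h2))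
  have h2 : Function.Involutive φ := by
    intro v
    refine Subtype.ext ?_
    rw [hφ, hφ]
    calc x * (x * v * x⁻¹) * x⁻¹ = (x * x) * v * (x * x)⁻¹ := by group
      _ = v := by rw [hxx]; group
  intro v hv
  exact congrArg Subtype.val (congrFun (h1.coe_eq_inv_of_involutive h2) ⟨v, hv⟩)

theorem commute_of_actsAsSign (h : IsFaithfulOnPair p q r s V W B) {x : G} (hx : x ∈ B)
    (hV : ActsAsSign V x) (hW : ActsAsSign W x) {b : G} (hb : b ∈ B) : Commute b x := by
  refine commutatorElement_eq_one_iff_commute.1 (h.eq_one _ ?_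
    (hV.commute_commutator (h.le_normalizer_left hb))
    (hW.commute_commutator (h.le_normalizer_right hb)))
  rw [commutatorElement_def]
  exact mul_mem (mul_mem (mul_mem hb hx) (inv_mem hb)) (inv_mem hx)

variable [Finite G] [Fact p.Prime] [Fact r.Prime] (hNT : NoCommutingTriple G)

include hNT

theorem fixedPts_eq_bot_or [Fact q.Prime] (h : IsFaithfulOnPair p q r s V W B) {x : G}
    (hxr : x ^ r = 1) (hx1 : x ≠ 1) : fixedPts V x = ⊥ ∨ fixedPts W x = ⊥ := by
  by_contra! hne
  obtain ⟨v, hv, hv1⟩ := exists_ne_one_of_ne_bot hne.1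
  obtain ⟨w, hw, hw1⟩ := exists_ne_one_of_ne_bot hne.2
  obtain ⟨hvV, hxv⟩ := mem_fixedPts.1 hv
  obtain ⟨hwW, hxw⟩ := mem_fixedPts.1 hw
  exact hNT.false h.ne_pq h.ne_pr h.ne_qr h.isPGroup_left h.isPGroup_right
    (isPGroup_zpowers_of_pow_eq_one hxr) hvV hwW (mem_zpowers x) hv1 hw1 hx1
    (h.commute v hvV w hwW) hxv.symm hxw.symm

/-- An element of order `r` commuting with a group of rank two for `s` has no fixed points
on `V`. -/
theorem fixedPts_left_eq_bot [Fact s.Prime] (h : IsFaithfulOnPair p q r s V W B) {D : Subgroup G}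
    (hD : IsRankTwo s D) (hDB : D ≤ B) {x : G} (hxr : x ^ r = 1) (hx1 : x ≠ 1)
    (hxD : ∀ d ∈ D, Commute x d) : fixedPts V x = ⊥ :=
  fixedPts_eq_bot_of_commute_rankTwo hNT h.ne_ps h.ne_pr h.ne_rs.symm h.isPGroup_left hD
    (hDB.trans h.le_normalizer_left) hxr hx1 hxD

end IsFaithfulOnPair
end TwoModules

section TwoModules

variable {G : Type*} [Group G] [Finite G]

/-- In a nonabelian group generated by `a`, `b` of order `r` with central commutator `z`, all
subgroups of `⟨a, z⟩` of order `r` other than `⟨z⟩` are conjugate to `⟨a⟩`. As one of the subgroups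
of order `r` has fixed points on `V`, either `z` or `a` does. -/
theorem fixedPts_ne_bot_of_conj {p r : ℕ} [Fact p.Prime] [Fact r.Prime] (hpr : p ≠ r)
    {V : Subgroup G} (hV : IsPGroup p V) (hVne : V ≠ ⊥) {a b z : G} (har : a ^ r = 1)
    (hzr : z ^ r = 1) (hz1 : z ≠ 1) (hab : b * a * b⁻¹ = a * z) (haz : Commute a z)
    (hbz : Commute b z) (haV : a ∈ normalizer (V : Set G)) (hbV : b ∈ normalizer (V : Set G))
    (hzV : z ∈ normalizer (V : Set G)) (hz : fixedPts V z = ⊥) : fixedPts V a ≠ ⊥ := by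
  have hnot : a ∉ zpowers z := by
    rintro ⟨i, hi⟩
    have h1 : Commute b a := by
      rw [← hi]
      exact hbz.zpow_right i
    rw [h1.eq, mul_inv_cancel_right] at hab
    exact hz1 (left_eq_mul.1 hab)
  have hE := isRankTwo_sup har hzr haz hz1 hnot
  obtain ⟨x, hx, hx1, v, hv, hv1, hxv⟩ := hE.exists_commute hpr.symm hV
    (sup_le (zpowers_le.2 haV) (zpowers_le.2 hzV)) hVne
  have hz' := fixedPts_eq_bot_iff.1 hz
  have hxz : x ∉ zpowers z := by
    intro h
    obtain ⟨i, hi⟩ := mem_zpowers_of_mem_of_prime hzr h hx1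
    have hi : x ^ i = z := hi
    exact hv1 (hz' v hv (hi ▸ hxv.zpow_left i))
  have hzE : z ∈ zpowers a ⊔ zpowers z := mem_sup_right (mem_zpowers z)
  have haE : a ∈ zpowers a ⊔ zpowers z := mem_sup_left (mem_zpowers a)
  have hle := hE.le_of_mem (S := zpowers x ⊔ zpowers z) hzE hx hz1 hxz
    (mem_sup_right (mem_zpowers z)) (mem_sup_left (mem_zpowers x))
  obtain ⟨i, j, hij⟩ := exists_zpow_mul_zpow_of_mem_sup (hE.commute x hx z hzE) (hle haE)
  -- the conjugate of `a` by a suitable power of `b` is a power of `x`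
  have hconj : ∀ n : ℕ, b ^ n * a * (b ^ n)⁻¹ = a * z ^ n := by
    intro n
    induction n with
    | zero => simp
    | succ n ih =>
      calc b ^ (n + 1) * a * (b ^ (n + 1))⁻¹ = b * (b ^ n * a * (b ^ n)⁻¹) * b⁻¹ := by
            rw [pow_succ']; group
        _ = (b * a * b⁻¹) * (b * z ^ n * b⁻¹) := by rw [ih]; group
        _ = a * z * z ^ n := by rw [hab, (hbz.pow_right n).eq, mul_inv_cancel_right]
        _ = a * z ^ (n + 1) := by rw [pow_succ', mul_assoc]
  obtain ⟨n, hn⟩ : ∃ n : ℕ, z ^ n = z ^ (-j) := by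
    have h1 : z ^ (-j) ∈ Submonoid.powers z :=
      mem_powers_iff_mem_zpowers.2 ⟨-j, rfl⟩
    exact h1
  have hxi : b ^ n * a * (b ^ n)⁻¹ = x ^ i := by
    rw [hconj, hn]
    conv_lhs => rw [hij]
    group
  refine ne_bot_of_mem (x := (b ^ n)⁻¹ * v * b ^ n) (mem_fixedPts.2 ⟨?_, ?_⟩) fun h => hv1 ?_
  · simpa using conj_mem_of_mem_normalizer (inv_mem (pow_mem hbV n)) hv
  · have h1 : Commute (b ^ n * a * (b ^ n)⁻¹) v := hxi ▸ hxv.zpow_left i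
    change a * ((b ^ n)⁻¹ * v * b ^ n) = (b ^ n)⁻¹ * v * b ^ n * a
    calc a * ((b ^ n)⁻¹ * v * b ^ n)
        = (b ^ n)⁻¹ * ((b ^ n * a * (b ^ n)⁻¹) * v) * b ^ n := by group
      _ = (b ^ n)⁻¹ * (v * (b ^ n * a * (b ^ n)⁻¹)) * b ^ n := by rw [h1.eq]
      _ = (b ^ n)⁻¹ * v * b ^ n * a := by group
  · calc v = b ^ n * ((b ^ n)⁻¹ * v * b ^ n) * (b ^ n)⁻¹ := by group
      _ = 1 := by rw [h]; group

namespace IsFaithfulOnPair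

variable {p q r s : ℕ} {V W B : Subgroup G} [hp : Fact p.Prime] [hq : Fact q.Prime]
  [hr : Fact r.Prime] [hs : Fact s.Prime] (hNT : NoCommutingTriple G)

include hNT

/-- If `f` acts without fixed points on `V`, then it acts trivially on the fixed points of any
`d ≠ 1` in the rank two group `D ∋ f` on an abelian group `M`: otherwise the commutators with `f`
of these fixed points centralise `V`, so that no element of `D` outside `⟨d⟩` has fixed points on
`V`, and hence `d` has. -/
theorem commute_of_fixedPts_eq_bot (h : IsFaithfulOnPair p q r s V W B) {D M : Subgroup G}
    (hD : IsRankTwo s D) (hDB : D ≤ B) (hM : IsPGroup r M) (hMB : M ≤ B)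
    (hDM : D ≤ normalizer (M : Set G)) (hab : ∀ a ∈ M, ∀ b ∈ M, Commute a b) {d f : G}
    (hd : d ∈ D) (hd1 : d ≠ 1) (hf : f ∈ D) (hVf : fixedPts V f = ⊥) {x : G} (hx : x ∈ M)
    (hdx : Commute d x) : Commute f x := by
  by_contra hfx
  have hds := hD.pow_eq_one d hd
  have hBV := h.le_normalizer_left
  have hBW := h.le_normalizer_right
  set K := fixedPts M d with hK
  have hKM : K ≤ M := fixedPts_le
  have hDK : D ≤ normalizer (K : Set G) := fun g hg =>
    mem_normalizer_fixedPts (hDM hg) (hD.commute g hg d hd)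
  obtain ⟨K', hK'K, hfK', hK'1, hK'c⟩ := exists_commutator_subgroup h.ne_rs (hM.to_le hKM)
    (fun a ha b hb => hab a (hKM ha) b (hKM hb)) (hD.pow_eq_one f hf) (hDK hf)
  have hK'V : ∀ k ∈ K', ∀ v ∈ V, Commute k v := by
    refine commute_of_fixedPointFree h.ne_rs h.ne_pr.symm h.ne_ps.symm
      (hM.to_le (hK'K.trans hKM)) (hD.pow_eq_one f hf) hfK' h.isPGroup_left (hBV (hDB hf))
      (((hK'K.trans hKM).trans hMB).trans hBV) ?_ (fixedPts_eq_bot_iff.1 hVf)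
    intro k hk hkf v _
    rw [hK'1 k hk hkf]
    exact Commute.one_left v
  have hk := hK'c x (mem_fixedPts.2 ⟨hx, hdx⟩)
  have hk1 : ⁅x, f⁆ ≠ 1 := fun h1 => hfx (commutatorElement_eq_one_iff_commute.1 h1).symm
  generalize ⁅x, f⁆ = k at hk hk1
  have hkM : k ∈ M := hKM (hK'K hk)
  have hdk : Commute d k := (mem_fixedPts.1 (hK'K hk)).2
  have hkV := hK'V k hk
  have hWne : ∀ f' ∈ D, f' ∉ zpowers d → fixedPts W f' ≠ ⊥ := by
    intro f' hf' hf'd hW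
    refine hk1 (h.eq_one k (hMB hkM) hkV ?_)
    refine commute_of_fixedPointFree (K := K ⊓ centralizer (V : Set G)) h.ne_rs h.ne_qr.symm
      h.ne_qs.symm (hM.to_le (inf_le_left.trans hKM)) (hD.pow_eq_one f' hf') ?_ h.isPGroup_right
      (hBW (hDB hf')) (((inf_le_left.trans hKM).trans hMB).trans hBW) ?_
      (fixedPts_eq_bot_iff.1 hW) k ?_
    · refine mem_normalizer_of_conj_mem fun y hy => ⟨?_, ?_⟩
      · exact conj_mem_of_mem_normalizer (hDK hf') hy.1
      · exact conj_mem_of_mem_normalizer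
          (normalizer_le_normalizer_centralizer (hBV (hDB hf'))) hy.2
    · intro y hy hyf w _
      -- `y` commutes with `D` and centralises `V`
      obtain ⟨hyM, hdy⟩ := mem_fixedPts.1 hy.1
      have h1 : D ≤ centralizer {y} := hD.le_of_mem hd hf' hd1 hf'd
        (mem_centralizer_singleton_iff.2 hdy.eq) (mem_centralizer_singleton_iff.2 hyf.symm.eq)
      have h2 : y = 1 := by
        by_contra hy1
        obtain ⟨i, hi1, hir⟩ := exists_zpow_of_isPGroup hM hyM hy1
        obtain ⟨v, hv, hv1⟩ := exists_ne_one_of_ne_bot h.left_ne_bot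
        refine hv1 (fixedPts_eq_bot_iff.1 (h.fixedPts_left_eq_bot hNT hD hDB hir hi1 ?_) v hv ?_)
        · intro e he
          have h3 : Commute e y := mem_centralizer_singleton_iff.1 (h1 he)
          exact (h3.zpow_right i).symm
        · have h3 : Commute y v := (mem_centralizer_iff.1 hy.2 v hv).symm
          exact h3.zpow_left i
      rw [h2]
      exact Commute.one_left w
    · exact ⟨hK'K hk, mem_centralizer_iff.2 fun v hv => (hkV v hv).symm.eq⟩
  obtain ⟨e, he, he1, v, hv, hv1, hev⟩ := hD.exists_commute h.ne_ps.symm h.isPGroup_left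
    (hDB.trans hBV) h.left_ne_bot
  by_cases hed : e ∈ zpowers d
  · obtain ⟨i, hi⟩ := mem_zpowers_of_mem_of_prime hds hed he1
    have hi : e ^ i = d := hi
    have hdv : Commute d v := hi ▸ hev.zpow_left i
    exact hNT.false h.ne_pr h.ne_ps h.ne_rs h.isPGroup_left hM hD.isPGroup hv hkM hd hv1 hk1 hd1
      (hkV v hv).symm hdv.symm hdk.symm
  · rcases h.swap_primes.fixedPts_eq_bot_or hNT (hD.pow_eq_one e he) he1 with h1 | h1
    · exact hv1 (fixedPts_eq_bot_iff.1 h1 v hv hev)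
    · exact hWne e he hed h1

/-- A group of rank two for `s` in `B` centralises the abelian `r`-subgroups it normalises. -/
theorem commute_of_abelian (h : IsFaithfulOnPair p q r s V W B) {D M : Subgroup G}
    (hD : IsRankTwo s D) (hDB : D ≤ B) (hM : IsPGroup r M) (hMB : M ≤ B)
    (hDM : D ≤ normalizer (M : Set G)) (hab : ∀ a ∈ M, ∀ b ∈ M, Commute a b) :
    ∀ f ∈ D, ∀ x ∈ M, Commute f x := by
  have hle : M ≤ centralizer (D : Set G) := by
    refine hD.le_of_fixed_le h.ne_rs.symm hM hDM fun d hd hd1 x hx hdx => ?_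
    refine mem_centralizer_iff.2 fun f hf => ?_
    by_cases hf1 : f = 1
    · rw [hf1, one_mul, mul_one]
    rcases h.swap_primes.fixedPts_eq_bot_or hNT (hD.pow_eq_one f hf) hf1 with h1 | h1
    · exact (h.commute_of_fixedPts_eq_bot hNT hD hDB hM hMB hDM hab hd hd1 hf h1 hx hdx).eq
    · exact (h.swap.commute_of_fixedPts_eq_bot hNT hD hDB hM hMB hDM hab hd hd1 hf h1 hx hdx).eq
  exact fun f hf x hx => mem_centralizer_iff.1 (hle hx) f hf

/-- An element of order `r` commuting with a group of rank two for `s` is not the commutator of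
elements of order `r` that commute with it. -/
theorem commutator_eq_one (h : IsFaithfulOnPair p q r s V W B) {D : Subgroup G}
    (hD : IsRankTwo s D) (hDB : D ≤ B) {a b : G} (ha : a ∈ B) (hb : b ∈ B) (har : a ^ r = 1)
    (hzr : ⁅a⁻¹, b⁆ ^ r = 1) (haz : Commute a ⁅a⁻¹, b⁆) (hbz : Commute b ⁅a⁻¹, b⁆)
    (hzD : ∀ d ∈ D, Commute ⁅a⁻¹, b⁆ d) : ⁅a⁻¹, b⁆ = 1 := by
  by_contra hz1
  have ha1 : a ≠ 1 := by
    rintro rfl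
    exact hz1 (by simp)
  have hab : b * a * b⁻¹ = a * ⁅a⁻¹, b⁆ := by rw [commutatorElement_def]; group
  have hz : ⁅a⁻¹, b⁆ ∈ B := by
    rw [commutatorElement_def]
    exact mul_mem (mul_mem (mul_mem (inv_mem ha) hb) (inv_mem (inv_mem ha))) (inv_mem hb)
  have hBV := h.le_normalizer_left
  have hBW := h.le_normalizer_right
  rcases h.fixedPts_eq_bot_or hNT har ha1 with h1 | h1
  · exact fixedPts_ne_bot_of_conj h.ne_pr h.isPGroup_left h.left_ne_bot har hzr hz1 hab haz hbz
      (hBV ha) (hBV hb) (hBV hz) (h.fixedPts_left_eq_bot hNT hD hDB hzr hz1 hzD) h1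
  · exact fixedPts_ne_bot_of_conj h.ne_qr h.isPGroup_right h.right_ne_bot har hzr hz1 hab haz hbz
      (hBW ha) (hBW hb) (hBW hz) (h.swap.fixedPts_left_eq_bot hNT hD hDB hzr hz1 hzD) h1

/-- If the involution `z` inverts `V` and `W`, every other involution `t` of `B` acts without fixed
points on `V`: otherwise `t` inverts `W`, so `t z` centralises `W` and inverts `V`; hence `t`
centralises `V`, is central in `B`, and therefore has no fixed points on `V`. -/
theorem fixedPts_eq_bot_of_involution (h : IsFaithfulOnPair p q 2 s V W B) {D : Subgroup G}
    (hD : IsRankTwo s D) (hDB : D ≤ B) {z t : G} (hz : z ∈ B) (hz2 : z ^ 2 = 1)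
    (hzV : ∀ v ∈ V, z * v * z⁻¹ = v⁻¹) (hzW : ∀ w ∈ W, z * w * z⁻¹ = w⁻¹) (ht : t ∈ B)
    (ht2 : t ^ 2 = 1) (ht1 : t ≠ 1) (htz : t ≠ z) : fixedPts V t = ⊥ := by
  by_contra hne
  have hBV := h.le_normalizer_left
  have hBW := h.le_normalizer_right
  have hzt : Commute t z := h.commute_of_actsAsSign hz (Or.inr hzV) (Or.inr hzW) ht
  have htW := conj_eq_inv_of_fixedPts_eq_bot ht2 (hBW ht)
    ((h.fixedPts_eq_bot_or hNT ht2 ht1).resolve_left hne)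
  have htz2 : (t * z) ^ 2 = 1 := by rw [hzt.mul_pow, ht2, hz2, one_mul]
  have htz1 : t * z ≠ 1 := by
    intro h1
    rw [sq] at hz2
    exact htz (mul_right_cancel (h1.trans hz2.symm))
  have htzW : fixedPts W (t * z) ≠ ⊥ := by
    obtain ⟨w, hw, hw1⟩ := exists_ne_one_of_ne_bot h.right_ne_bot
    refine ne_bot_of_mem (mem_fixedPts.2 ⟨hw, ?_⟩) hw1
    have : t * z * w * (t * z)⁻¹ = w := by
      calc t * z * w * (t * z)⁻¹ = t * (z * w * z⁻¹) * t⁻¹ := by group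
        _ = w := by rw [hzW w hw, htW _ (inv_mem hw), inv_inv]
    exact mul_inv_eq_iff_eq_mul.1 this
  have htzV := conj_eq_inv_of_fixedPts_eq_bot htz2 (hBV (mul_mem ht hz))
    ((h.fixedPts_eq_bot_or hNT htz2 htz1).resolve_right htzW)
  have htV : ∀ v ∈ V, t * v * t⁻¹ = v := by
    intro v hv
    have h1 := htzV v⁻¹ (inv_mem hv)
    rw [inv_inv] at h1
    calc t * v * t⁻¹ = t * (z * v⁻¹ * z⁻¹) * t⁻¹ := by rw [hzV _ (inv_mem hv), inv_inv]
      _ = t * z * v⁻¹ * (t * z)⁻¹ := by group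
      _ = v := h1
  exact hne (h.fixedPts_left_eq_bot hNT hD hDB ht2 ht1 fun d hd =>
    (h.commute_of_actsAsSign ht (Or.inl htV) (Or.inr htW) (hDB hd)).symm)

/-- If `B` has rank at least two for the prime `2`, no involution of `B` commutes with a
group of rank two for `s`. -/
theorem false_of_involution (h : IsFaithfulOnPair p q 2 s V W B) {E D : Subgroup G}
    (hE : IsRankTwo 2 E) (hEB : E ≤ B) (hD : IsRankTwo s D) (hDB : D ≤ B) {z : G} (hz : z ∈ B)
    (hz2 : z ^ 2 = 1) (hz1 : z ≠ 1) (hzD : ∀ d ∈ D, Commute z d) : False := by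
  have hBV := h.le_normalizer_left
  have hBW := h.le_normalizer_right
  have hzV := conj_eq_inv_of_fixedPts_eq_bot hz2 (hBV hz)
    (h.fixedPts_left_eq_bot hNT hD hDB hz2 hz1 hzD)
  have hzW := conj_eq_inv_of_fixedPts_eq_bot hz2 (hBW hz)
    (h.swap.fixedPts_left_eq_bot hNT hD hDB hz2 hz1 hzD)
  obtain ⟨t, ht, htz⟩ : ∃ t ∈ E, t ∉ zpowers z := by
    by_cases hzE : z ∈ E
    · exact hE.exists_not_mem_zpowers hzE
    · obtain ⟨t, ht, ht1⟩ := hE.exists_ne_one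
      exact ⟨t, ht, fun htz => hzE
        ((zpowers_le.2 ht) (mem_zpowers_of_mem_of_prime hz2 htz ht1))⟩
  have ht1 : t ≠ 1 := by rintro rfl; exact htz (one_mem _)
  have htz' : t ≠ z := by rintro rfl; exact htz (mem_zpowers _)
  have ht2 := hE.pow_eq_one t ht
  have htV := conj_eq_inv_of_fixedPts_eq_bot ht2 (hBV (hEB ht))
    (h.fixedPts_eq_bot_of_involution hNT hD hDB hz hz2 hzV hzW (hEB ht) ht2 ht1 htz')
  have htW := conj_eq_inv_of_fixedPts_eq_bot ht2 (hBW (hEB ht))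
    (h.swap.fixedPts_eq_bot_of_involution hNT hD hDB hz hz2 hzW hzV (hEB ht) ht2 ht1 htz')
  -- `t` and `z` both invert `V` and `W`, hence are equal
  refine htz' ?_
  have h2 : ∀ (U : Subgroup G), (∀ v ∈ U, z * v * z⁻¹ = v⁻¹) → (∀ v ∈ U, t * v * t⁻¹ = v⁻¹) →
      ∀ v ∈ U, Commute (z⁻¹ * t) v := by
    intro U hzU htU v hv
    refine mul_inv_eq_iff_eq_mul.1 ?_
    have h3 := hzU v hv
    rw [← htU v hv] at h3
    calc z⁻¹ * t * v * (z⁻¹ * t)⁻¹ = z⁻¹ * (t * v * t⁻¹) * z := by group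
      _ = z⁻¹ * (z * v * z⁻¹) * z := by rw [h3]
      _ = v := by group
  have h3 := h.eq_one (z⁻¹ * t) (mul_mem (inv_mem hz) (hEB ht)) (h2 V hzV htV) (h2 W hzW htW)
  exact (inv_mul_eq_one.1 h3).symm

/-- If `B` has rank at least two for `r`, a group of rank two for `s` in `B` centralises all
`r`-subgroups of `B` it normalises. -/
theorem commute_of_isPGroup (h : IsFaithfulOnPair p q r s V W B) {E D R : Subgroup G}
    (hE : IsRankTwo r E) (hEB : E ≤ B) (hD : IsRankTwo s D) (hDB : D ≤ B) (hR : IsPGroup r R)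
    (hRB : R ≤ B) (hDR : D ≤ normalizer (R : Set G)) : ∀ d ∈ D, ∀ x ∈ R, Commute d x := by
  by_contra hne
  obtain ⟨M, hMR, hDM, hMne, hMD, hMc, hMexp⟩ := exists_special_subgroup h.ne_rs.symm hD.isPGroup
    hR le_normalizer hDR le_rfl hne
  have hMB := hMR.trans hRB
  have hM := hR.to_le hMR
  have hM'M : ⁅M, M⁆ ≤ M := commutator_le_self M
  refine hMne (h.commute_of_abelian hNT hD hDB hM hMB hDM ?_)
  by_cases hr2 : r = 2
  · subst hr2
    have hbot : ⁅M, M⁆ = ⊥ := by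
      by_contra hbot
      obtain ⟨z, hz, hz1, hz2⟩ := exists_pow_prime_order (hM.to_le hM'M) hbot
      exact h.false_of_involution hNT hE hEB hD hDB (hMB (hM'M hz)) hz2 hz1
        fun d hd => (hMD d hd z hz).symm
    intro a ha b hb
    exact commutatorElement_eq_one_iff_commute.1
      (mem_bot.1 (hbot ▸ commutator_mem_commutator ha hb))
  · intro a ha b hb
    have hz : ⁅a⁻¹, b⁆ ∈ ⁅M, M⁆ := commutator_mem_commutator (inv_mem ha) hb
    have h1 := h.commutator_eq_one hNT hD hDB (hMB ha) (hMB hb) (hMexp hr2 a ha)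
      (hMexp hr2 _ (hM'M hz)) (hMc _ hz a ha).symm (hMc _ hz b hb).symm
      fun d hd => (hMD d hd _ hz).symm
    exact Commute.inv_left_iff.1 (commutatorElement_eq_one_iff_commute.1 h1)

/-- The part of `IsFaithfulOnPair.false` in which `s` is odd. Then `O_s(B)` has rank one, say with
subgroup `⟨c⟩` of order `s`, and the group of rank two for `s` lies in the nilpotent normal subgroup
`C(O_r(B)) ∩ C(c)` of `B`. -/
theorem false_of_ne_two (h : IsFaithfulOnPair p q r s V W B) (hs2 : s ≠ 2)
    (hB : Group.IsSolvable B) (hBcard : ∀ u : ℕ, u.Prime → u ∣ Nat.card B → u = r ∨ u = s)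
    {E D : Subgroup G} (hE : IsRankTwo r E) (hEB : E ≤ B) (hD : IsRankTwo s D) (hDB : D ≤ B) :
    False := by
  have hDR : ∀ d ∈ D, ∀ x ∈ pcore r B, Commute d x := h.commute_of_isPGroup hNT hE hEB hD hDB
    isPGroup_pcore pcore_le (hDB.trans le_normalizer_pcore)
  have hES : ∀ e ∈ E, ∀ x ∈ pcore s B, Commute e x := h.swap_primes.commute_of_isPGroup hNT hD hDB
    hE hEB isPGroup_pcore pcore_le (hEB.trans le_normalizer_pcore)
  have hfit : ∀ (u : ℕ) (_ : u.Prime) (y : G) (k : ℕ), y ∈ B → y ^ u ^ k = 1 →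
      (∀ x ∈ pcore r B, Commute y x) → (∀ x ∈ pcore s B, Commute y x) → y ∈ pcore u B := by
    intro u hu y k hy hyk h1 h2
    have : Fact u.Prime := ⟨hu⟩
    refine mem_pcore_of_commute hB hy hyk fun v hv z hz => ?_
    by_cases hvB : v ∣ Nat.card B
    · rcases hBcard v hv hvB with rfl | rfl
      exacts [h1 z hz, h2 z hz]
    · rw [pcore_eq_bot_of_not_dvd hv hvB, mem_bot] at hz
      rw [hz]
      exact Commute.one_right y
  have hSne : pcore s B ≠ ⊥ := by
    intro hS
    obtain ⟨d, hd, hd1⟩ := hD.exists_ne_one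
    have h1 := hfit s hs.out d 1 (hDB hd) (by rw [pow_one]; exact hD.pow_eq_one d hd) (hDR d hd)
      (fun x hx => by rw [hS, mem_bot] at hx; rw [hx]; exact Commute.one_right d)
    exact hd1 (mem_bot.1 (hS ▸ h1))
  have hrank : ∀ D' ≤ pcore s B, ¬ IsRankTwo s D' := by
    intro D' hD'S hD'
    obtain ⟨e, he, he1, v, hv, hv1, hev⟩ := hE.exists_commute h.ne_pr.symm h.isPGroup_left
      (hEB.trans h.le_normalizer_left) h.left_ne_bot
    exact hv1 (fixedPts_eq_bot_iff.1 (h.fixedPts_left_eq_bot hNT hD' (hD'S.trans pcore_le)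
      (hE.pow_eq_one e he) he1 fun d hd => hES e he d (hD'S hd)) v hv hev)
  obtain ⟨c, hc, hc1, hcs, -, hcu⟩ := exists_unique_order isPGroup_pcore hSne hrank
  have hBc : B ≤ normalizer (zpowers c : Set G) := fun g hg =>
    mem_normalizer_zpowers hc hcs hcu (le_normalizer_pcore hg)
  have hDc : ∀ d ∈ D, Commute d c := by
    intro d hd
    by_contra hne
    have h1 := dvd_sub_one_of_not_commute (hD.pow_eq_one d hd) hcs
      (conj_mem_of_mem_normalizer (hBc (hDB hd)) (mem_zpowers c)) hne
    have h2 := Nat.le_of_dvd (Nat.sub_pos_of_lt hs.out.one_lt) h1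
    have := hs.out.one_lt
    omega
  set C := B ⊓ centralizer (pcore r B : Set G) ⊓ centralizer (zpowers c : Set G) with hC
  have hBC : B ≤ normalizer (C : Set G) := by
    intro g hg
    refine mem_normalizer_of_conj_mem fun n hn =>
      ⟨⟨B.mul_mem (B.mul_mem hg hn.1.1) (B.inv_mem hg), ?_⟩, ?_⟩
    · exact conj_mem_of_mem_normalizer
        (normalizer_le_normalizer_centralizer (le_normalizer_pcore hg)) hn.1.2
    · exact conj_mem_of_mem_normalizer (normalizer_le_normalizer_centralizer (hBc hg)) hn.2
  have hCcentral : ∀ u : ℕ, u.Prime → u ≠ s → ∀ y ∈ C, ∀ k : ℕ, y ^ u ^ k = 1 →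
      ∀ c ∈ C, Commute y c := by
    intro u hu hus y hy k hyk c' hc'
    have : Fact u.Prime := ⟨hu⟩
    have hyu : IsPGroup u (zpowers y) := isPGroup_zpowers_of_pow_pow_eq_one hyk
    have hyS : ∀ z ∈ pcore s B, Commute y z := by
      refine fun z hz => commute_of_unique_order hus hs2 hyu isPGroup_pcore
        ((zpowers_le.2 hy.1.1).trans le_normalizer_pcore) hcu ?_ y (mem_zpowers y) z hz
      rintro _ ⟨i, rfl⟩
      exact (mem_centralizer_zpowers_iff.1 hy.2).zpow_left i
    have hyR := hfit u hu y k hy.1.1 hyk (fun x hx => (mem_centralizer_iff.1 hy.1.2 x hx).symm) hyS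
    by_cases huB : u ∣ Nat.card B
    · obtain rfl := (hBcard u hu huB).resolve_right hus
      exact mem_centralizer_iff.1 hc'.1.2 y hyR
    · rw [pcore_eq_bot_of_not_dvd hu huB, mem_bot] at hyR
      rw [hyR]
      exact Commute.one_left c'
  refine hrank D (fun d hd => ?_) hD
  refine mem_pcore_of_central (k := 1) (inf_le_left.trans inf_le_left) hBC hCcentral
    ⟨⟨hDB hd, mem_centralizer_iff.2 fun x hx => (hDR d hd x hx).symm.eq⟩,
      mem_centralizer_zpowers_iff.2 (hDc d hd)⟩ ?_
  rw [pow_one]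
  exact hD.pow_eq_one d hd

/-- No solvable `{r, s}`-group of rank at least two for both primes acts faithfully on the product
of a `p`-group and a `q`-group. -/
theorem false (h : IsFaithfulOnPair p q r s V W B)
    (hB : Group.IsSolvable B) (hBcard : ∀ u : ℕ, u.Prime → u ∣ Nat.card B → u = r ∨ u = s)
    {E D : Subgroup G} (hE : IsRankTwo r E) (hEB : E ≤ B) (hD : IsRankTwo s D) (hDB : D ≤ B) :
    False := by
  by_cases hs2 : s = 2
  · exact h.swap_primes.false_of_ne_two hNT (fun hr2 => h.ne_rs (hr2.trans hs2.symm)) hB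
      (fun u hu hd => (hBcard u hu hd).symm) hD hDB hE hEB
  · exact h.false_of_ne_two hNT hs2 hB hBcard hE hEB hD hDB

end IsFaithfulOnPair
end TwoModules

/-! ### Groups of rank two for four primes -/

section FourPrimeGroups

variable {G : Type*} [Group G] [Finite G]

/-- The part of `false_of_rankTwo` in which `O_p(G)` is nontrivial. -/
theorem false_of_rankTwo_of_pcore (hNT : NoCommutingTriple G) {p q r s : ℕ} [hp : Fact p.Prime]
    [hq : Fact q.Prime] [hr : Fact r.Prime] [hs : Fact s.Prime] (hpq : p ≠ q) (hpr : p ≠ r)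
    (hps : p ≠ s) (hqr : q ≠ r) (hqs : q ≠ s) (hrs : r ≠ s) (hG : Group.IsSolvable (⊤ : Subgroup G))
    (hcard : ∀ u : ℕ, u.Prime → u ∣ Nat.card (⊤ : Subgroup G) → u = p ∨ u = q ∨ u = r ∨ u = s)
    {F E D : Subgroup G} (hF : IsRankTwo q F) (hE : IsRankTwo r E) (hD : IsRankTwo s D)
    (hP : pcore p (⊤ : Subgroup G) ≠ ⊥) : False := by
  have hnorm : ∀ (t : ℕ) (H : Subgroup G), H ≤ normalizer (pcore t (⊤ : Subgroup G) : Set G) :=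
    fun t H => le_top.trans le_normalizer_pcore
  -- if two of the groups `O_t(G)` are nontrivial, the others are trivial
  have hpair : ∀ {a b c : ℕ} [Fact a.Prime] [Fact b.Prime] [Fact c.Prime], p ≠ a → p ≠ b → p ≠ c →
      a ≠ b → a ≠ c → b ≠ c → ∀ {E D : Subgroup G}, IsRankTwo b E → IsRankTwo c D →
      (∀ u : ℕ, u.Prime → u ∣ Nat.card (⊤ : Subgroup G) → u = p ∨ u = a ∨ u = b ∨ u = c) →
      pcore a (⊤ : Subgroup G) ≠ ⊥ → False := by
    intro a b c ha hb hc hpa hpb hpc hab hac hbc E D hE hD hcard hQ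
    obtain ⟨v, hv, hv1⟩ := exists_ne_one_of_ne_bot hP
    obtain ⟨w, hw, hw1⟩ := exists_ne_one_of_ne_bot hQ
    have hbot : ∀ {t : ℕ} [Fact t.Prime], p ≠ t → a ≠ t → pcore t (⊤ : Subgroup G) = ⊥ := by
      intro t ht hpt hat
      by_contra hne
      obtain ⟨x, hx, hx1⟩ := exists_ne_one_of_ne_bot hne
      exact hNT.false hpa hpt hat isPGroup_pcore isPGroup_pcore isPGroup_pcore hv hw hx hv1 hw1 hx1
        (commute_pcore hpa v hv w hw) (commute_pcore hpt v hv x hx) (commute_pcore hat w hw x hx)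
    obtain ⟨B, hB⟩ := exists_isHall hG {b, c}
    obtain ⟨E, hEB, hE⟩ := hE.exists_conj le_top (hB.not_dvd_relIndex b hb.out (by simp))
    obtain ⟨D, hDB, hD⟩ := hD.exists_conj le_top (hB.not_dvd_relIndex c hc.out (by simp))
    have hBcard : ∀ u : ℕ, u.Prime → u ∣ Nat.card B → u = b ∨ u = c := fun u hu hd => by
      simpa using hB.mem_of_dvd_card u hu hd
    have hpairs :
        IsFaithfulOnPair p a b c (pcore p (⊤ : Subgroup G)) (pcore a (⊤ : Subgroup G)) B := by
      refine ⟨hpa, hpb, hpc, hab, hac, hbc, isPGroup_pcore, isPGroup_pcore, hP, hQ,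
        commute_pcore hpa, hnorm p B, hnorm a B, fun x hx hxV hxW => ?_⟩
      refine eq_one_of_commute_pcore hG le_top ?_ hx ?_
      · intro u hu hd
        rcases hBcard u hu hd with rfl | rfl
        exacts [hbot hpb hab, hbot hpc hac]
      · intro u hu y hy
        have : Fact u.Prime := ⟨hu⟩
        by_cases hup : p = u
        · subst hup; exact hxV y hy
        by_cases hua : a = u
        · subst hua; exact hxW y hy
        rw [hbot hup hua, mem_bot] at hy
        rw [hy]
        exact Commute.one_right x
    exact hpairs.false hNT (isSolvable_of_le hB.le hG) hBcard hE hEB hD hDB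
  by_cases hQ : pcore q (⊤ : Subgroup G) = ⊥
  swap
  · exact hpair hpq hpr hps hqr hqs hrs hE hD hcard hQ
  by_cases hR : pcore r (⊤ : Subgroup G) = ⊥
  swap
  · refine hpair hpr hpq hps hqr.symm hrs hqs hF hD (fun u hu hd => ?_) hR
    rcases hcard u hu hd with h | h | h | h <;> simp [h]
  by_cases hS : pcore s (⊤ : Subgroup G) = ⊥
  swap
  · refine hpair hps hpq hpr hqs.symm hrs.symm hqr hF hE (fun u hu hd => ?_) hS
    rcases hcard u hu hd with h | h | h | h <;> simp [h]
  obtain ⟨H, hH⟩ := exists_isHall hG {q, r, s}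
  obtain ⟨F, hFH, hF⟩ := hF.exists_conj le_top (hH.not_dvd_relIndex q hq.out (by simp))
  obtain ⟨E, hEH, hE⟩ := hE.exists_conj le_top (hH.not_dvd_relIndex r hr.out (by simp))
  obtain ⟨D, hDH, hD⟩ := hD.exists_conj le_top (hH.not_dvd_relIndex s hs.out (by simp))
  have hHcard : ∀ u : ℕ, u.Prime → u ∣ Nat.card H → u = q ∨ u = r ∨ u = s := fun u hu hd => by
    simpa using hH.mem_of_dvd_card u hu hd
  refine false_of_faithful hNT hpq hpr hps hqr hqs hrs (isPGroup_pcore (t := p) (H := ⊤))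
    (hnorm p H) ?_ (isSolvable_of_le hH.le hG) hHcard hF hFH hE hEH hD hDH
  intro x hx hxP
  refine eq_one_of_commute_pcore hG le_top ?_ hx ?_
  · intro u hu hd
    rcases hHcard u hu hd with rfl | rfl | rfl
    exacts [hQ, hR, hS]
  · intro u hu y hy
    by_cases huG : u ∣ Nat.card (⊤ : Subgroup G)
    · have hbot : u ≠ p → pcore u (⊤ : Subgroup G) = ⊥ := by
        intro hup
        rcases (hcard u hu huG).resolve_left hup with h | h | h <;> rw [h] <;> assumption
      by_cases hup : u = p
      · exact hxP y (hup ▸ hy)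
      · rw [hbot hup, mem_bot] at hy
        rw [hy]
        exact Commute.one_right x
    · rw [pcore_eq_bot_of_not_dvd hu huG, mem_bot] at hy
      rw [hy]
      exact Commute.one_right x

/-- A solvable `{p, q, r, s}`-group of rank at least two for the four primes contains commuting
elements of three distinct prime orders. -/
theorem false_of_rankTwo (hNT : NoCommutingTriple G) {p q r s : ℕ} [hp : Fact p.Prime]
    [hq : Fact q.Prime] [hr : Fact r.Prime] [hs : Fact s.Prime] (hpq : p ≠ q) (hpr : p ≠ r)
    (hps : p ≠ s) (hqr : q ≠ r) (hqs : q ≠ s) (hrs : r ≠ s) (hG : Group.IsSolvable (⊤ : Subgroup G))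
    (hcard : ∀ u : ℕ, u.Prime → u ∣ Nat.card (⊤ : Subgroup G) → u = p ∨ u = q ∨ u = r ∨ u = s)
    {C F E D : Subgroup G} (hC : IsRankTwo p C) (hF : IsRankTwo q F) (hE : IsRankTwo r E)
    (hD : IsRankTwo s D) : False := by
  obtain ⟨e, he, he1⟩ := hE.exists_ne_one
  obtain ⟨t, ht, hne⟩ := exists_pcore_ne_bot hG (ne_bot_of_mem (mem_top e) he1)
  have : Fact t.Prime := ⟨ht⟩
  rcases hcard t ht (dvd_card_of_pcore_ne_bot hne) with rfl | rfl | rfl | rfl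
  · exact false_of_rankTwo_of_pcore hNT hpq hpr hps hqr hqs hrs hG hcard hF hE hD hne
  · refine false_of_rankTwo_of_pcore hNT hpq.symm hqr hqs hpr hps hrs hG (fun u hu hd => ?_) hC hE
      hD hne
    rcases hcard u hu hd with h | h | h | h <;> simp [h]
  · refine false_of_rankTwo_of_pcore hNT hpr.symm hqr.symm hrs hpq hps hqs hG (fun u hu hd => ?_) hC
      hF hD hne
    rcases hcard u hu hd with h | h | h | h <;> simp [h]
  · refine false_of_rankTwo_of_pcore hNT hps.symm hqs.symm hrs.symm hpq hpr hqr hG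
      (fun u hu hd => ?_) hC hF hE hne
    rcases hcard u hu hd with h | h | h | h <;> simp [h]

end FourPrimeGroups

/-! ### Solvable groups with disconnected prime graph, and subgroups of rank two -/

section Higman

variable {G : Type*} [Group G]

/-- In the subgroup `H`, no elements of orders `q` and `r` commute. For distinct primes `q`, `r`
this says that they are not adjacent in the prime graph of `H`. -/
def NoEdge (H : Subgroup G) (q r : ℕ) : Prop :=
  ∀ x ∈ H, ∀ y ∈ H, x ^ q = 1 → y ^ r = 1 → Commute x y → x = 1 ∨ y = 1

theorem NoEdge.symm {H : Subgroup G} {q r : ℕ} (h : NoEdge H q r) : NoEdge H r q :=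
  fun x hx y hy hxr hyq hxy => (h y hy x hx hyq hxr hxy.symm).symm

theorem NoEdge.mono {H K : Subgroup G} {q r : ℕ} (h : NoEdge H q r) (hKH : K ≤ H) :
    NoEdge K q r :=
  fun x hx y hy => h x (hKH hx) y (hKH hy)

variable [Finite G]

theorem NoEdge.eq_one {H : Subgroup G} {q r : ℕ} [Fact q.Prime] [Fact r.Prime] (h : NoEdge H q r)
    {Q R : Subgroup G} (hQ : IsPGroup q Q) (hR : IsPGroup r R) {x y : G} (hx : x ∈ Q) (hy : y ∈ R)
    (hxH : x ∈ H) (hyH : y ∈ H) (hxy : Commute x y) (hx1 : x ≠ 1) : y = 1 := by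
  by_contra hy1
  obtain ⟨i, hi1, hi⟩ := exists_zpow_of_isPGroup hQ hx hx1
  obtain ⟨j, hj1, hj⟩ := exists_zpow_of_isPGroup hR hy hy1
  exact (h _ (zpow_mem hxH i) _ (zpow_mem hyH j) hi hj (hxy.zpow_zpow i j)).elim hi1 hj1

/-- The part of `false_of_noEdge` in which `O_q(H)` is nontrivial. Then a Hall `{r, s}`-subgroup
contains, for one of the two primes, a normal subgroup normalised without fixed points by an element
of the other prime order, and this configuration cannot act without fixed points on `O_q(H)`. -/
theorem false_of_noEdge_of_pcore {q r s : ℕ} [hq : Fact q.Prime] [hr : Fact r.Prime]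
    [hs : Fact s.Prime] (hqr : q ≠ r) (hqs : q ≠ s) (hrs : r ≠ s) {H : Subgroup G}
    (hH : Group.IsSolvable H) (hEqr : NoEdge H q r) (hEqs : NoEdge H q s) (hErs : NoEdge H r s)
    {y z : G} (hy : y ∈ H) (hz : z ∈ H) (hy1 : y ≠ 1) (hz1 : z ≠ 1) (hyr : y ^ r = 1)
    (hzs : z ^ s = 1) (hQ : pcore q H ≠ ⊥) : False := by
  obtain ⟨B, hB⟩ := exists_isHall hH {r, s}
  obtain ⟨y, hyB, hy1, hyr⟩ := hB.exists_mem_of_mem (p := r) (by simp) hy hy1 hyr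
  obtain ⟨z, hzB, hz1, hzs⟩ := hB.exists_mem_of_mem (p := s) (by simp) hz hz1 hzs
  have hBQ : B ≤ normalizer (pcore q H : Set G) := hB.le.trans le_normalizer_pcore
  have key : ∀ {u v : ℕ} [Fact u.Prime] [Fact v.Prime], q ≠ u → q ≠ v → u ≠ v → NoEdge H q u →
      NoEdge H q v → NoEdge H u v → ∀ d ∈ B, d ^ v = 1 → d ≠ 1 → pcore u B ≠ ⊥ → False := by
    intro u v hu hv hqu hqv huv h1 h2 h3 d hd hdv hd1 hne
    obtain ⟨k, hk, hk1⟩ := exists_ne_one_of_ne_bot hne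
    obtain ⟨x, hx, hx1⟩ := exists_ne_one_of_ne_bot hQ
    have hcomm := commute_of_fixedPointFree huv hqu.symm hqv.symm (isPGroup_pcore (t := u) (H := B))
      hdv (le_normalizer_pcore hd) (isPGroup_pcore (t := q) (H := H)) (hBQ hd)
      (pcore_le.trans hBQ) ?_ ?_ k hk x hx
    · exact hk1 (h1.eq_one isPGroup_pcore isPGroup_pcore hx hk (pcore_le hx)
        (hB.le (pcore_le hk)) hcomm.symm hx1)
    · intro k hk hkd x _
      rw [h3.symm.eq_one (isPGroup_zpowers_of_pow_eq_one hdv) isPGroup_pcore (mem_zpowers d) hk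
        (hB.le hd) (hB.le (pcore_le hk)) hkd.symm hd1]
      exact Commute.one_left x
    · intro x hx hdx
      exact h2.symm.eq_one (isPGroup_zpowers_of_pow_eq_one hdv) isPGroup_pcore (mem_zpowers d) hx
        (hB.le hd) (pcore_le hx) hdx hd1
  obtain ⟨t, ht, hne⟩ := exists_pcore_ne_bot (isSolvable_of_le hB.le hH) (ne_bot_of_mem hyB hy1)
  have : Fact t.Prime := ⟨ht⟩
  have htB : t = r ∨ t = s := by simpa using hB.mem_of_dvd_card t ht (dvd_card_of_pcore_ne_bot hne)
  rcases htB with rfl | rfl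
  · exact key hqr hqs hrs hEqr hEqs hErs z hzB hzs hz1 hne
  · exact key hqs hqr hrs.symm hEqs hEqr hErs.symm y hyB hyr hy1 hne

/-- The prime graph of a solvable group has no three pairwise nonadjacent vertices. -/
theorem false_of_noEdge {q r s : ℕ} [hq : Fact q.Prime] [hr : Fact r.Prime] [hs : Fact s.Prime]
    (hqr : q ≠ r) (hqs : q ≠ s) (hrs : r ≠ s) {H : Subgroup G} (hH : Group.IsSolvable H)
    (hEqr : NoEdge H q r) (hEqs : NoEdge H q s) (hErs : NoEdge H r s) {x y z : G} (hx : x ∈ H)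
    (hy : y ∈ H) (hz : z ∈ H) (hx1 : x ≠ 1) (hy1 : y ≠ 1) (hz1 : z ≠ 1) (hxq : x ^ q = 1)
    (hyr : y ^ r = 1) (hzs : z ^ s = 1) : False := by
  obtain ⟨K, hK⟩ := exists_isHall hH {q, r, s}
  obtain ⟨x, hxK, hx1, hxq⟩ := hK.exists_mem_of_mem (p := q) (by simp) hx hx1 hxq
  obtain ⟨y, hyK, hy1, hyr⟩ := hK.exists_mem_of_mem (p := r) (by simp) hy hy1 hyr
  obtain ⟨z, hzK, hz1, hzs⟩ := hK.exists_mem_of_mem (p := s) (by simp) hz hz1 hzs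
  have hKs := isSolvable_of_le hK.le hH
  replace hEqr := hEqr.mono hK.le
  replace hEqs := hEqs.mono hK.le
  replace hErs := hErs.mono hK.le
  obtain ⟨t, ht, hne⟩ := exists_pcore_ne_bot hKs (ne_bot_of_mem hyK hy1)
  have : Fact t.Prime := ⟨ht⟩
  have htK : t = q ∨ t = r ∨ t = s := by
    simpa using hK.mem_of_dvd_card t ht (dvd_card_of_pcore_ne_bot hne)
  rcases htK with rfl | rfl | rfl
  · exact false_of_noEdge_of_pcore hqr hqs hrs hKs hEqr hEqs hErs hyK hzK hy1 hz1 hyr hzs hne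
  · exact false_of_noEdge_of_pcore hqr.symm hrs hqs hKs hEqr.symm hErs hEqs hxK hzK hx1 hz1 hxq hzs
      hne
  · exact false_of_noEdge_of_pcore hqs.symm hrs.symm hqr hKs hEqs.symm hErs.symm hEqr hxK hyK hx1
      hy1 hxq hyr hne

/-- If `p` is adjacent to `q`, `r`, `s` in the prime graph of a solvable group, while no element
of order `p` commutes with commuting elements of two further orders among these, then there is an
elementary abelian `p`-subgroup of rank two. Otherwise all subgroups of order `p` are conjugate, so
that a single element of order `p` commutes with elements of orders `q`, `r` and `s`; these three
primes are pairwise nonadjacent in its centralizer. -/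
theorem exists_isRankTwo {p q r s : ℕ} [hp : Fact p.Prime] [hq : Fact q.Prime] [hr : Fact r.Prime]
    [hs : Fact s.Prime] (hqr : q ≠ r) (hqs : q ≠ s) (hrs : r ≠ s)
    (hG : Group.IsSolvable (⊤ : Subgroup G))
    (hedge : ∀ t : ℕ, t = q ∨ t = r ∨ t = s →
      ∃ x y : G, x ^ p = 1 ∧ y ^ t = 1 ∧ x ≠ 1 ∧ y ≠ 1 ∧ Commute x y)
    (hE : ∀ c : G, c ^ p = 1 → c ≠ 1 → NoEdge (centralizer {c}) q r ∧
      NoEdge (centralizer {c}) q s ∧ NoEdge (centralizer {c}) r s) :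
    ∃ E : Subgroup G, IsRankTwo p E := by
  by_contra! hrank
  obtain ⟨P⟩ : Nonempty (Sylow p G) := inferInstance
  have hindex : ¬ p ∣ (P : Subgroup G).relIndex ⊤ := by
    rw [relIndex_top_right]
    exact P.not_dvd_index
  have hconj : ∀ x : G, x ^ p = 1 → ∃ g : G, g⁻¹ * x * g ∈ (P : Subgroup G) := by
    intro x hx
    obtain ⟨g, -, hg⟩ := exists_conj_mem (isPGroup_zpowers_of_pow_eq_one hx) le_top hindex
    exact ⟨g, hg x (mem_zpowers x)⟩
  have hconj_pow : ∀ (g x : G) (n : ℕ), x ^ n = 1 → (g⁻¹ * x * g) ^ n = 1 := by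
    intro g x n hx
    have := conj_pow (i := n) (a := g⁻¹) (b := x)
    rw [inv_inv] at this
    rw [this, hx]; group
  have hconj_ne : ∀ g x : G, x ≠ 1 → g⁻¹ * x * g ≠ 1 := by
    intro g x hx h1
    refine hx ?_
    calc x = g * (g⁻¹ * x * g) * g⁻¹ := by group
      _ = 1 := by rw [h1]; group
  have hPne : (P : Subgroup G) ≠ ⊥ := by
    obtain ⟨x, -, hx, -, hx1, -, -⟩ := hedge q (Or.inl rfl)
    obtain ⟨g, hg⟩ := hconj x hx
    exact ne_bot_of_mem hg (hconj_ne g x hx1)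
  obtain ⟨c, hc, hc1, hcp, -, hcu⟩ := exists_unique_order P.2 hPne fun E _ => hrank E
  have hex : ∀ t : ℕ, t = q ∨ t = r ∨ t = s → ∃ y ∈ centralizer {c}, y ≠ 1 ∧ y ^ t = 1 := by
    intro t ht
    obtain ⟨x, y, hxp, hyt, hx1, hy1, hxy⟩ := hedge t ht
    obtain ⟨g, hg⟩ := hconj x hxp
    refine ⟨g⁻¹ * y * g, ?_, hconj_ne g y hy1, hconj_pow g y t hyt⟩
    obtain ⟨i, hi⟩ := mem_zpowers_of_mem_of_prime hcp (hcu _ hg (hconj_pow g x p hxp))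
      (hconj_ne g x hx1)
    have hi : (g⁻¹ * x * g) ^ i = c := hi
    have h1 : Commute (g⁻¹ * x * g) (g⁻¹ * y * g) := by
      change g⁻¹ * x * g * (g⁻¹ * y * g) = g⁻¹ * y * g * (g⁻¹ * x * g)
      calc g⁻¹ * x * g * (g⁻¹ * y * g) = g⁻¹ * (x * y) * g := by group
        _ = g⁻¹ * (y * x) * g := by rw [hxy.eq]
        _ = g⁻¹ * y * g * (g⁻¹ * x * g) := by group
    rw [mem_centralizer_singleton_iff, ← hi]
    exact (h1.zpow_left i).symm.eq
  obtain ⟨x, hx, hx1, hxq⟩ := hex q (by simp)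
  obtain ⟨y, hy, hy1, hyr⟩ := hex r (by simp)
  obtain ⟨z, hz, hz1, hzs⟩ := hex s (by simp)
  obtain ⟨h1, h2, h3⟩ := hE c hcp hc1
  exact false_of_noEdge hqr hqs hrs (isSolvable_of_le le_top hG) h1 h2 h3 hx hy hz hx1 hy1 hz1 hxq
    hyr hzs

end Higman

/-! ### Element orders -/

section Spectrum

theorem mul_mem_groupSpectrum_of_dvd {G : Type*} [Group G] [Finite G] {a b : ℕ} (ha : a.Prime)
    (hb : b.Prime) (hab : a ≠ b) {x : G} (hax : a ∣ orderOf x) (hbx : b ∣ orderOf x) :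
    a * b ∈ groupSpectrum G := by
  have h1 : a * b ∣ orderOf x :=
    Nat.Coprime.mul_dvd_of_dvd_of_dvd ((Nat.coprime_primes ha hb).2 hab) hax hbx
  exact ⟨x ^ (orderOf x / (a * b)), orderOf_pow_orderOf_div (orderOf_pos x).ne' h1⟩

theorem mul_mem_groupSpectrum_prod {L : Type*} [Group L] [Finite L] {a b : ℕ} (ha : a.Prime)
    (hb : b.Prime) (hab : a ≠ b) (haL : a ∣ Nat.card L) (hbL : b ∣ Nat.card L) :
    a * b ∈ groupSpectrum (L × L) := by
  have : Fact a.Prime := ⟨ha⟩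
  have : Fact b.Prime := ⟨hb⟩
  obtain ⟨x, hx⟩ := exists_prime_orderOf_dvd_card' a haL
  obtain ⟨y, hy⟩ := exists_prime_orderOf_dvd_card' b hbL
  refine ⟨(x, y), ?_⟩
  change orderOf (x, y) = a * b
  rw [Prod.orderOf_mk, hx, hy]
  exact ((Nat.coprime_primes ha hb).2 hab).lcm_eq_mul

/-- Of three primes dividing the order of `(x, y)`, two divide the order of `x` or that of `y`. -/
theorem mul_mul_notMem_groupSpectrum_prod {L : Type*} [Group L] [Finite L] {a b c : ℕ}
    (ha : a.Prime) (hb : b.Prime) (hc : c.Prime) (hab : a ≠ b) (hac : a ≠ c) (hbc : b ≠ c)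
    (h1 : a * b ∉ groupSpectrum L) (h2 : a * c ∉ groupSpectrum L) (h3 : b * c ∉ groupSpectrum L) :
    a * b * c ∉ groupSpectrum (L × L) := by
  rintro ⟨⟨x, y⟩, hxy⟩
  have hxy : orderOf (x, y) = a * b * c := hxy
  rw [Prod.orderOf_mk] at hxy
  have key : ∀ t : ℕ, t.Prime → t ∣ a * b * c → t ∣ orderOf x ∨ t ∣ orderOf y := by
    intro t ht hd
    rw [← hxy] at hd
    exact ht.dvd_mul.1 (hd.trans (Nat.lcm_dvd_mul _ _))
  have hA := key a ha ((Dvd.intro _ rfl).trans (Dvd.intro _ rfl))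
  have hB := key b hb ((Dvd.intro_left _ rfl).trans (Dvd.intro _ rfl))
  have hC := key c hc (Dvd.intro_left _ rfl)
  have n1 : ∀ u : L, a ∣ orderOf u → b ∣ orderOf u → False := fun u hu hv =>
    h1 (mul_mem_groupSpectrum_of_dvd ha hb hab hu hv)
  have n2 : ∀ u : L, a ∣ orderOf u → c ∣ orderOf u → False := fun u hu hv =>
    h2 (mul_mem_groupSpectrum_of_dvd ha hc hac hu hv)
  have n3 : ∀ u : L, b ∣ orderOf u → c ∣ orderOf u → False := fun u hu hv =>
    h3 (mul_mem_groupSpectrum_of_dvd hb hc hbc hu hv)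
  rcases hA with hA | hA <;> rcases hB with hB | hB
  · exact n1 x hA hB
  · exact hC.elim (n2 x hA) (n3 y hB)
  · exact hC.elim (n3 x hB) (n2 y hA)
  · exact n1 y hA hB

variable {G : Type*} [Group G]

theorem exists_commute_of_mul_mem_groupSpectrum {a b : ℕ} (ha : a.Prime) (hb : b.Prime)
    (h : a * b ∈ groupSpectrum G) :
    ∃ x y : G, x ^ a = 1 ∧ y ^ b = 1 ∧ x ≠ 1 ∧ y ≠ 1 ∧ Commute x y := by
  obtain ⟨g, hg⟩ := h
  have hg : orderOf g = a * b := hg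
  have h1 : g ^ (a * b) = 1 := hg ▸ pow_orderOf_eq_one g
  refine ⟨g ^ b, g ^ a, ?_, ?_, fun h => ?_, fun h => ?_, (Commute.refl g).pow_pow b a⟩
  · rw [← pow_mul, mul_comm, h1]
  · rw [← pow_mul, h1]
  · have h2 := Nat.le_of_dvd hb.pos (hg ▸ orderOf_dvd_of_pow_eq_one h)
    exact absurd h2 (not_le.2 (lt_mul_of_one_lt_left hb.pos ha.one_lt))
  · have h2 := Nat.le_of_dvd ha.pos (hg ▸ orderOf_dvd_of_pow_eq_one h)
    exact absurd h2 (not_le.2 (lt_mul_of_one_lt_right ha.pos hb.one_lt))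

theorem eq_one_of_mul_mul_notMem_groupSpectrum {a b c : ℕ} (ha : a.Prime) (hb : b.Prime)
    (hc : c.Prime) (hab : a ≠ b) (hac : a ≠ c) (hbc : b ≠ c) (h : a * b * c ∉ groupSpectrum G)
    {x y z : G} (hx : x ^ a = 1) (hy : y ^ b = 1) (hz : z ^ c = 1) (hxy : Commute x y)
    (hxz : Commute x z) (hyz : Commute y z) : x = 1 ∨ y = 1 ∨ z = 1 := by
  by_contra! hne
  have : Fact a.Prime := ⟨ha⟩
  have : Fact b.Prime := ⟨hb⟩
  have : Fact c.Prime := ⟨hc⟩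
  have hx' := orderOf_eq_prime hx hne.1
  have hy' := orderOf_eq_prime hy hne.2.1
  have hz' := orderOf_eq_prime hz hne.2.2
  have h1 : orderOf (x * y) = a * b := by
    rw [hxy.orderOf_mul_eq_mul_orderOf_of_coprime, hx', hy']
    rw [hx', hy']
    exact (Nat.coprime_primes ha hb).2 hab
  refine h ⟨x * y * z, ?_⟩
  change orderOf (x * y * z) = a * b * c
  rw [(hxz.mul_left hyz).orderOf_mul_eq_mul_orderOf_of_coprime, h1, hz']
  rw [h1, hz']
  exact Nat.Coprime.mul_left ((Nat.coprime_primes ha hc).2 hac) ((Nat.coprime_primes hb hc).2 hbc)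

theorem IsRankTwo.subgroupOf {a : ℕ} {E T : Subgroup G} (hE : IsRankTwo a E) (hET : E ≤ T) :
    IsRankTwo a (E.subgroupOf T) :=
  ⟨(Nat.card_congr (subgroupOfEquivOfLe hET).toEquiv).trans hE.card_eq,
    fun x hx => Subtype.ext (hE.pow_eq_one x (mem_subgroupOf.1 hx)),
    fun x hx y hy => Subtype.ext (hE.commute x (mem_subgroupOf.1 hx) y (mem_subgroupOf.1 hy))⟩

variable [Finite G]

/-- A finite group with elements of order `a * b` for any two of four primes, but none of order
`a * b * c` for any three of them, is not solvable. -/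
theorem not_isSolvable_of_groupSpectrum {p q r s : ℕ} (hp : p.Prime) (hq : q.Prime) (hr : r.Prime)
    (hs : s.Prime) (hpq : p ≠ q) (hpr : p ≠ r) (hps : p ≠ s) (hqr : q ≠ r) (hqs : q ≠ s)
    (hrs : r ≠ s)
    (h2 : ∀ a ∈ ({p, q, r, s} : Set ℕ), ∀ b ∈ ({p, q, r, s} : Set ℕ), a ≠ b →
      a * b ∈ groupSpectrum G)
    (h3 : ∀ a ∈ ({p, q, r, s} : Set ℕ), ∀ b ∈ ({p, q, r, s} : Set ℕ),
      ∀ c ∈ ({p, q, r, s} : Set ℕ), a ≠ b → a ≠ c → b ≠ c → a * b * c ∉ groupSpectrum G) :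
    ¬ Group.IsSolvable G := by
  intro hsol
  have hG : Group.IsSolvable (⊤ : Subgroup G) :=
    Group.isSolvable_of_isSolvable_injective (f := (⊤ : Subgroup G).subtype) (subtype_injective _)
  have hprime : ∀ a ∈ ({p, q, r, s} : Set ℕ), a.Prime := by
    rintro a (rfl | rfl | rfl | rfl) <;> assumption
  have hmem : p ∈ ({p, q, r, s} : Set ℕ) ∧ q ∈ ({p, q, r, s} : Set ℕ) ∧
      r ∈ ({p, q, r, s} : Set ℕ) ∧ s ∈ ({p, q, r, s} : Set ℕ) := by simp
  obtain ⟨hpA, hqA, hrA, hsA⟩ := hmem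
  obtain ⟨T, hT⟩ := exists_isHall hG ({p, q, r, s} : Set ℕ)
  have hrank : ∀ a ∈ ({p, q, r, s} : Set ℕ), ∀ b ∈ ({p, q, r, s} : Set ℕ),
      ∀ c ∈ ({p, q, r, s} : Set ℕ), ∀ d ∈ ({p, q, r, s} : Set ℕ), a ≠ b → a ≠ c → a ≠ d → b ≠ c →
      b ≠ d → c ≠ d → ∃ E : Subgroup T, IsRankTwo a E := by
    intro a ha b hb c hc d hd hab hac had hbc hbd hcd
    have : Fact a.Prime := ⟨hprime a ha⟩
    have : Fact b.Prime := ⟨hprime b hb⟩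
    have : Fact c.Prime := ⟨hprime c hc⟩
    have : Fact d.Prime := ⟨hprime d hd⟩
    have hadj := fun t (ht : t ∈ ({p, q, r, s} : Set ℕ)) (hat : a ≠ t) =>
      exists_commute_of_mul_mem_groupSpectrum (hprime a ha) (hprime t ht) (h2 a ha t ht hat)
    obtain ⟨E, hE⟩ : ∃ E : Subgroup G, IsRankTwo a E := by
      refine exists_isRankTwo hbc hbd hcd hG ?_ fun e hea he1 => ?_
      · rintro t (rfl | rfl | rfl)
        exacts [hadj t hb hab, hadj t hc hac, hadj t hd had]
      · have key : ∀ u ∈ ({p, q, r, s} : Set ℕ), ∀ v ∈ ({p, q, r, s} : Set ℕ), a ≠ u → a ≠ v →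
            u ≠ v → NoEdge (centralizer {e}) u v := by
          intro u hu v hv hau hav huv x hx y hy hxu hyv hxy
          exact (eq_one_of_mul_mul_notMem_groupSpectrum (hprime a ha) (hprime u hu) (hprime v hv)
            hau hav huv (h3 a ha u hu v hv hau hav huv) hea hxu hyv
            (mem_centralizer_singleton_iff.1 hx).symm (mem_centralizer_singleton_iff.1 hy).symm
            hxy).resolve_left he1
        exact ⟨key b hb c hc hab hac hbc, key b hb d hd hab had hbd, key c hc d hd hac had hcd⟩
    obtain ⟨E', hE'T, hE'⟩ := hE.exists_conj le_top (hT.not_dvd_relIndex a (hprime a ha) ha)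
    exact ⟨E'.subgroupOf T, hE'.subgroupOf hE'T⟩
  have hTdvd : ∀ u : ℕ, u.Prime → u ∣ Nat.card (⊤ : Subgroup T) → u ∈ ({p, q, r, s} : Set ℕ) := by
    intro u hu hd
    rw [card_top] at hd
    exact hT.mem_of_dvd_card u hu hd
  have hNT : NoCommutingTriple T := by
    intro a b c ha hb hc hab hac hbc x y z hx hy hz hxy hxz hyz
    have hdvd : ∀ {u : ℕ} (_ : u.Prime) {g : T}, g ^ u = 1 → g ≠ 1 →
        u ∈ ({p, q, r, s} : Set ℕ) := by
      intro u hu g hg hg1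
      have : Fact u.Prime := ⟨hu⟩
      exact hT.mem_of_dvd_card u hu (orderOf_eq_prime hg hg1 ▸ orderOf_dvd_natCard g)
    by_contra! hne
    have h4 := eq_one_of_mul_mul_notMem_groupSpectrum ha hb hc hab hac hbc
      (h3 a (hdvd ha hx hne.1) b (hdvd hb hy hne.2.1) c (hdvd hc hz hne.2.2) hab hac hbc)
      (congrArg Subtype.val hx) (congrArg Subtype.val hy) (congrArg Subtype.val hz)
      (hxy.map T.subtype) (hxz.map T.subtype) (hyz.map T.subtype)
    rcases h4 with h | h | h
    exacts [hne.1 (Subtype.ext h), hne.2.1 (Subtype.ext h), hne.2.2 (Subtype.ext h)]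
  have hTsol : Group.IsSolvable (⊤ : Subgroup T) :=
    Group.isSolvable_of_isSolvable_injective (f := T.subtype.comp (⊤ : Subgroup T).subtype)
      (T.subtype_injective.comp (subtype_injective _))
  have : Fact p.Prime := ⟨hp⟩
  have : Fact q.Prime := ⟨hq⟩
  have : Fact r.Prime := ⟨hr⟩
  have : Fact s.Prime := ⟨hs⟩
  obtain ⟨C, hC⟩ := hrank p hpA q hqA r hrA s hsA hpq hpr hps hqr hqs hrs
  obtain ⟨F, hF⟩ := hrank q hqA p hpA r hrA s hsA hpq.symm hqr hqs hpr hps hrs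
  obtain ⟨E, hE⟩ := hrank r hrA p hpA q hqA s hsA hpr.symm hqr.symm hrs hpq hps hqs
  obtain ⟨D, hD⟩ := hrank s hsA p hpA q hqA r hrA hps.symm hqs.symm hrs.symm hpq hpr hqr
  exact false_of_rankTwo hNT hpq hpr hps hqr hqs hrs hTsol hTdvd hC hF hE hD

end Spectrum

end FourPrimes

theorem corollary1 {L : Type*} [Group L] [Finite L] (hL : 4 ≤ primeGraphIndepNum L)
    {G : Type*} [Group G] [Finite G] (hG : groupSpectrum G = groupSpectrum (L × L)) :
    ¬ Group.IsSolvable G := by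
  obtain ⟨t, ht⟩ := (primeGraph L).exists_isNIndepSet_indepNum
  obtain ⟨u, hut, hu⟩ := Finset.exists_subset_card_eq (hL.trans_eq ht.card_eq.symm)
  obtain ⟨p, q, r, s, hpq, hpr, hps, hqr, hqs, hrs, rfl⟩ := Finset.card_eq_four.1 hu
  have hindep : ∀ a ∈ ({p, q, r, s} : Finset _), ∀ b ∈ ({p, q, r, s} : Finset _), a ≠ b →
      (a : ℕ) * (b : ℕ) ∉ groupSpectrum L := fun a ha b hb hab h =>
    ht.isIndepSet (hut ha) (hut hb) hab ⟨hab, h⟩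
  have hprime : ∀ a : (Nat.card L).primeFactors, (a : ℕ).Prime := fun a =>
    Nat.prime_of_mem_primeFactors a.2
  have hdvd : ∀ a : (Nat.card L).primeFactors, (a : ℕ) ∣ Nat.card L := fun a =>
    Nat.dvd_of_mem_primeFactors a.2
  have hlift : ∀ a ∈ ({(p : ℕ), (q : ℕ), (r : ℕ), (s : ℕ)} : Set ℕ),
      ∃ a' ∈ ({p, q, r, s} : Finset (Nat.card L).primeFactors), (a' : ℕ) = a := by
    rintro a (rfl | rfl | rfl | rfl)
    exacts [⟨p, by simp, rfl⟩, ⟨q, by simp, rfl⟩, ⟨r, by simp, rfl⟩, ⟨s, by simp, rfl⟩]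
  refine FourPrimes.not_isSolvable_of_groupSpectrum (hprime p) (hprime q) (hprime r) (hprime s)
    (Subtype.coe_ne_coe.2 hpq) (Subtype.coe_ne_coe.2 hpr) (Subtype.coe_ne_coe.2 hps)
    (Subtype.coe_ne_coe.2 hqr) (Subtype.coe_ne_coe.2 hqs) (Subtype.coe_ne_coe.2 hrs) ?_ ?_
  · intro a ha b hb hab
    obtain ⟨a, -, rfl⟩ := hlift a ha
    obtain ⟨b, -, rfl⟩ := hlift b hb
    rw [hG]
    exact FourPrimes.mul_mem_groupSpectrum_prod (hprime a) (hprime b) hab (hdvd a) (hdvd b)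
  · intro a ha b hb c hc hab hac hbc
    obtain ⟨a, ha', rfl⟩ := hlift a ha
    obtain ⟨b, hb', rfl⟩ := hlift b hb
    obtain ⟨c, hc', rfl⟩ := hlift c hc
    rw [hG]
    exact FourPrimes.mul_mul_notMem_groupSpectrum_prod (hprime a) (hprime b) (hprime c) hab hac hbc
      (hindep a ha' b hb' (Subtype.coe_ne_coe.1 hab))
      (hindep a ha' c hc' (Subtype.coe_ne_coe.1 hac))
      (hindep b hb' c hc' (Subtype.coe_ne_coe.1 hbc))
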